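/- Let $\beta\in\mathbb R^d$, let $\Sigma\in\mathbb R^{d\times d}$ be symmetric positive definite, and let $\delta>0$, $\zeta\in(0,1)$ with $\delta+\zeta>1$. For $\gamma\in(0,1)$ put $m(\gamma)=\lfloor\gamma^{-\delta}\rfloor$ (number of firms), $T(\gamma)=\lfloor\gamma^{-\zeta}\rfloor$ (number of periods) and $\alpha(\gamma)=\log(1/\gamma)$, which is assumed known. *Covariates.* For each $\gamma$ the covariate vectors $V_{i,t}\in\mathbb R^d$ ($1\le i\le m(\gamma)$, $0\le t<T(\gamma)$) are jointly Gaussian, each $V_{i,t}$ is $N(0,\Sigma)$ distributed, and for constants $K$ and $\rho\in(0,1)$ independent of $\gamma$ the operator norms satisfy $\|E(V_{i,t}V_{j,t+k}^{\intercal})\|\le K\rho^k$ for all $i,j,t$ and $k\ge 0$. *Defaults.* Let $h:\mathbb R\to\mathbb R$ be three times differentiable such that $q(x)=e^x(1+h(x))\in[0,1]$ for all $x$. Suppose that, with $V\sim N(0,\Sigma)$, there is a constant $C$ such that for all small enough $\gamma>0$ and $k=0,1,2,3$ the random variable $\frac1\gamma h^{(k)}(\beta^{\intercal}V-\alpha(\gamma))$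 is integrable with $E\big|\frac1\gamma h^{(k)}(\beta^{\intercal}V-\alpha(\gamma))\big|\le C$. Let $D_{i,t+1}\in\{0,1\}$ indicate that firm $i$ defaults between times $t$ and $t+1$, let $\tau_i=\min\{T(\gamma)-1,\min\{t\ge0:D_{i,t+1}=1\}\}$, and let $\mathcal F_t$ be the $\sigma$-algebra generated by $V_{i,s}$, $s\le t$, and $D_{i,s}$, $1\le s\le t$, $i\le m(\gamma)$. Given $\mathcal F_t$, the variables $D_{i,t+1}$, $i\le m(\gamma)$, are independent, and $$P(D_{i,t+1}=1\mid\mathcal F_t)=q(\beta^{\intercal}V_{i,t}-\alpha(\gamma))\,\mathbb I(\tau_i\ge t).$$ *Estimator.* Let the random vector $\hat\beta_{M}(\gamma)$ be the maximum likelihood estimator, i.e. almost surely, whenever the likelihood $$\mathcal L(b)=\prod_{i\le m(\gamma)}\prod_{t=0}^{\tau_i}q(b^{\intercal}V_{i,t}-\alpha(\gamma))^{D_{i,t+1}}\big(1-q(b^{\intercal}V_{i,t}-\alpha(\gamma))\big)^{1-D_{i,t+1}}$$ attains its maximum over $b\in\mathbb R^d$, it does so at $b=\hat\beta_M(\gamma)$.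 Then, as $\gamma\downarrow0$, $$\gamma^{-(\delta+\zeta-1)/2}\,(\hat\beta_M(\gamma)-\beta)\to N(0,\Gamma)\ \text{ in distribution},\qquad \Gamma=(\Sigma+\Sigma\beta\beta^{\intercal}\Sigma)^{-1}\exp\!\big(-\tfrac12\beta^{\intercal}\Sigma\beta\big).$$ Moreover $\|\hat\beta_M(\gamma)-\beta\|_2^2=O_{\mathcal P}(\gamma^{\delta+\zeta-1})$: for every $\varepsilon>0$ there is $M>0$ such that $P\big(\|\hat\beta_M(\gamma)-\beta\|_2^2>M\gamma^{\delta+\zeta-1}\big)<\varepsilon$ for all small enough $\gamma$. -/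

import Mathlib

open MeasureTheory ProbabilityTheory Filter Topology
open scoped RealInnerProductSpace

noncomputable section

/-- The number of firms `m(γ) = γ^{-δ}` (integer part). -/
def numFirms (δ γ : ℝ) : ℕ := ⌊γ ^ (-δ)⌋₊

/-- The number of periods `T(γ) = γ^{-ζ}` (integer part). -/
def numPeriods (ζ γ : ℝ) : ℕ := ⌊γ ^ (-ζ)⌋₊

/-- The known intercept `α(γ) = log (1/γ)`. -/
def intercept (γ : ℝ) : ℝ := Real.log (1 / γ)

/-- The link `q(x) = e^x (1 + h(x))`; a surviving firm with covariate vector `v` defaults in the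
next period with probability `q(βᵀv - α)`. -/
def link (h : ℝ → ℝ) (x : ℝ) : ℝ := Real.exp x * (1 + h x)

section Model

variable {d : ℕ} {Ω : Type*}

/-- `V i t` is the covariate vector of firm `i` at time `t`, and `D i t` is the indicator of the
event that firm `i` defaults between the times `t` and `t + 1`.
`history m V D t` is the σ-algebra known at time `t`: it is generated by the covariates of all
firms up to time `t` and by the defaults of all firms that occurred up to time `t`. -/
@[reducible] def history (m : ℕ) (V : ℕ → ℕ → Ω → EuclideanSpace ℝ (Fin d)) (D : ℕ → ℕ → Ω → ℝ) (t : ℕ) :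
    MeasurableSpace Ω :=
  (⨆ (i : ℕ) (_ : i < m) (s : ℕ) (_ : s ≤ t), MeasurableSpace.comap (V i s) inferInstance) ⊔
  (⨆ (i : ℕ) (_ : i < m) (s : ℕ) (_ : s < t), MeasurableSpace.comap (D i s) inferInstance)

/-- The last time at which firm `i` is at risk and observed:
`τ_i = min {T - 1, min {t ≥ 0 : firm i defaults between t and t + 1}}`. -/
def lastTime (T : ℕ) (D : ℕ → ℕ → Ω → ℝ) (i : ℕ) (ω : Ω) : ℕ :=
  sInf ({T - 1} ∪ {t : ℕ | D i t ω = 1})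

/-- The likelihood of the default data at the parameter `(b, a)`:
`∏_{i ≤ m} ∏_{t = 0}^{τ_i} q(bᵀV_{i,t} - a)^{D} (1 - q(bᵀV_{i,t} - a))^{1 - D}`. -/
def likelihood (m T : ℕ) (q : ℝ → ℝ) (V : ℕ → ℕ → Ω → EuclideanSpace ℝ (Fin d))
    (D : ℕ → ℕ → Ω → ℝ) (a : ℝ) (b : EuclideanSpace ℝ (Fin d)) (ω : Ω) : ℝ :=
  ∏ i ∈ Finset.range m, ∏ t ∈ Finset.range (lastTime T D i ω + 1),
    if D i t ω = 1 then q (⟪b, V i t ω⟫ - a) else 1 - q (⟪b, V i t ω⟫ - a)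

/-- `b` maximises the likelihood over all of `ℝ^d`, the intercept `a` being known. -/
def IsMLE (m T : ℕ) (q : ℝ → ℝ) (V : ℕ → ℕ → Ω → EuclideanSpace ℝ (Fin d))
    (D : ℕ → ℕ → Ω → ℝ) (a : ℝ) (ω : Ω) (b : EuclideanSpace ℝ (Fin d)) : Prop :=
  ∀ b' : EuclideanSpace ℝ (Fin d),
    likelihood m T q V D a b' ω ≤ likelihood m T q V D a b ω

/-- The cross-covariance matrix `E[X Yᵀ]` of two centred random vectors. -/
def crossMoment [MeasurableSpace Ω] (P : Measure Ω) (X Y : Ω → EuclideanSpace ℝ (Fin d)) :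
    Matrix (Fin d) (Fin d) ℝ :=
  Matrix.of fun k l => ∫ ω, X ω k * Y ω l ∂P

/-- The covariates of `m` firms over `T` periods form a jointly Gaussian process with marginals
`N(0, S)` and exponentially decaying correlation in time (in operator norm). -/
structure IsCovariateProcess [MeasurableSpace Ω] (P : Measure Ω) (m T : ℕ)
    (S : Matrix (Fin d) (Fin d) ℝ) (K ρ : ℝ)
    (V : ℕ → ℕ → Ω → EuclideanSpace ℝ (Fin d)) : Prop where
  measurable : ∀ i < m, ∀ t < T, Measurable (V i t)
  gaussian : IsGaussianProcess (fun p : Fin m × Fin T => V p.1 p.2) P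
  marginal : ∀ i < m, ∀ t < T, HasLaw (V i t) (multivariateGaussian 0 S) P
  decay : ∀ i < m, ∀ j < m, ∀ t k : ℕ, t + k < T →
    ‖Matrix.toEuclideanCLM (𝕜 := ℝ) (crossMoment P (V i t) (V j (t + k)))‖ ≤ K * ρ ^ k

/-- Defaults: given the information at time `t`, the firms default between `t` and `t + 1`
independently of one another, firm `i` with probability `q(βᵀV_{i,t} - a)` if it is still at risk
(`t ≤ τ_i`) and with probability zero otherwise. Conditional independence of the `0`-`1` variables
is expressed by the conditional expectations of the products over all sets `s` of firms; singletons
give `E(D_{i,t+1} | F_t) = q(βᵀV_{i,t} - a) 1(τ_i ≥ t)`. -/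
structure IsDefaultProcess [MeasurableSpace Ω] (P : Measure Ω) (m T : ℕ) (q : ℝ → ℝ)
    (β : EuclideanSpace ℝ (Fin d)) (a : ℝ)
    (V : ℕ → ℕ → Ω → EuclideanSpace ℝ (Fin d)) (D : ℕ → ℕ → Ω → ℝ) : Prop where
  measurable : ∀ i < m, ∀ t < T, Measurable (D i t)
  zero_or_one : ∀ i < m, ∀ t < T, ∀ ω, D i t ω = 0 ∨ D i t ω = 1
  cond_default : ∀ t < T, ∀ s ⊆ Finset.range m,
    P[fun ω => ∏ i ∈ s, D i t ω | history m V D t] =ᵐ[P]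
      fun ω => ∏ i ∈ s, if t ≤ lastTime T D i ω then q (⟪β, V i t ω⟫ - a) else 0

end Model

/-- `h` is three times differentiable and, for `V ~ N(0, S)`, the functions `γ⁻¹ h(βᵀV - α(γ))`,
`γ⁻¹ h'(βᵀV - α(γ))`, `γ⁻¹ h''(βᵀV - α(γ))`, `γ⁻¹ h'''(βᵀV - α(γ))` are integrable, with
expectations of the absolute values bounded uniformly over all small enough `γ > 0`. -/
structure IsSmoothRemainder {d : ℕ} (S : Matrix (Fin d) (Fin d) ℝ)
    (β : EuclideanSpace ℝ (Fin d)) (h : ℝ → ℝ) : Prop where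
  differentiable : ∀ k < 3, Differentiable ℝ (iteratedDeriv k h)
  integrable : ∃ C : ℝ, ∀ᶠ γ in 𝓝[>] (0 : ℝ), ∀ k ≤ 3,
    Integrable (fun v => γ⁻¹ * iteratedDeriv k h (⟪β, v⟫ - intercept γ))
      (multivariateGaussian 0 S) ∧
    ∫ v, |γ⁻¹ * iteratedDeriv k h (⟪β, v⟫ - intercept γ)| ∂(multivariateGaussian 0 S) ≤ C

/-- `Γ = (Σ + Σ β βᵀ Σ)⁻¹ exp(-½ βᵀ Σ β)`. -/
def limitCov {d : ℕ} (S : Matrix (Fin d) (Fin d) ℝ) (β : EuclideanSpace ℝ (Fin d)) :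
    Matrix (Fin d) (Fin d) ℝ :=
  Real.exp (-(1 / 2) * (β.ofLp ⬝ᵥ S.mulVec β.ofLp)) •
    (S + S * Matrix.vecMulVec β.ofLp β.ofLp * S)⁻¹

/-- `X_γ = O_P(a_γ)` as `γ ↓ 0`. -/
def IsBigOP {Ω : ℝ → Type*} [∀ γ, MeasurableSpace (Ω γ)] (P : ∀ γ, Measure (Ω γ))
    (X : ∀ γ, Ω γ → ℝ) (a : ℝ → ℝ) : Prop :=
  ∀ ε > 0, ∃ M > 0, ∀ᶠ γ in 𝓝[>] (0 : ℝ), (P γ).real {ω | M < |X γ ω / a γ|} < ε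

end

/-! The intercept makes defaults rare: a firm at risk defaults in one period with probability about
γ e^{βᵀV}. There are about γ^{-(δ+ζ)} pairs (firm, period), so the number of defaults, and with it
the information, has order n = γ^{-(δ+ζ-1)} → ∞. A given firm defaults over the whole observation
window with probability O(Tγ) → 0, so departures from the risk set are negligible.

In this regime the likelihood is asymptotically that of a Poisson model. With u = b - β, U the score
at β, and the sum taken over the pairs at risk, log L(b) - log L(β) = ⟨u, U⟩ - ∑ e^{βᵀV - α}
(e^{uᵀV} - 1 - uᵀV) + O(γ n ‖u‖²) for b in a fixed ball, with high probability
(`abs_log_binaryLikelihood_sub_le`). The integrability assumptions on h and its derivatives are used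
through the pointwise bounds h, h', h'' = O(e^x) at -∞ (`IsSmoothRemainder.exists_abs_le`).

Curvature. Jointly Gaussian vectors with small cross-covariance are nearly independent, and
covariances decay in the time lag for every pair of firms. This gives a law of large numbers by
averaging over time alone (`exists_integral_sum_sub_sq_le`), and the curvature at β is close to nA
with A = E[e^{βᵀV} V Vᵀ]. Tilting the Gaussian shows that A = exp(½ βᵀΣβ)(Σ + Σββᵀ Σ), the inverse
of Γ.

Score. Up to a truncation of large covariates, U is a sum of compensated Bernoulli variables with
predictable weights, and its predictable variance is again close to nA. A quantitative
characteristic function estimate (`IsBernoulliScheme.norm_integral_exp_sub_exp_le`) yields U/√n →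
N(0, A).

Localisation. Concavity of the log-likelihood is not assumed, so the maximiser has to be located
globally. Each orthant contains a box on which ⟨b, v⟩ is at least a multiple of ‖b‖ for all b in
that orthant. If ‖b‖ exceeds a multiple of α, the defaults observed in the box opposite to b are too
unlikely; if ‖b‖ is large but below that multiple, the survivals in the box along b are too unlikely
(`binaryLikelihood_lt_of_le_norm`). Hence a maximiser exists and lies in a fixed ball. There the
convexity of e^y - 1 - y gives ‖b - β‖ = O(n^{-1/2}) (`IsRegularSample.norm_sub_le_of_le`).

On the scale n^{-1/2} the log-likelihood ratio differs by o(1) from ⟨u, U⟩ - n⟨u, Au⟩/2, hence √n (b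
- β) = A⁻¹U/√n + o(1) (`IsRegularSample.norm_sub_oneStep_le`). The limit covariance is A⁻¹ A A⁻¹ =
Γ, and the rate statement is tightness of the rescaled error. -/

noncomputable section

/-! ### Pointwise bounds on the remainder from its Gaussian averages -/

/-- A function with an integrable derivative is bounded at the centre of a window by the `L¹` norms
of the function and of its derivative over the window. -/
lemma abs_le_integral_window {f f' : ℝ → ℝ} (hf : ∀ x, HasDerivAt f (f' x) x) (c : ℝ)
    (hi : IntegrableOn f (Set.Icc (c - 1) (c + 1))) (hi' : IntegrableOn f' (Set.Icc (c - 1) (c + 1))) :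
    |f c| ≤ (∫ x in Set.Icc (c - 1) (c + 1), |f x|) + ∫ x in Set.Icc (c - 1) (c + 1), |f' x| := by
  set A := ∫ x in Set.Icc (c - 1) (c + 1), |f' x| with hA
  have key : ∀ y ∈ Set.Icc (c - 1) (c + 1), |f c| ≤ |f y| + A := by
    intro y hy
    have hsub : Set.uIcc y c ⊆ Set.Icc (c - 1) (c + 1) := by
      apply Set.uIcc_subset_Icc hy; constructor <;> linarith
    have hii : IntervalIntegrable f' volume y c := by
      rw [intervalIntegrable_iff]
      exact hi'.mono_set (Set.uIoc_subset_uIcc.trans hsub)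
    have h1 := intervalIntegral.integral_eq_sub_of_hasDerivAt (fun x _ => hf x) hii
    have h2 : |∫ x in y..c, f' x| ≤ A := by
      calc |∫ x in y..c, f' x| ≤ ∫ x in Set.uIoc y c, ‖f' x‖ := by
            simpa using intervalIntegral.norm_integral_le_integral_norm_uIoc (f := f') (a := y) (b := c)
        _ ≤ A := by
            rw [hA]
            apply setIntegral_mono_set hi'.norm
            · exact Eventually.of_forall fun x => norm_nonneg _
            · exact (Set.uIoc_subset_uIcc.trans hsub).eventuallyLE
    have h3 : f c = f y + ∫ x in y..c, f' x := by rw [h1]; ring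
    rw [h3]
    exact (abs_add_le _ _).trans (by linarith)
  -- `key` is averaged over the window, which has length 2; this even gives the factor 1/2 in front
  -- of the integral of |f|.
  have hint : ∫ x in Set.Icc (c - 1) (c + 1), (|f c| - A) ≤ ∫ x in Set.Icc (c - 1) (c + 1), |f x| := by
    apply setIntegral_mono_on (by simp) hi.abs measurableSet_Icc
    intro x hx
    have := key x hx
    linarith
  rw [setIntegral_const] at hint
  have hv : volume.real (Set.Icc (c - 1) (c + 1)) = 2 := by
    rw [measureReal_def, Real.volume_Icc]
    rw [ENNReal.toReal_ofReal] <;> linarith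
  rw [hv, smul_eq_mul] at hint
  have hA0 : 0 ≤ A := integral_nonneg fun x => abs_nonneg _
  have hB0 : 0 ≤ ∫ x in Set.Icc (c - 1) (c + 1), |f x| := integral_nonneg fun x => abs_nonneg _
  linarith

/-- On a bounded window, a nondegenerate real Gaussian dominates Lebesgue measure. -/
lemma exists_volume_restrict_le_gaussianReal (v : NNReal) (hv : v ≠ 0) :
    ∃ c : NNReal, volume.restrict (Set.Icc (-1 : ℝ) 1) ≤ c • gaussianReal 0 v := by
  have hv' : (0 : ℝ) < v := by positivity
  -- The density at the endpoint 1 is its minimum on the window, so p⁻¹ can serve as the constant.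
  set p : ℝ := gaussianPDFReal 0 v 1 with hp
  have hp0 : 0 < p := gaussianPDFReal_pos _ _ _ hv
  have hle : ∀ x ∈ Set.Icc (-1 : ℝ) 1, p ≤ gaussianPDFReal 0 v x := by
    intro x hx
    simp only [hp, gaussianPDFReal]
    gcongr ?_ * Real.exp (- ?_ / _)
    simp only [sub_zero]
    nlinarith [hx.1, hx.2]
  refine ⟨p⁻¹.toNNReal, ?_⟩
  rw [Measure.le_iff]
  intro s hs
  rw [Measure.restrict_apply hs, Measure.smul_apply, gaussianReal_of_var_ne_zero _ hv,
    withDensity_apply _ hs]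
  have h1 : ENNReal.ofReal p * volume (s ∩ Set.Icc (-1 : ℝ) 1) ≤ ∫⁻ a in s, gaussianPDF 0 v a := by
    calc ENNReal.ofReal p * volume (s ∩ Set.Icc (-1 : ℝ) 1)
        = ∫⁻ a in s ∩ Set.Icc (-1 : ℝ) 1, ENNReal.ofReal p := by rw [setLIntegral_const]
      _ ≤ ∫⁻ a in s ∩ Set.Icc (-1 : ℝ) 1, gaussianPDF 0 v a := by
          apply setLIntegral_mono' (hs.inter measurableSet_Icc)
          intro x hx
          exact ENNReal.ofReal_le_ofReal (hle x hx.2)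
      _ ≤ _ := lintegral_mono_set Set.inter_subset_left
  calc volume (s ∩ Set.Icc (-1 : ℝ) 1)
      = ENNReal.ofReal p⁻¹ * (ENNReal.ofReal p * volume (s ∩ Set.Icc (-1 : ℝ) 1)) := by
        rw [← mul_assoc, ← ENNReal.ofReal_mul (by positivity), inv_mul_cancel₀ hp0.ne']; simp
    _ ≤ _ := by
        rw [ENNReal.smul_def, smul_eq_mul]
        exact mul_le_mul_right h1 _

lemma map_inner_multivariateGaussian {d : ℕ} {S : Matrix (Fin d) (Fin d) ℝ} (hS : S.PosSemidef)
    (β : EuclideanSpace ℝ (Fin d)) :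
    (multivariateGaussian 0 S).map (fun v => ⟪β, v⟫) =
      gaussianReal 0 (β.ofLp ⬝ᵥ S.mulVec β.ofLp).toNNReal := by
  have h1 : (fun v : EuclideanSpace ℝ (Fin d) => ⟪β, v⟫) = ⇑(innerSL ℝ β) := by
    ext v; simp
  rw [h1, IsGaussian.map_eq_gaussianReal]
  congr 1
  · rw [ContinuousLinearMap.integral_comp_id_comm]
    · simp
    · exact IsGaussian.integrable_id
  · congr 1
    have := covarianceBilin_self (μ := multivariateGaussian (0 : EuclideanSpace ℝ (Fin d)) S)
      (IsGaussian.memLp_two_id) β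
    rw [covarianceBilin_multivariateGaussian hS] at this
    rw [this]; rfl

/-- The remainder and its first two derivatives are pointwise `O(e^x)` at `-∞`. -/
lemma IsSmoothRemainder.exists_abs_le {d : ℕ} {S : Matrix (Fin d) (Fin d) ℝ} (hS : S.PosDef)
    {β : EuclideanSpace ℝ (Fin d)} {h : ℝ → ℝ} (hh : IsSmoothRemainder S β h) :
    ∃ C > 0, ∃ x₀ : ℝ, ∀ x ≤ x₀, ∀ k ≤ 2, |iteratedDeriv k h x| ≤ C * Real.exp x := by
  obtain ⟨C, hC⟩ := hh.integrable
  rw [eventually_nhdsWithin_iff, Metric.eventually_nhds_iff] at hC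
  obtain ⟨r, hr, hC⟩ := hC
  -- The substitution γ = e^x turns `intercept γ` into -x. Halving the radius keeps e^x strictly
  -- inside the ball where the hypothesis holds.
  have hex : ∀ x ≤ Real.log (r / 2), ∀ k ≤ 3,
      Integrable (fun v => (Real.exp x)⁻¹ * iteratedDeriv k h (⟪β, v⟫ + x)) (multivariateGaussian 0 S) ∧
      ∫ v, |(Real.exp x)⁻¹ * iteratedDeriv k h (⟪β, v⟫ + x)| ∂(multivariateGaussian 0 S) ≤ C := by
    intro x hx k hk
    have h1 : Real.exp x ≤ r / 2 := by
      rw [← Real.exp_log (show 0 < r / 2 by linarith)]; exact Real.exp_le_exp.2 hx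
    have := hC (y := Real.exp x) (by
      rw [Real.dist_eq, sub_zero, abs_of_pos (Real.exp_pos x)]; linarith) (Real.exp_pos x) k hk
    simpa [intercept] using this
  clear hC
  set x₀ := Real.log (r / 2)
  have hC0 : 0 ≤ C := (integral_nonneg fun _ => abs_nonneg _).trans (hex x₀ le_rfl 0 (by norm_num)).2
  -- For β = 0 the law of ⟪β, v⟫ is a point mass, and the moment hypothesis is already the pointwise
  -- bound. Otherwise the law has a density.
  by_cases hβ : β = 0
  · refine ⟨C + 1, by linarith, x₀, fun x hx k hk => ?_⟩
    have := (hex x hx k (by omega)).2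
    simp only [hβ, inner_zero_left, zero_add, integral_const, probReal_univ, one_smul, abs_mul,
      abs_inv, Real.abs_exp] at this
    rw [inv_mul_le_iff₀ (Real.exp_pos x)] at this
    nlinarith [Real.exp_pos x]
  have hpos : 0 < β.ofLp ⬝ᵥ S.mulVec β.ofLp := by
    have h2 := hS.dotProduct_mulVec_pos (x := β.ofLp) (by simpa using hβ)
    simpa using h2
  obtain ⟨c, hc⟩ := exists_volume_restrict_le_gaussianReal (β.ofLp ⬝ᵥ S.mulVec β.ofLp).toNNReal
    (by simpa using hpos)
  rw [← map_inner_multivariateGaussian hS.posSemidef β] at hc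
  have hD : ∀ k < 3, ∀ x, HasDerivAt (iteratedDeriv k h) (iteratedDeriv (k + 1) h x) x := by
    intro k hk x
    rw [iteratedDeriv_succ]
    exact (hh.differentiable k hk x).hasDerivAt
  have hmeas : ∀ k ≤ 3, Measurable (iteratedDeriv k h) := by
    intro k hk
    rcases Nat.eq_or_lt_of_le hk with rfl | hk
    · rw [iteratedDeriv_succ]; exact measurable_deriv _
    · exact (hh.differentiable k hk).continuous.measurable
  have hwin : ∀ x ≤ x₀, ∀ k ≤ 3, IntegrableOn (iteratedDeriv k h) (Set.Icc (x - 1) (x + 1)) ∧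
      ∫ y in Set.Icc (x - 1) (x + 1), |iteratedDeriv k h y| ≤ c * C * Real.exp x := by
    intro x hx k hk
    obtain ⟨hi, hle⟩ := hex x hx k hk
    have hm := hmeas k hk
    have hfm : Measurable (fun y : ℝ => iteratedDeriv k h (y + x)) := hm.comp (measurable_add_const x)
    have hi' : Integrable (fun v => iteratedDeriv k h (⟪β, v⟫ + x)) (multivariateGaussian 0 S) := by
      have := hi.const_mul (Real.exp x)
      simpa [← mul_assoc] using this
    have him : Integrable (fun y : ℝ => iteratedDeriv k h (y + x))
        ((multivariateGaussian 0 S).map (fun v => ⟪β, v⟫)) := by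
      rw [integrable_map_measure hfm.aestronglyMeasurable (by fun_prop)]
      exact hi'
    have him2 : Integrable (fun y : ℝ => iteratedDeriv k h (y + x))
        (c • (multivariateGaussian 0 S).map (fun v => ⟪β, v⟫)) := him.smul_measure_nnreal
    have hint : ∫ v, |iteratedDeriv k h (⟪β, v⟫ + x)| ∂(multivariateGaussian 0 S)
        ≤ C * Real.exp x := by
      simp only [abs_mul, abs_inv, Real.abs_exp, integral_const_mul] at hle
      rw [inv_mul_le_iff₀ (Real.exp_pos x)] at hle
      linarith
    have him3 : IntegrableOn (fun y : ℝ => iteratedDeriv k h (y + x)) (Set.Icc (-1) 1) :=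
      him2.mono_measure hc
    have hle3 : ∫ y in Set.Icc (-1 : ℝ) 1, |iteratedDeriv k h (y + x)| ≤ c * C * Real.exp x := by
      calc ∫ y in Set.Icc (-1 : ℝ) 1, |iteratedDeriv k h (y + x)|
          ≤ ∫ y, |iteratedDeriv k h (y + x)| ∂(c • (multivariateGaussian 0 S).map (fun v => ⟪β, v⟫)) :=
            integral_mono_measure hc (Eventually.of_forall fun _ => abs_nonneg _) him2.norm
        _ = c * ∫ v, |iteratedDeriv k h (⟪β, v⟫ + x)| ∂(multivariateGaussian 0 S) := by
            rw [integral_smul_nnreal_measure, integral_map (by fun_prop)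
              (show AEStronglyMeasurable (fun y => |iteratedDeriv k h (y + x)|) _ from
                hfm.norm.aestronglyMeasurable)]
            rfl
        _ ≤ c * (C * Real.exp x) := by gcongr
        _ = _ := by ring
    have hmp := measurePreserving_add_right (volume : Measure ℝ) x
    have hpre : (fun y => y + x) ⁻¹' (Set.Icc (x - 1) (x + 1)) = Set.Icc (-1 : ℝ) 1 := by
      ext y; simp only [Set.mem_preimage, Set.mem_Icc]; constructor <;> rintro ⟨h1, h2⟩ <;> constructor <;> linarith
    constructor
    · have := hmp.integrableOn_comp_preimage (measurableEmbedding_addRight x)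
        (f := iteratedDeriv k h) (s := Set.Icc (x - 1) (x + 1))
      rw [hpre] at this
      exact this.1 him3
    · have := hmp.setIntegral_preimage_emb (measurableEmbedding_addRight x)
        (fun y => |iteratedDeriv k h y|) (Set.Icc (x - 1) (x + 1))
      rw [hpre] at this
      rw [← this]; exact hle3
  -- Bounding the k-th derivative at a point uses the window averages of orders k and k + 1, so
  -- three derivatives control two. The summand 1 only makes the constant positive.
  refine ⟨2 * (c * C) + 1, by positivity, x₀, fun x hx k hk => ?_⟩
  have h0 := hwin x hx k (by omega)
  have h1 := hwin x hx (k + 1) (by omega)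
  have := abs_le_integral_window (hD k (by omega)) x h0.1 h1.1
  nlinarith [h0.2, h1.2, Real.exp_pos x]

/-! ### Links that behave like the exponential at -∞ -/

/-- A probability-valued function that agrees with `exp` to first order at `-∞`, together with the
second-order Taylor expansions of the two log-likelihood contributions `log q`, `log (1 - q)`. -/
structure IsExpLike (q : ℝ → ℝ) (C x₁ : ℝ) : Prop where
  cont : Continuous q
  nonneg : ∀ x, 0 ≤ q x
  le_one : ∀ x, q x ≤ 1
  one_le : 1 ≤ C
  nonpos : x₁ ≤ 0
  le_exp : ∀ x, q x ≤ C * Real.exp x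
  sub_exp : ∀ x, |q x - Real.exp x| ≤ C * Real.exp (2 * x)
  lower : ∀ x ≤ x₁, Real.exp x / 2 ≤ q x
  upper : ∀ x ≤ x₁, q x ≤ 1 / 2
  score : ∀ x ≤ x₁, |deriv q x / (q x * (1 - q x)) - 1| ≤ C * Real.exp x
  taylor_log : ∀ x y, x ≤ x₁ → x + y ≤ x₁ →
    |Real.log (q (x + y)) - Real.log (q x) - deriv q x / q x * y
      + Real.exp x * (Real.exp y - 1 - y)| ≤ C * Real.exp (max x (x + y)) * y ^ 2
  taylor_log_one_sub : ∀ x y, x ≤ x₁ → x + y ≤ x₁ →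
    |Real.log (1 - q (x + y)) - Real.log (1 - q x) + deriv q x / (1 - q x) * y
      + Real.exp x * (Real.exp y - 1 - y)| ≤ C * Real.exp (2 * max x (x + y)) * y ^ 2

/-- The mean value inequality is applied to G', then to G minus its tangent. Everything is asked on
a half-line only, because the link is controlled only near -∞. -/
lemma abs_taylor_two_le {G G' G'' : ℝ → ℝ} {b M x y : ℝ}
    (hG : ∀ t ≤ b, HasDerivAt G (G' t) t) (hG' : ∀ t ≤ b, HasDerivAt G' (G'' t) t)
    (hx : x ≤ b) (hxy : x + y ≤ b) (hM : ∀ t ≤ max x (x + y), |G'' t| ≤ M) :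
    |G (x + y) - G x - G' x * y| ≤ M * y ^ 2 := by
  have hb : ∀ t ∈ Set.uIcc x (x + y), t ≤ b ∧ t ≤ max x (x + y) ∧ |t - x| ≤ |y| := by
    intro t ht
    have h1 : t ≤ max x (x + y) := ht.2
    refine ⟨h1.trans (max_le hx hxy), h1, ?_⟩
    have := Set.abs_sub_left_of_mem_uIcc ht
    simpa using this
  have hM0 : 0 ≤ M := (abs_nonneg _).trans (hM _ le_rfl)
  have h1 : ∀ t ∈ Set.uIcc x (x + y), |G' t - G' x| ≤ M * |y| := by
    intro t ht
    have := (convex_uIcc x (x + y)).norm_image_sub_le_of_norm_hasDerivWithin_le (f := G') (f' := G'')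
      (C := M) (fun s hs => (hG' s (hb s hs).1).hasDerivWithinAt) (fun s hs => hM s (hb s hs).2.1)
      Set.left_mem_uIcc ht
    simp only [Real.norm_eq_abs] at this
    exact this.trans (mul_le_mul_of_nonneg_left (hb t ht).2.2 hM0)
  have := (convex_uIcc x (x + y)).norm_image_sub_le_of_norm_hasDerivWithin_le
      (f := fun t => G t - G' x * t) (f' := fun t => G' t - G' x)
      (C := M * |y|) (fun s hs => ((hG s (hb s hs).1).sub
        (by simpa using (hasDerivAt_id s).const_mul (G' x))).hasDerivWithinAt)
      (fun s hs => by simpa using h1 s hs)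
      Set.left_mem_uIcc Set.right_mem_uIcc
  simp only [Real.norm_eq_abs] at this
  have e : x + y - x = y := by ring
  rw [e, mul_assoc, abs_mul_abs_self] at this
  calc |G (x + y) - G x - G' x * y| = |G (x + y) - G' x * (x + y) - (G x - G' x * x)| := by
        congr 1; ring
    _ ≤ M * (y * y) := this
    _ = M * y ^ 2 := by ring

lemma abs_div_le_of_le {n d A e : ℝ} (he : 0 < e) (hd : e ≤ d) (hn : |n| ≤ A * e) : |n / d| ≤ A := by
  have hd0 : 0 < d := he.trans_le hd
  have hA : 0 ≤ A := by
    by_contra hA; push Not at hA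
    have := (abs_nonneg n).trans hn
    nlinarith
  rw [abs_div, abs_of_pos hd0, div_le_iff₀ hd0]
  exact hn.trans (by gcongr)

set_option maxHeartbeats 1000000 in
/-- The link `e^x (1 + h)` is exponential-like when `h, h', h'' = O(e^x)` at `-∞`. -/
lemma isExpLike_link {h : ℝ → ℝ} (hq : ∀ x, 0 ≤ link h x ∧ link h x ≤ 1)
    (hd0 : Differentiable ℝ h) (hd1 : Differentiable ℝ (deriv h)) {C x₀ : ℝ} (hC : 0 < C)
    (hb0 : ∀ x ≤ x₀, |h x| ≤ C * Real.exp x) (hb1 : ∀ x ≤ x₀, |deriv h x| ≤ C * Real.exp x)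
    (hb2 : ∀ x ≤ x₀, |deriv (deriv h) x| ≤ C * Real.exp x) :
    ∃ C' x₁, IsExpLike (link h) C' x₁ := by
  -- Below x₁ both e^x and C e^x are at most 1/4, which forces 1 + h ≥ 3/4 and q ≤ 1/2.
  set x₁ := min (min x₀ 0) (Real.log (1 / (4 * (C + 1)))) with hx₁
  have hx₁0 : x₁ ≤ 0 := (min_le_left _ _).trans (min_le_right _ _)
  have hbd : ∀ x ≤ x₁, |h x| ≤ C * Real.exp x ∧ |deriv h x| ≤ C * Real.exp x ∧
      |deriv (deriv h) x| ≤ C * Real.exp x ∧ C * Real.exp x ≤ 1 / 4 ∧ Real.exp x ≤ 1 / 4 := by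
    intro x hx
    have h1 : x ≤ x₀ := hx.trans ((min_le_left _ _).trans (min_le_left _ _))
    have h2 : Real.exp x ≤ 1 / (4 * (C + 1)) := by
      rw [← Real.exp_log (show 0 < 1 / (4 * (C + 1)) by positivity)]
      exact Real.exp_le_exp.2 (hx.trans (min_le_right _ _))
    rw [le_div_iff₀ (by positivity)] at h2
    have h3 := Real.exp_pos x
    exact ⟨hb0 x h1, hb1 x h1, hb2 x h1, by nlinarith, by nlinarith⟩
  set q := link h with hqdef
  set q' : ℝ → ℝ := fun x => Real.exp x * (1 + h x + deriv h x) with hq'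
  set q'' : ℝ → ℝ := fun x => Real.exp x * (1 + h x + 2 * deriv h x + deriv (deriv h) x) with hq''
  have hqd : ∀ x, HasDerivAt q (q' x) x := by
    intro x
    have := (Real.hasDerivAt_exp x).mul (((hd0 x).hasDerivAt).const_add 1)
    convert! this using 1
    simp only [hq']; ring
  have hq'd : ∀ x, HasDerivAt q' (q'' x) x := by
    intro x
    have := (Real.hasDerivAt_exp x).mul ((((hd0 x).hasDerivAt).const_add 1).add (hd1 x).hasDerivAt)
    convert! this using 1
    simp only [hq'', Pi.add_apply]; ring
  have hderiv : ∀ x, deriv q x = q' x := fun x => (hqd x).deriv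
  have hqE : ∀ x, q x = Real.exp x * (1 + h x) := fun x => rfl
  have hqs : ∀ x ≤ x₁, Real.exp x / 2 ≤ q x ∧ q x ≤ 2 * Real.exp x ∧ q x ≤ 1 / 2 ∧ 3 / 4 ≤ 1 + h x := by
    intro x hx
    obtain ⟨h0, -, -, h3, h4⟩ := hbd x hx
    have h5 := Real.exp_pos x
    rw [abs_le] at h0
    rw [hqE]
    refine ⟨?_, ?_, ?_, ?_⟩ <;> nlinarith
  -- The two exponentials serve the bounds above x₁, where only 0 ≤ q ≤ 1 is known; the remaining
  -- terms serve the estimates below x₁.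
  set C' : ℝ := 64 * C + 100 + Real.exp (-x₁) + Real.exp (-(2 * x₁)) with hC'
  have e1 := Real.exp_pos (-x₁)
  have e2 := Real.exp_pos (-(2 * x₁))
  refine ⟨C', x₁, ⟨?_, fun x => (hq x).1, fun x => (hq x).2, by linarith, hx₁0, ?_, ?_,
    fun x hx => (hqs x hx).1, fun x hx => (hqs x hx).2.2.1, ?_, ?_, ?_⟩⟩
  · exact continuous_iff_continuousAt.2 fun x => (hqd x).continuousAt
  · intro x
    have h5 := Real.exp_pos x
    rcases le_total x x₁ with hx | hx
    · have := (hqs x hx).2.1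
      nlinarith
    · have h6 : 1 ≤ Real.exp (-x₁) * Real.exp x := by
        rw [← Real.exp_add]; exact Real.one_le_exp (by linarith)
      have := (hq x).2
      nlinarith
  · intro x
    have h5 := Real.exp_pos x
    have e3 : Real.exp (2 * x) = Real.exp x * Real.exp x := by rw [← Real.exp_add]; ring_nf
    rcases le_total x x₁ with hx | hx
    · obtain ⟨h0, -⟩ := hbd x hx
      rw [hqE, show Real.exp x * (1 + h x) - Real.exp x = Real.exp x * h x by ring, abs_mul,
        Real.abs_exp, e3]
      have : 0 < Real.exp x * Real.exp x := by positivity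
      nlinarith
    · have h6 : 1 ≤ Real.exp (-(2 * x₁)) * Real.exp (2 * x) := by
        rw [← Real.exp_add]; exact Real.one_le_exp (by linarith)
      have h7 : Real.exp x ≤ Real.exp (-x₁) * Real.exp (2 * x) := by
        rw [← Real.exp_add]; exact Real.exp_le_exp.2 (by linarith)
      have h8 := (hq x).2
      have h9 := (hq x).1
      have h10 := Real.exp_pos (2 * x)
      rw [abs_le]
      constructor <;> nlinarith
  · intro x hx
    obtain ⟨h0, h1, -, h3, h4⟩ := hbd x hx
    obtain ⟨g1, g2, g3, g4⟩ := hqs x hx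
    have h5 := Real.exp_pos x
    have hq0 : 0 < q x := by linarith
    have e3 : deriv q x / (q x * (1 - q x)) - 1 =
        (deriv h x + (1 + h x) * q x) / ((1 + h x) * (1 - q x)) := by
      have hh : (1 + h x) ≠ 0 := by linarith
      have hh1 : (1 - q x) ≠ 0 := by linarith
      have hh2 := Real.exp_ne_zero x
      rw [hderiv]
      simp only [hq']
      rw [hqE] at hh1 ⊢
      field_simp
      ring
    rw [e3]
    apply abs_div_le_of_le (e := 3 / 8) (by norm_num)
    · nlinarith
    · have hu : 1 + h x ≤ 2 := by rw [abs_le] at h0; linarith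
      have : |(1 + h x) * q x| ≤ 4 * Real.exp x := by
        rw [abs_of_nonneg (by positivity)]; nlinarith
      have := abs_add_le (deriv h x) ((1 + h x) * q x)
      nlinarith
  · intro x y hx hxy
    -- The function expanded is log q + e^t. Its second derivative is O(e^t), and the second-order
    -- Taylor remainder of e^t at x is the Poisson term e^x (e^y - 1 - y).
    have hG : ∀ t ≤ x₁, HasDerivAt (fun t => t + Real.log (1 + h t) + Real.exp t)
        (1 + deriv h t / (1 + h t) + Real.exp t) t := by
      intro t ht
      exact ((hasDerivAt_id t).add (((hd0 t).hasDerivAt.const_add 1).log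
        (by linarith [(hqs t ht).2.2.2]))).add (Real.hasDerivAt_exp t)
    have hG' : ∀ t ≤ x₁, HasDerivAt (fun t => 1 + deriv h t / (1 + h t) + Real.exp t)
        ((deriv (deriv h) t * (1 + h t) - deriv h t * deriv h t) / (1 + h t) ^ 2 + Real.exp t) t := by
      intro t ht
      exact (((hd1 t).hasDerivAt.div ((hd0 t).hasDerivAt.const_add 1)
        (by linarith [(hqs t ht).2.2.2])).const_add 1).add (Real.hasDerivAt_exp t)
    have hm : max x (x + y) ≤ x₁ := max_le hx hxy
    have hT := abs_taylor_two_le hG hG' hx hxy (M := C' * Real.exp (max x (x + y))) (by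
      intro t ht
      obtain ⟨h0, h1, h2, h3, h4⟩ := hbd t (ht.trans hm)
      obtain ⟨g1, g2, g3, g4⟩ := hqs t (ht.trans hm)
      have h5 := Real.exp_pos t
      have hu : 1 + h t ≤ 5 / 4 := by rw [abs_le] at h0; linarith
      have k1 : |(deriv (deriv h) t * (1 + h t) - deriv h t * deriv h t) / (1 + h t) ^ 2|
          ≤ 4 * C * Real.exp t := by
        apply abs_div_le_of_le (e := 1 / 2) (by norm_num)
        · nlinarith
        · have k2 := abs_sub (deriv (deriv h) t * (1 + h t)) (deriv h t * deriv h t)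
          rw [abs_mul, abs_mul, abs_of_nonneg (show 0 ≤ 1 + h t by linarith)] at k2
          have k3 : |deriv (deriv h) t| * (1 + h t) ≤ (C * Real.exp t) * (5 / 4) := by gcongr
          have k4 : |deriv h t| * |deriv h t| ≤ (C * Real.exp t) * (1 / 4) := by
            gcongr; linarith
          have k5 : 0 < C * Real.exp t := by positivity
          linarith
      have k5 := abs_add_le ((deriv (deriv h) t * (1 + h t) - deriv h t * deriv h t) / (1 + h t) ^ 2)
        (Real.exp t)
      rw [Real.abs_exp] at k5
      have k6 : Real.exp t ≤ Real.exp (max x (x + y)) := Real.exp_le_exp.2 ht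
      nlinarith [Real.exp_pos (max x (x + y))])
    have hlog : ∀ t ≤ x₁, Real.log (q t) = t + Real.log (1 + h t) := by
      intro t ht
      rw [hqE, Real.log_mul (Real.exp_ne_zero t) (by linarith [(hqs t ht).2.2.2]), Real.log_exp]
    rw [hlog x hx, hlog _ hxy]
    convert hT using 2
    have : deriv q x / q x = 1 + deriv h x / (1 + h x) := by
      rw [hderiv, hqE]
      simp only [hq']
      have hh : (1 + h x) ≠ 0 := by linarith [(hqs x hx).2.2.2]
      have hh2 := Real.exp_ne_zero x
      field_simp
    rw [this, Real.exp_add]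
    ring
  · intro x y hx hxy
    -- Here adding e^t is essential: the second derivative of log (1 - q) is -e^t to first order,
    -- and only the sum is O(e^{2t}). This matters because survivals are more numerous than defaults
    -- by a factor of order 1/γ.
    have hG : ∀ t ≤ x₁, HasDerivAt (fun t => Real.log (1 - q t) + Real.exp t)
        (-q' t / (1 - q t) + Real.exp t) t := by
      intro t ht
      exact (((hqd t).const_sub 1).log (by linarith [(hqs t ht).2.2.1])).add (Real.hasDerivAt_exp t)
    have hG' : ∀ t ≤ x₁, HasDerivAt (fun t => -q' t / (1 - q t) + Real.exp t)
        ((-q'' t * (1 - q t) - -q' t * -q' t) / (1 - q t) ^ 2 + Real.exp t) t := by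
      intro t ht
      exact ((hq'd t).neg.div ((hqd t).const_sub 1) (by linarith [(hqs t ht).2.2.1])).add
        (Real.hasDerivAt_exp t)
    have hm : max x (x + y) ≤ x₁ := max_le hx hxy
    have hT := abs_taylor_two_le hG hG' hx hxy (M := C' * Real.exp (2 * max x (x + y))) (by
      intro t ht
      obtain ⟨h0, h1, h2, h3, h4⟩ := hbd t (ht.trans hm)
      obtain ⟨g1, g2, g3, g4⟩ := hqs t (ht.trans hm)
      have h5 := Real.exp_pos t
      have hq0 : 0 ≤ q t := by linarith
      set E := Real.exp t with hE
      -- The numerator is sorted to show the cancellation: E - q'' is itself of second order, and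
      -- every other term is a product of two small factors.
      have e3 : (-q'' t * (1 - q t) - -q' t * -q' t) / (1 - q t) ^ 2 + E =
          (E * (q t * (q t - 2)) + (E - q'' t) + q'' t * q t - q' t * q' t) / (1 - q t) ^ 2 := by
        have hh : 1 - q t ≠ 0 := by linarith
        field_simp
        ring
      have k0 : Real.exp (2 * t) = E * E := by rw [hE, ← Real.exp_add]; ring_nf
      have k1 : |h t + 2 * deriv h t + deriv (deriv h) t| ≤ 4 * (C * E) := by
        have i0 := abs_le.1 h0
        have i1 := abs_le.1 h1
        have i2 := abs_le.1 h2
        exact abs_le.2 ⟨by linarith [i0.1, i1.1, i2.1], by linarith [i0.2, i1.2, i2.2]⟩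
      have k2 : |E - q'' t| ≤ 4 * C * (E * E) := by
        rw [show E - q'' t = -(E * (h t + 2 * deriv h t + deriv (deriv h) t)) by
          simp only [hq'']; ring, abs_neg, abs_mul, abs_of_pos h5]
        linarith [mul_le_mul_of_nonneg_left k1 h5.le]
      have k3 : |q'' t| ≤ 2 * E := by
        rw [show q'' t = E - (E - q'' t) by ring]
        refine (abs_sub _ _).trans ?_
        rw [abs_of_pos h5]
        linarith [mul_le_mul_of_nonneg_left h3 h5.le]
      have k4 : |q' t| ≤ 2 * E := by
        simp only [hq']
        rw [abs_mul, abs_of_pos h5]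
        have : |1 + h t + deriv h t| ≤ 2 := by
          have i0 := abs_le.1 h0
          have i1 := abs_le.1 h1
          exact abs_le.2 ⟨by linarith [i0.1, i1.1], by linarith [i0.2, i1.2]⟩
        linarith [mul_le_mul_of_nonneg_left this h5.le]
      have k5 : |E * (q t * (q t - 2))| ≤ 4 * (E * E) := by
        rw [abs_mul, abs_mul, abs_of_pos h5, abs_of_nonneg hq0, abs_of_nonpos (by linarith)]
        have i1 : q t * -(q t - 2) ≤ 4 * E := by nlinarith only [hq0, g2]
        linarith [mul_le_mul_of_nonneg_left i1 h5.le]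
      have k6 : |q'' t * q t| ≤ 4 * (E * E) := by
        rw [abs_mul, abs_of_nonneg hq0]
        calc |q'' t| * q t ≤ (2 * E) * (2 * E) := by gcongr
          _ = _ := by ring
      have k7 : |q' t * q' t| ≤ 4 * (E * E) := by
        rw [abs_mul]
        calc |q' t| * |q' t| ≤ (2 * E) * (2 * E) := by gcongr
          _ = _ := by ring
      have k8 : |(-q'' t * (1 - q t) - -q' t * -q' t) / (1 - q t) ^ 2 + E| ≤ (16 * C + 48) * (E * E) := by
        rw [e3]
        apply abs_div_le_of_le (e := 1 / 4) (by norm_num)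
        · have : 1 / 2 ≤ 1 - q t := by linarith
          nlinarith only [this]
        · have i2 := abs_le.1 k2
          have i5 := abs_le.1 k5
          have i6 := abs_le.1 k6
          have i7 := abs_le.1 k7
          exact abs_le.2 ⟨by linarith only [i2.1, i5.1, i6.1, i7.2], by linarith only [i2.2, i5.2, i6.2, i7.1]⟩
      have k9 : E * E ≤ Real.exp (2 * max x (x + y)) := by
        rw [← k0]; exact Real.exp_le_exp.2 (by linarith)
      refine k8.trans (mul_le_mul (by linarith) k9 (by positivity) (by positivity)))
    convert hT using 2
    rw [hderiv, Real.exp_add]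
    ring

lemma IsSmoothRemainder.exists_isExpLike {d : ℕ} {S : Matrix (Fin d) (Fin d) ℝ} (hS : S.PosDef)
    {β : EuclideanSpace ℝ (Fin d)} {h : ℝ → ℝ} (hh : IsSmoothRemainder S β h)
    (hq : ∀ x, 0 ≤ link h x ∧ link h x ≤ 1) :
    ∃ C x₁, IsExpLike (link h) C x₁ := by
  obtain ⟨C, hC, x₀, hb⟩ := hh.exists_abs_le hS
  refine isExpLike_link hq (by simpa using hh.differentiable 0 (by norm_num))
    (by simpa using hh.differentiable 1 (by norm_num)) hC
    (fun x hx => by simpa using hb x hx 0 (by norm_num))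
    (fun x hx => by simpa using hb x hx 1 (by norm_num))
    (fun x hx => by simpa [iteratedDeriv_succ] using hb x hx 2 (by norm_num))

/-! ### Exponential moments and the tilted Gaussian -/

section GaussianMoments

variable {d : ℕ} {S : Matrix (Fin d) (Fin d) ℝ}

/-- A Gaussian measure has exponential moments of the norm of all orders. -/
lemma integrable_exp_mul_norm {E : Type*} [NormedAddCommGroup E] [NormedSpace ℝ E]
    [MeasurableSpace E] [BorelSpace E] [SecondCountableTopology E] [CompleteSpace E]
    (μ : Measure E) [IsGaussian μ] (c : ℝ) : Integrable (fun v => Real.exp (c * ‖v‖)) μ := by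
  obtain ⟨A, hA, hi⟩ := IsGaussian.exists_integrable_exp_sq μ
  refine (hi.const_mul (Real.exp (c ^ 2 / (4 * A)))).mono' (by fun_prop) (ae_of_all _ fun v => ?_)
  rw [Real.norm_eq_abs, Real.abs_exp, ← Real.exp_add]
  apply Real.exp_le_exp.2
  have : c ^ 2 / (4 * A) + A * ‖v‖ ^ 2 - c * ‖v‖ = (c / (2 * A) - ‖v‖) ^ 2 * A := by
    field_simp; ring
  nlinarith [mul_nonneg (sq_nonneg (c / (2 * A) - ‖v‖)) hA.le]

lemma memLp_two_of_le_exp {E : Type*} [NormedAddCommGroup E] [NormedSpace ℝ E]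
    [MeasurableSpace E] [BorelSpace E] [SecondCountableTopology E] [CompleteSpace E]
    (μ : Measure E) [IsGaussian μ] {g : E → ℝ} (hg : Measurable g) {A c : ℝ}
    (h : ∀ v, |g v| ≤ A * Real.exp (c * ‖v‖)) : MemLp g 2 μ := by
  have h1 : MemLp (fun v : E => A * Real.exp (c * ‖v‖)) 2 μ := by
    apply MemLp.const_mul
    rw [memLp_two_iff_integrable_sq (by fun_prop)]
    have := integrable_exp_mul_norm μ (2 * c)
    refine this.congr (ae_of_all _ fun v => ?_)
    simp only []
    rw [← Real.exp_nat_mul]; congr 1; push_cast; ring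
  exact h1.of_le hg.aestronglyMeasurable (ae_of_all _ fun v => by
    rw [Real.norm_eq_abs, Real.norm_eq_abs]; exact (h v).trans (le_abs_self _))

lemma integral_exp_inner_multivariateGaussian (hS : S.PosSemidef) (b : EuclideanSpace ℝ (Fin d)) :
    ∫ v, Real.exp ⟪b, v⟫ ∂(multivariateGaussian 0 S) =
      Real.exp (b.ofLp ⬝ᵥ S.mulVec b.ofLp / 2) := by
  have h1 := mgf_gaussianReal (map_inner_multivariateGaussian hS b) 1
  have h2 : 0 ≤ b.ofLp ⬝ᵥ S.mulVec b.ofLp := by simpa using hS.dotProduct_mulVec_nonneg b.ofLp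
  simp only [mgf, one_mul, zero_add, Real.coe_toNNReal _ h2, one_pow, mul_one] at h1
  exact h1

lemma dotProduct_mulVec_comm_of_isHermitian (hS : S.IsHermitian) (x y : Fin d → ℝ) :
    x ⬝ᵥ S.mulVec y = y ⬝ᵥ S.mulVec x := by
  have hT : S.transpose = S := (show S.IsSymm by simpa using hS).eq
  rw [Matrix.dotProduct_mulVec, ← Matrix.mulVec_transpose, hT, dotProduct_comm]

/-- Second moments of the exponentially tilted Gaussian. -/
lemma integral_exp_inner_mul_sq (hS : S.PosSemidef) (β w : EuclideanSpace ℝ (Fin d)) :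
    ∫ v, Real.exp ⟪β, v⟫ * ⟪w, v⟫ ^ 2 ∂(multivariateGaussian 0 S) =
      Real.exp (β.ofLp ⬝ᵥ S.mulVec β.ofLp / 2) *
        (w.ofLp ⬝ᵥ S.mulVec w.ofLp + (w.ofLp ⬝ᵥ S.mulVec β.ofLp) ^ 2) := by
  set μ := multivariateGaussian (0 : EuclideanSpace ℝ (Fin d)) S
  have hexp : ∀ b : EuclideanSpace ℝ (Fin d), Integrable (fun v => Real.exp ⟪b, v⟫) μ := by
    intro b
    refine (integrable_exp_mul_norm μ ‖b‖).mono' (by fun_prop) (ae_of_all _ fun v => ?_)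
    rw [Real.norm_eq_abs, Real.abs_exp]
    exact Real.exp_le_exp.2 (real_inner_le_norm b v)
  -- Under the tilted measure ν, not normalised, the integral is the second moment of ⟪w, ·⟫, that
  -- is, the second derivative at 0 of an explicit moment generating function.
  set ν := μ.withDensity (fun v => ENNReal.ofReal (Real.exp ⟪β, v⟫)) with hν
  have hm : Measurable (fun v : EuclideanSpace ℝ (Fin d) => ENNReal.ofReal (Real.exp ⟪β, v⟫)) := by
    fun_prop
  have hint : ∀ f : EuclideanSpace ℝ (Fin d) → ℝ,
      ∫ v, f v ∂ν = ∫ v, Real.exp ⟪β, v⟫ * f v ∂μ := by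
    intro f
    rw [hν, integral_withDensity_eq_integral_toReal_smul hm (by simp)]
    simp [ENNReal.toReal_ofReal (Real.exp_pos _).le]
  have hmgf : mgf (fun v => ⟪w, v⟫) ν = fun t => Real.exp
      (β.ofLp ⬝ᵥ S.mulVec β.ofLp / 2 + t * (w.ofLp ⬝ᵥ S.mulVec β.ofLp)
        + t ^ 2 * (w.ofLp ⬝ᵥ S.mulVec w.ofLp) / 2) := by
    ext t
    rw [mgf, hint]
    have : (fun v : EuclideanSpace ℝ (Fin d) => Real.exp ⟪β, v⟫ * Real.exp (t * ⟪w, v⟫)) =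
        fun v => Real.exp ⟪β + t • w, v⟫ := by
      ext v
      rw [← Real.exp_add, inner_add_left, real_inner_smul_left]
    rw [this, integral_exp_inner_multivariateGaussian hS]
    congr 1
    simp only [WithLp.ofLp_add, WithLp.ofLp_smul, Matrix.mulVec_add, Matrix.mulVec_smul,
      dotProduct_add, add_dotProduct, smul_dotProduct, dotProduct_smul, smul_eq_mul]
    rw [dotProduct_mulVec_comm_of_isHermitian hS.isHermitian β.ofLp w.ofLp]
    ring
  -- All exponential moments are finite, so 0 is interior to the domain and differentiation at 0 is
  -- allowed.
  have hset : integrableExpSet (fun v => ⟪w, v⟫) ν = Set.univ := by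
    ext t
    simp only [integrableExpSet, Set.mem_ofPred_eq, Set.mem_univ, iff_true]
    rw [hν, integrable_withDensity_iff_integrable_smul' hm (by simp)]
    refine (hexp (β + t • w)).congr (ae_of_all _ fun v => ?_)
    simp only [ENNReal.toReal_ofReal (Real.exp_pos _).le, smul_eq_mul]
    rw [← Real.exp_add, inner_add_left, real_inner_smul_left]
  have h2 := iteratedDeriv_mgf_zero (X := fun v => ⟪w, v⟫) (μ := ν) (by rw [hset]; simp) 2
  have h3 : (fun v : EuclideanSpace ℝ (Fin d) => ⟪w, v⟫) ^ 2 = fun v => ⟪w, v⟫ ^ 2 := rfl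
  rw [h3, hint] at h2
  rw [← h2, hmgf, iteratedDeriv_succ, iteratedDeriv_one]
  set A := β.ofLp ⬝ᵥ S.mulVec β.ofLp
  set B := w.ofLp ⬝ᵥ S.mulVec β.ofLp
  set D := w.ofLp ⬝ᵥ S.mulVec w.ofLp
  have d1 : ∀ t : ℝ, HasDerivAt (fun t : ℝ => A / 2 + t * B + t ^ 2 * D / 2) (B + t * D) t := by
    intro t
    have := (((hasDerivAt_id t).mul_const B).const_add (A / 2)).add
      (((hasDerivAt_pow 2 t).mul_const D).div_const 2)
    convert! this using 1
    push_cast; ring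
  have d2 : deriv (fun t : ℝ => Real.exp (A / 2 + t * B + t ^ 2 * D / 2)) =
      fun t => Real.exp (A / 2 + t * B + t ^ 2 * D / 2) * (B + t * D) := by
    ext t; exact (d1 t).exp.deriv
  rw [d2]
  have d3 : HasDerivAt (fun t : ℝ => Real.exp (A / 2 + t * B + t ^ 2 * D / 2) * (B + t * D)) _ 0 :=
    (d1 0).exp.mul (((hasDerivAt_id (0 : ℝ)).mul_const D).const_add B)
  rw [d3.deriv]
  simp
  ring

end GaussianMoments

/-! ### One box per orthant, to treat all directions at once -/

section Boxes

variable {d : ℕ}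

/-- The sign attached to a Boolean. -/
def boolSign (b : Bool) : ℝ := if b then 1 else -1

/-- The open cube of side `s` in the orthant `ε`, at distance `s` from the coordinate hyperplanes. -/
def signBox (s : ℝ) (ε : Fin d → Bool) : Set (EuclideanSpace ℝ (Fin d)) :=
  {v | ∀ j, s < boolSign (ε j) * v j ∧ boolSign (ε j) * v j < 2 * s}

lemma boolSign_mul_self (b : Bool) : boolSign b * boolSign b = 1 := by
  cases b <;> simp [boolSign]

lemma isOpen_signBox (s : ℝ) (ε : Fin d → Bool) : IsOpen (signBox s ε) := by
  have : signBox s ε = ⋂ j, {v : EuclideanSpace ℝ (Fin d) | s < boolSign (ε j) * v j} ∩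
      {v | boolSign (ε j) * v j < 2 * s} := by
    ext v; simp [signBox]
  rw [this]
  refine isOpen_iInter_of_finite fun j => ?_
  exact (isOpen_lt (by fun_prop) (by fun_prop)).inter (isOpen_lt (by fun_prop) (by fun_prop))

lemma signBox_nonempty {s : ℝ} (hs : 0 < s) (ε : Fin d → Bool) : (signBox s ε).Nonempty := by
  refine ⟨WithLp.toLp 2 fun j => boolSign (ε j) * (3 / 2 * s), fun j => ?_⟩
  simp only [← mul_assoc, boolSign_mul_self]
  constructor <;> linarith

instance isOpenPosMeasure_gaussianReal (v : NNReal) [NeZero v] :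
    (gaussianReal 0 v).IsOpenPosMeasure :=
  (gaussianReal_absolutelyContinuous' 0 (NeZero.ne v)).isOpenPosMeasure

-- The law is the image of the standard Gaussian under the square root of S, and S^{1/2} S⁻¹ is a
-- right inverse of that map, which is therefore onto.
open scoped MatrixOrder in
lemma isOpenPosMeasure_multivariateGaussian {S : Matrix (Fin d) (Fin d) ℝ} (hS : S.PosDef) :
    (multivariateGaussian (0 : EuclideanSpace ℝ (Fin d)) S).IsOpenPosMeasure := by
  have h1 : (stdGaussian (EuclideanSpace ℝ (Fin d))).IsOpenPosMeasure := by
    rw [← map_pi_eq_stdGaussian]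
    exact (PiLp.continuous_toLp 2 _).isOpenPosMeasure_map (WithLp.toLp_surjective 2)
  rw [multivariateGaussian]
  refine Continuous.isOpenPosMeasure_map (by fun_prop) fun y => ?_
  have hd : IsUnit S.det := hS.det_pos.ne'.isUnit
  refine ⟨Matrix.toEuclideanCLM (𝕜 := ℝ) (CFC.sqrt S * S⁻¹) y, ?_⟩
  rw [zero_add, ← ContinuousLinearMap.comp_apply, ← ContinuousLinearMap.mul_def, ← map_mul,
    ← mul_assoc, CFC.sqrt_mul_sqrt_self _ hS.posSemidef.nonneg, Matrix.mul_nonsing_inv _ hd]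
  simp

lemma signBox_measureReal_pos {S : Matrix (Fin d) (Fin d) ℝ} (hS : S.PosDef) {s : ℝ} (hs : 0 < s)
    (ε : Fin d → Bool) : 0 < (multivariateGaussian 0 S).real (signBox s ε) := by
  have := isOpenPosMeasure_multivariateGaussian hS
  exact ENNReal.toReal_pos ((isOpen_signBox s ε).measure_ne_zero _ (signBox_nonempty hs ε))
    (measure_ne_top _ _)

lemma norm_le_of_mem_signBox {s : ℝ} {ε : Fin d → Bool} {v : EuclideanSpace ℝ (Fin d)} (hs : 0 < s)
    (hv : v ∈ signBox s ε) : ‖v‖ ≤ 2 * s * d := by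
  have h1 : ∀ j, |v j| ≤ 2 * s := by
    intro j
    have h := hv j
    have : |boolSign (ε j) * v j| = |v j| := by
      rw [abs_mul]; cases ε j <;> simp [boolSign]
    rw [← this, abs_of_pos (hs.trans h.1)]
    exact h.2.le
  rw [EuclideanSpace.norm_eq]
  apply Real.sqrt_le_iff.2
  refine ⟨by positivity, ?_⟩
  calc ∑ i, ‖v i‖ ^ 2 ≤ ∑ _i : Fin d, (2 * s) ^ 2 := by
        gcongr with i; exact h1 i
    _ = d * (2 * s) ^ 2 := by simp
    _ ≤ (2 * s * d) ^ 2 := by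
        have : (d : ℝ) ≤ d * d := by
          rcases Nat.eq_zero_or_pos d with rfl | hd
          · simp
          · have : (1 : ℝ) ≤ d := by exact_mod_cast hd
            nlinarith
        nlinarith [sq_nonneg (2 * s)]

/-- The orthant of a vector. -/
def orthant (u : EuclideanSpace ℝ (Fin d)) : Fin d → Bool := fun j => decide (0 ≤ u j)

/-- On the box in the orthant of u every product u_j v_j is at least s |u_j|, and the ℓ¹ norm
dominates the Euclidean one. The 2^d boxes thus replace a supremum over all directions. -/
lemma norm_mul_le_inner_of_mem_signBox {s : ℝ} (hs : 0 < s) {u v : EuclideanSpace ℝ (Fin d)}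
    (hv : v ∈ signBox s (orthant u)) : s * ‖u‖ ≤ ⟪u, v⟫ := by
  have h1 : ‖u‖ ≤ ∑ j, |u j| := by
    rw [EuclideanSpace.norm_eq]
    apply Real.sqrt_le_iff.2
    refine ⟨Finset.sum_nonneg fun _ _ => abs_nonneg _, ?_⟩
    exact Finset.sum_sq_le_sq_sum_of_nonneg fun _ _ => abs_nonneg _
  have h2 : ⟪u, v⟫ = ∑ j, u j * v j := by
    simp [PiLp.inner_apply, mul_comm]
  calc s * ‖u‖ ≤ s * ∑ j, |u j| := by gcongr
    _ = ∑ j, |u j| * s := by rw [Finset.mul_sum]; simp_rw [mul_comm]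
    _ ≤ ∑ j, u j * v j := by
        refine Finset.sum_le_sum fun j _ => ?_
        have h := (hv j).1.le
        by_cases hu : 0 ≤ u j
        · simp only [orthant, hu, decide_true, boolSign, if_true, one_mul] at h
          rw [abs_of_nonneg hu]; gcongr
        · simp only [orthant, hu, decide_false, boolSign] at h
          push Not at hu
          rw [abs_of_neg hu]
          simp only [Bool.false_eq_true, if_false] at h
          nlinarith
    _ = ⟪u, v⟫ := h2.symm

end Boxes

/-! ### Gaussian vectors with small cross-covariance are nearly independent -/

section CovarianceDecay

variable {d : ℕ}

/-- Replacing `g` by an `L²`-close `f` changes product moments by little, whatever the coupling. -/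
lemma abs_integral_prod_sub_le {E : Type*} [MeasurableSpace E] {μ : Measure E}
    {ν : Measure (E × E)} (h1 : ν.map Prod.fst = μ) (h2 : ν.map Prod.snd = μ) {f g : E → ℝ}
    (hf : MemLp f 2 μ) (hg : MemLp g 2 μ) {θ : ℝ} (hθ : 0 < θ)
    (hfg : ∫ x, (g x - f x) ^ 2 ∂μ ≤ θ ^ 2) :
    |∫ p, g p.1 * g p.2 ∂ν - ∫ p, f p.1 * f p.2 ∂ν| ≤
      θ * (2 + 2 * ∫ x, g x ^ 2 ∂μ + θ ^ 2) := by
  have mp1 : MeasurePreserving Prod.fst ν μ := ⟨measurable_fst, h1⟩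
  have mp2 : MeasurePreserving Prod.snd ν μ := ⟨measurable_snd, h2⟩
  have hi1 : ∀ {u : E → ℝ}, MemLp u 2 μ → MemLp (fun p : E × E => u p.1) 2 ν :=
    fun hu => hu.comp_measurePreserving mp1
  have hi2 : ∀ {u : E → ℝ}, MemLp u 2 μ → MemLp (fun p : E × E => u p.2) 2 ν :=
    fun hu => hu.comp_measurePreserving mp2
  have e1 : ∀ {u : E → ℝ}, MemLp u 2 μ → ∫ p : E × E, u p.1 ^ 2 ∂ν = ∫ x, u x ^ 2 ∂μ := by
    intro u hu
    have : AEStronglyMeasurable (fun x => u x ^ 2) (ν.map Prod.fst) := by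
      rw [h1]; exact hu.aestronglyMeasurable.pow 2
    rw [← h1, integral_map measurable_fst.aemeasurable this]
  have e2 : ∀ {u : E → ℝ}, MemLp u 2 μ → ∫ p : E × E, u p.2 ^ 2 ∂ν = ∫ x, u x ^ 2 ∂μ := by
    intro u hu
    have : AEStronglyMeasurable (fun x => u x ^ 2) (ν.map Prod.snd) := by
      rw [h2]; exact hu.aestronglyMeasurable.pow 2
    rw [← h2, integral_map measurable_snd.aemeasurable this]
  have hgf := hg.sub hf
  -- Weighted arithmetic-geometric mean inequality, |uw| ≤ u²/(2θ) + θw²/2: the weight is chosen so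
  -- that a factor of L² size θ costs one power of θ.
  have key : ∀ {u w : E × E → ℝ}, MemLp u 2 ν → MemLp w 2 ν → ∫ p, u p ^ 2 ∂ν ≤ θ ^ 2 →
      |∫ p, u p * w p ∂ν| ≤ θ / 2 * (1 + ∫ p, w p ^ 2 ∂ν) := by
    intro u w hu hw hle
    have i1 := hu.integrable_sq
    have i2 := hw.integrable_sq
    calc |∫ p, u p * w p ∂ν| ≤ ∫ p, |u p * w p| ∂ν := abs_integral_le_integral_abs
      _ ≤ ∫ p, (1 / (2 * θ) * u p ^ 2 + θ / 2 * w p ^ 2) ∂ν := by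
          refine integral_mono (hu.integrable_mul hw).abs ((i1.const_mul _).add (i2.const_mul _)) ?_
          intro p
          simp only
          have : 1 / (2 * θ) * u p ^ 2 + θ / 2 * w p ^ 2 - |u p * w p| =
              (|u p| - θ * |w p|) ^ 2 / (2 * θ) := by
            rw [abs_mul]; field_simp; rw [sub_sq, mul_pow, sq_abs, sq_abs]; ring
          have : 0 ≤ (|u p| - θ * |w p|) ^ 2 / (2 * θ) := by positivity
          linarith
      _ = 1 / (2 * θ) * ∫ p, u p ^ 2 ∂ν + θ / 2 * ∫ p, w p ^ 2 ∂ν := by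
          rw [integral_add (i1.const_mul _) (i2.const_mul _), integral_const_mul, integral_const_mul]
      _ ≤ 1 / (2 * θ) * θ ^ 2 + θ / 2 * ∫ p, w p ^ 2 ∂ν := by gcongr
      _ = _ := by field_simp
  have k1 := key (hi1 hgf) (hi2 hg) (by rw [e1 hgf]; exact hfg)
  have k2 := key (hi2 hgf) (hi1 hf) (by rw [e2 hgf]; exact hfg)
  rw [e2 hg] at k1
  rw [e1 hf] at k2
  have hf2 : ∫ x, f x ^ 2 ∂μ ≤ 2 * ∫ x, g x ^ 2 ∂μ + 2 * θ ^ 2 := by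
    calc ∫ x, f x ^ 2 ∂μ ≤ ∫ x, (2 * g x ^ 2 + 2 * (g x - f x) ^ 2) ∂μ := by
          refine integral_mono hf.integrable_sq ((hg.integrable_sq.const_mul _).add
            (hgf.integrable_sq.const_mul _)) fun x => ?_
          simp only
          nlinarith [sq_nonneg (2 * g x - f x)]
      _ = 2 * ∫ x, g x ^ 2 ∂μ + 2 * ∫ x, (g x - f x) ^ 2 ∂μ := by
          rw [← integral_const_mul, ← integral_const_mul]
          exact integral_add (hg.integrable_sq.const_mul _) (hgf.integrable_sq.const_mul _)
      _ ≤ _ := by linarith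
  -- One factor is replaced at a time. The second term carries f instead of g, whose norm is
  -- controlled by `hf2`.
  have hsplit : ∫ p, g p.1 * g p.2 ∂ν - ∫ p, f p.1 * f p.2 ∂ν =
      (∫ p : E × E, (g - f) p.1 * g p.2 ∂ν) + ∫ p : E × E, (g - f) p.2 * f p.1 ∂ν := by
    refine (integral_sub ((hi1 hg).integrable_mul (hi2 hg))
      ((hi1 hf).integrable_mul (hi2 hf))).symm.trans (Eq.trans ?_
        (integral_add ((hi1 hgf).integrable_mul (hi2 hg)) ((hi2 hgf).integrable_mul (hi1 hf))))
    congr 1; ext p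
    simp only [Pi.sub_apply, Pi.mul_apply]; ring
  rw [hsplit]
  refine (abs_add_le _ _).trans ?_
  have hg0 : 0 ≤ ∫ x, g x ^ 2 ∂μ := integral_nonneg fun x => sq_nonneg _
  nlinarith

/-- Jointly Gaussian vectors with law `N(0, S)` whose cross-covariances tend to zero are
asymptotically independent. -/
lemma tendsto_integral_prod_of_tendsto_crossMoment {S : Matrix (Fin d) (Fin d) ℝ} (hS : S.PosSemidef)
    (ν : ℕ → Measure (EuclideanSpace ℝ (Fin d) × EuclideanSpace ℝ (Fin d))) [∀ n, IsGaussian (ν n)]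
    (h1 : ∀ n, (ν n).map Prod.fst = multivariateGaussian 0 S)
    (h2 : ∀ n, (ν n).map Prod.snd = multivariateGaussian 0 S)
    (hc : Tendsto (fun n => ‖Matrix.toEuclideanCLM (𝕜 := ℝ) (crossMoment (ν n) Prod.fst Prod.snd)‖)
      atTop (𝓝 0)) (f : BoundedContinuousFunction (EuclideanSpace ℝ (Fin d)) ℝ) :
    Tendsto (fun n => ∫ p, f p.1 * f p.2 ∂(ν n)) atTop
      (𝓝 ((∫ x, f x ∂(multivariateGaussian 0 S)) ^ 2)) := by
  set μ := multivariateGaussian (0 : EuclideanSpace ℝ (Fin d)) S with hμ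
  have hmt : Measurable (WithLp.toLp 2 : EuclideanSpace ℝ (Fin d) × EuclideanSpace ℝ (Fin d) → WithLp 2 (EuclideanSpace ℝ (Fin d) × EuclideanSpace ℝ (Fin d))) := by fun_prop
  -- The product is given the L² norm because characteristic functions are taken with respect to an
  -- inner product.
  let ν' : ℕ → ProbabilityMeasure (WithLp 2 (EuclideanSpace ℝ (Fin d) × EuclideanSpace ℝ (Fin d))) := fun n =>
    ⟨(ν n).map (WithLp.toLp 2), Measure.isProbabilityMeasure_map hmt.aemeasurable⟩
  let μ' : ProbabilityMeasure (WithLp 2 (EuclideanSpace ℝ (Fin d) × EuclideanSpace ℝ (Fin d))) :=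
    ⟨(μ.prod μ).map (WithLp.toLp 2), Measure.isProbabilityMeasure_map hmt.aemeasurable⟩
  have hlim : Tendsto ν' atTop (𝓝 μ') := by
    apply ProbabilityMeasure.tendsto_of_tendsto_charFun
    intro t
    have hμ' : charFun (μ' : Measure (WithLp 2 (EuclideanSpace ℝ (Fin d) × EuclideanSpace ℝ (Fin d)))) t =
        charFun μ t.fst * charFun μ t.snd := charFun_prod t
    rw [hμ']
    -- The joint characteristic function is that of independent copies times the exponential of
    -- minus the cross-covariance form, so Lévy's continuity theorem applies.
    have hform : ∀ n, charFun (ν' n : Measure (WithLp 2 (EuclideanSpace ℝ (Fin d) × EuclideanSpace ℝ (Fin d)))) t =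
        charFun μ t.fst * charFun μ t.snd * Complex.exp (-(
          ⟪t.fst, Matrix.toEuclideanCLM (𝕜 := ℝ) (crossMoment (ν n) Prod.fst Prod.snd) t.snd⟫ : ℝ)) := by
      intro n
      have hG : HasGaussianLaw (fun p : EuclideanSpace ℝ (Fin d) × EuclideanSpace ℝ (Fin d) => WithLp.toLp 2 (p.1, p.2)) (ν n) :=
        HasGaussianLaw.toLp_prodMk 2 (X := Prod.fst) (Y := Prod.snd)
          (by simpa using! IsGaussian.hasGaussianLaw_id (μ := ν n))
      have hcf := hG.charFun_map_eq t
      have L1 : HasLaw (Prod.fst : EuclideanSpace ℝ (Fin d) × EuclideanSpace ℝ (Fin d) → EuclideanSpace ℝ (Fin d)) μ (ν n) := ⟨measurable_fst.aemeasurable, h1 n⟩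
      have L2 : HasLaw (Prod.snd : EuclideanSpace ℝ (Fin d) × EuclideanSpace ℝ (Fin d) → EuclideanSpace ℝ (Fin d)) μ (ν n) := ⟨measurable_snd.aemeasurable, h2 n⟩
      have m1 : ∀ u : EuclideanSpace ℝ (Fin d), MemLp (fun p : EuclideanSpace ℝ (Fin d) × EuclideanSpace ℝ (Fin d) => ⟪u, p.1⟫) 2 (ν n) := fun u =>
        (L1.hasGaussianLaw.map_fun (innerSL ℝ u)).memLp_two
      have m2 : ∀ u : EuclideanSpace ℝ (Fin d), MemLp (fun p : EuclideanSpace ℝ (Fin d) × EuclideanSpace ℝ (Fin d) => ⟪u, p.2⟫) 2 (ν n) := fun u =>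
        (L2.hasGaussianLaw.map_fun (innerSL ℝ u)).memLp_two
      have hsum : (fun p : EuclideanSpace ℝ (Fin d) × EuclideanSpace ℝ (Fin d) => ⟪t, WithLp.toLp 2 (p.1, p.2)⟫) =
          (fun p : EuclideanSpace ℝ (Fin d) × EuclideanSpace ℝ (Fin d) => ⟪t.fst, p.1⟫) + fun p : EuclideanSpace ℝ (Fin d) × EuclideanSpace ℝ (Fin d) => ⟪t.snd, p.2⟫ := by
        ext p; simp [WithLp.prod_inner_apply]
      have mean : ∀ u : EuclideanSpace ℝ (Fin d), ∫ x, ⟪u, x⟫ ∂μ = 0 := by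
        intro u
        have := (innerSL ℝ u).integral_comp_id_comm (μ := μ) IsGaussian.integrable_id
        simp only [innerSL_apply_apply] at this
        rw [this]; simp [hμ]
      have e1 : ∀ u : EuclideanSpace ℝ (Fin d), ∫ p : EuclideanSpace ℝ (Fin d) × EuclideanSpace ℝ (Fin d), ⟪u, p.1⟫ ∂(ν n) = 0 := by
        intro u
        rw [← mean u, ← h1 n, integral_map measurable_fst.aemeasurable (by fun_prop)]
      have e2 : ∀ u : EuclideanSpace ℝ (Fin d), ∫ p : EuclideanSpace ℝ (Fin d) × EuclideanSpace ℝ (Fin d), ⟪u, p.2⟫ ∂(ν n) = 0 := by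
        intro u
        rw [← mean u, ← h2 n, integral_map measurable_snd.aemeasurable (by fun_prop)]
      have vμ : ∀ u : EuclideanSpace ℝ (Fin d), Var[fun x => ⟪u, x⟫; μ] = u.ofLp ⬝ᵥ S.mulVec u.ofLp := by
        intro u
        rw [← covarianceBilin_multivariateGaussian hS u u (μ := 0),
          covarianceBilin_self IsGaussian.memLp_two_id]
      have v1 : Var[fun p : EuclideanSpace ℝ (Fin d) × EuclideanSpace ℝ (Fin d) => ⟪t.fst, p.1⟫; ν n] = Var[fun x => ⟪t.fst, x⟫; μ] := by
        rw [← h1 n, variance_map (by fun_prop) (by fun_prop)]; rfl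
      have v2 : Var[fun p : EuclideanSpace ℝ (Fin d) × EuclideanSpace ℝ (Fin d) => ⟪t.snd, p.2⟫; ν n] = Var[fun x => ⟪t.snd, x⟫; μ] := by
        rw [← h2 n, variance_map (by fun_prop) (by fun_prop)]; rfl
      have cc : cov[fun p : EuclideanSpace ℝ (Fin d) × EuclideanSpace ℝ (Fin d) => ⟪t.fst, p.1⟫, fun p : EuclideanSpace ℝ (Fin d) × EuclideanSpace ℝ (Fin d) => ⟪t.snd, p.2⟫; ν n] =
          ⟪t.fst, Matrix.toEuclideanCLM (𝕜 := ℝ) (crossMoment (ν n) Prod.fst Prod.snd) t.snd⟫ := by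
        rw [covariance_eq_sub (m1 _) (m2 _), e1, e2, Matrix.inner_toEuclideanCLM]
        simp only [mul_zero, sub_zero, Pi.mul_apply, PiLp.inner_apply, RCLike.inner_apply, conj_trivial,
          dotProduct, Matrix.mulVec, crossMoment, Matrix.of_apply]
        have mc1 : ∀ k, MemLp (fun p : EuclideanSpace ℝ (Fin d) × EuclideanSpace ℝ (Fin d) => p.1 k) 2 (ν n) := by
          intro k
          simpa [EuclideanSpace.inner_single_left] using m1 (EuclideanSpace.single k 1)
        have mc2 : ∀ k, MemLp (fun p : EuclideanSpace ℝ (Fin d) × EuclideanSpace ℝ (Fin d) => p.2 k) 2 (ν n) := by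
          intro k
          simpa [EuclideanSpace.inner_single_left] using m2 (EuclideanSpace.single k 1)
        have mcc : ∀ k l, Integrable (fun p : EuclideanSpace ℝ (Fin d) × EuclideanSpace ℝ (Fin d) => p.1 k * p.2 l) (ν n) :=
          fun k l => (mc1 k).integrable_mul (mc2 l)
        have : ∀ p : EuclideanSpace ℝ (Fin d) × EuclideanSpace ℝ (Fin d), (∑ i, p.1 i * t.fst i) * (∑ i, p.2 i * t.snd i) =
            ∑ i, ∑ j, t.fst i * t.snd j * (p.1 i * p.2 j) := by
          intro p
          rw [Finset.sum_mul_sum]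
          refine Finset.sum_congr rfl fun i _ => Finset.sum_congr rfl fun j _ => by ring
        simp_rw [this]
        rw [integral_finsetSum _ fun i _ => integrable_finsetSum _ fun j _ => (mcc i j).const_mul _]
        refine Finset.sum_congr rfl fun i _ => ?_
        rw [integral_finsetSum _ fun j _ => (mcc i j).const_mul _, Finset.mul_sum]
        refine Finset.sum_congr rfl fun j _ => ?_
        rw [integral_const_mul]
        ring
      have hν : (ν' n : Measure (WithLp 2 (EuclideanSpace ℝ (Fin d) × EuclideanSpace ℝ (Fin d)))) =
          (ν n).map (fun p : EuclideanSpace ℝ (Fin d) × EuclideanSpace ℝ (Fin d) => WithLp.toLp 2 (p.1, p.2)) := rfl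
      rw [hν, hcf]
      have hint : ∫ p : EuclideanSpace ℝ (Fin d) × EuclideanSpace ℝ (Fin d), ⟪t, WithLp.toLp 2 (p.1, p.2)⟫ ∂(ν n) = 0 := by
        rw [hsum]
        rw [integral_add' ((m1 _).integrable (by norm_num)) ((m2 _).integrable (by norm_num)), e1, e2,
          add_zero]
      rw [hint, hsum, variance_add (m1 _) (m2 _), v1, v2, cc, vμ, vμ, hμ,
        charFun_multivariateGaussian hS, charFun_multivariateGaussian hS, ← Complex.exp_add,
        ← Complex.exp_add]
      congr 1
      simp only [inner_zero_right]
      push_cast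
      ring
    simp_rw [hform]
    have hz : Tendsto (fun n => ⟪t.fst, Matrix.toEuclideanCLM (𝕜 := ℝ)
        (crossMoment (ν n) Prod.fst Prod.snd) t.snd⟫) atTop (𝓝 0) := by
      have hb : Tendsto (fun n => ‖t.fst‖ * (‖Matrix.toEuclideanCLM (𝕜 := ℝ)
        (crossMoment (ν n) Prod.fst Prod.snd)‖ * ‖t.snd‖)) atTop (𝓝 0) := by
        simpa using (hc.mul_const ‖t.snd‖).const_mul ‖t.fst‖
      refine squeeze_zero_norm (fun n => ?_) hb
      rw [Real.norm_eq_abs]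
      refine (abs_real_inner_le_norm _ _).trans ?_
      gcongr
      exact ContinuousLinearMap.le_opNorm _ _
    have h3 := ((Complex.continuous_exp.comp (Complex.continuous_ofReal.comp continuous_neg)).tendsto
      0).comp hz
    simpa using h3.const_mul (charFun μ t.fst * charFun μ t.snd)
  rw [ProbabilityMeasure.tendsto_iff_forall_integral_tendsto] at hlim
  let F : BoundedContinuousFunction (WithLp 2 (EuclideanSpace ℝ (Fin d) × EuclideanSpace ℝ (Fin d))) ℝ :=
    (f.compContinuous ⟨fun p => p.fst, by fun_prop⟩) * (f.compContinuous ⟨fun p => p.snd, by fun_prop⟩)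
  have hF := hlim F
  have hFm : Measurable F := F.continuous.measurable
  have eν : ∀ n, ∫ p, F p ∂(ν' n : Measure (WithLp 2 (EuclideanSpace ℝ (Fin d) × EuclideanSpace ℝ (Fin d)))) = ∫ p, f p.1 * f p.2 ∂(ν n) := by
    intro n
    change ∫ p, F p ∂((ν n).map (WithLp.toLp 2)) = _
    rw [integral_map hmt.aemeasurable hFm.aestronglyMeasurable]
    rfl
  have eμ : ∫ p, F p ∂(μ' : Measure (WithLp 2 (EuclideanSpace ℝ (Fin d) × EuclideanSpace ℝ (Fin d)))) = (∫ x, f x ∂μ) ^ 2 := by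
    change ∫ p, F p ∂((μ.prod μ).map (WithLp.toLp 2)) = _
    rw [integral_map hmt.aemeasurable hFm.aestronglyMeasurable]
    change ∫ p : EuclideanSpace ℝ (Fin d) × EuclideanSpace ℝ (Fin d), f p.1 * f p.2 ∂(μ.prod μ) = _
    rw [integral_prod_mul]; ring
  simp_rw [eν] at hF
  rwa [eμ] at hF

/-- Covariances of square-integrable functions of jointly Gaussian vectors are small when the
cross-covariance matrix is. -/
lemma exists_abs_integral_prod_sub_sq_le {S : Matrix (Fin d) (Fin d) ℝ} (hS : S.PosSemidef)
    {g : EuclideanSpace ℝ (Fin d) → ℝ} (hg : MemLp g 2 (multivariateGaussian 0 S)) {ε : ℝ}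
    (hε : 0 < ε) :
    ∃ κ > 0, ∀ ν : Measure (EuclideanSpace ℝ (Fin d) × EuclideanSpace ℝ (Fin d)),
      IsGaussian ν → ν.map Prod.fst = multivariateGaussian 0 S →
      ν.map Prod.snd = multivariateGaussian 0 S →
      ‖Matrix.toEuclideanCLM (𝕜 := ℝ) (crossMoment ν Prod.fst Prod.snd)‖ ≤ κ →
      |∫ p, g p.1 * g p.2 ∂ν - (∫ x, g x ∂(multivariateGaussian 0 S)) ^ 2| ≤ ε := by
  set μ := multivariateGaussian (0 : EuclideanSpace ℝ (Fin d)) S with hμ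
  -- If no κ works, the choices 1/(n + 1) give a sequence of couplings whose cross-covariances tend
  -- to zero while the deviation stays above ε.
  by_contra! hcon
  choose ν hν h1 h2 h3 h4 using fun n : ℕ => hcon (1 / ((n : ℝ) + 1)) (by positivity)
  have hg0 : 0 ≤ ∫ x, g x ^ 2 ∂μ := integral_nonneg fun x => sq_nonneg _
  set G := ∫ x, g x ^ 2 ∂μ
  -- θ is such that replacing g by a bounded continuous f costs at most ε/4. This is done for the
  -- coupling and for the product measure; with ε/4 from weak convergence the total is 3ε/4.
  set θ := min 1 (ε / (4 * (3 + 2 * G))) with hθ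
  have hθ0 : 0 < θ := by positivity
  have hθ1 : θ ≤ 1 := min_le_left _ _
  have hθ2 : θ * (2 + 2 * G + θ ^ 2) ≤ ε / 4 := by
    have : θ ≤ ε / (4 * (3 + 2 * G)) := min_le_right _ _
    rw [le_div_iff₀ (by positivity)] at this
    nlinarith
  obtain ⟨f, hf1, hf2⟩ := MemLp.exists_boundedContinuous_integral_rpow_sub_le (p := 2) (by norm_num)
    (f := g) (μ := μ) (by simpa using hg) (ε := θ ^ 2) (by positivity)
  have hf2' : MemLp f 2 μ := by simpa using hf2
  have hf1' : ∫ x, (g x - f x) ^ 2 ∂μ ≤ θ ^ 2 := by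
    simpa [Real.norm_eq_abs, sq_abs] using hf1
  have hlim := tendsto_integral_prod_of_tendsto_crossMoment hS ν h1 h2
    (squeeze_zero (fun n => norm_nonneg _) h3 tendsto_one_div_add_atTop_nhds_zero_nat) f
  have hev := (Metric.tendsto_nhds.1 hlim) (ε / 4) (by positivity)
  obtain ⟨n, hn⟩ := hev.exists
  rw [Real.dist_eq] at hn
  have k1 := abs_integral_prod_sub_le (h1 n) (h2 n) hf2' hg hθ0 hf1'
  have k2 := abs_integral_prod_sub_le (ν := μ.prod μ) (by simp [Measure.map_fst_prod])
    (by simp [Measure.map_snd_prod]) hf2' hg hθ0 hf1'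
  rw [integral_prod_mul, integral_prod_mul, ← pow_two, ← pow_two] at k2
  have k4 := h4 n
  rw [abs_le] at k1 k2
  rw [abs_lt] at hn
  rw [lt_abs] at k4
  rcases k4 with k4 | k4 <;> linarith [k1.1, k1.2, k2.1, k2.2, hn.1, hn.2]

end CovarianceDecay

/-! ### Weak law of large numbers for the covariates -/

/-- The index set of firms and periods. -/
def cells (m T : ℕ) : Finset (ℕ × ℕ) := Finset.range m ×ˢ Finset.range T

@[simp] lemma mem_cells {m T : ℕ} {p : ℕ × ℕ} : p ∈ cells m T ↔ p.1 < m ∧ p.2 < T := by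
  simp [cells]

@[simp] lemma card_cells (m T : ℕ) : (cells m T).card = m * T := by simp [cells]

section LawOfLargeNumbers

variable {d : ℕ} {Ω : Type*} [MeasurableSpace Ω] {P : Measure Ω} {m T : ℕ}
  {S : Matrix (Fin d) (Fin d) ℝ} {K ρ : ℝ} {V : ℕ → ℕ → Ω → EuclideanSpace ℝ (Fin d)}

lemma IsCovariateProcess.integral_comp (hV : IsCovariateProcess P m T S K ρ V) {i t : ℕ} (hi : i < m)
    (ht : t < T) {g : EuclideanSpace ℝ (Fin d) → ℝ}
    (hg : AEStronglyMeasurable g (multivariateGaussian 0 S)) :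
    ∫ ω, g (V i t ω) ∂P = ∫ v, g v ∂(multivariateGaussian 0 S) := by
  have h := hV.marginal i hi t ht
  rw [← h.map_eq, integral_map h.aemeasurable (by rw [h.map_eq]; exact hg)]

lemma IsCovariateProcess.measurePreserving (hV : IsCovariateProcess P m T S K ρ V) {i t : ℕ}
    (hi : i < m) (ht : t < T) : MeasurePreserving (V i t) P (multivariateGaussian 0 S) :=
  ⟨hV.measurable i hi t ht, (hV.marginal i hi t ht).map_eq⟩

/-- The crude bound for pairs close in time: |xy| ≤ (x² + y²)/2 and equality of the marginals. -/
lemma IsCovariateProcess.abs_covariance_le [IsProbabilityMeasure P]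
    (hV : IsCovariateProcess P m T S K ρ V)
    {g : EuclideanSpace ℝ (Fin d) → ℝ} (hg : MemLp g 2 (multivariateGaussian 0 S)) {p q : ℕ × ℕ}
    (hp : p ∈ cells m T) (hq : q ∈ cells m T) :
    |∫ ω, g (V p.1 p.2 ω) * g (V q.1 q.2 ω) ∂P - (∫ v, g v ∂(multivariateGaussian 0 S)) ^ 2| ≤
      ∫ v, g v ^ 2 ∂(multivariateGaussian 0 S) + (∫ v, g v ∂(multivariateGaussian 0 S)) ^ 2 := by
  rw [mem_cells] at hp hq
  have mp := hg.comp_measurePreserving (hV.measurePreserving hp.1 hp.2)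
  have mq := hg.comp_measurePreserving (hV.measurePreserving hq.1 hq.2)
  have ep := hV.integral_comp hp.1 hp.2 (g := fun v => g v ^ 2) (hg.aestronglyMeasurable.pow 2)
  have eq := hV.integral_comp hq.1 hq.2 (g := fun v => g v ^ 2) (hg.aestronglyMeasurable.pow 2)
  refine (abs_sub _ _).trans ?_
  rw [abs_of_nonneg (sq_nonneg (∫ v, g v ∂(multivariateGaussian 0 S)))]
  gcongr
  calc |∫ ω, g (V p.1 p.2 ω) * g (V q.1 q.2 ω) ∂P|
      ≤ ∫ ω, |g (V p.1 p.2 ω) * g (V q.1 q.2 ω)| ∂P := abs_integral_le_integral_abs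
    _ ≤ ∫ ω, (1 / 2 * g (V p.1 p.2 ω) ^ 2 + 1 / 2 * g (V q.1 q.2 ω) ^ 2) ∂P := by
        refine integral_mono (mp.integrable_mul mq).abs ((mp.integrable_sq.const_mul _).add
          (mq.integrable_sq.const_mul _)) fun ω => ?_
        simp only [abs_mul]
        nlinarith [sq_nonneg (|g (V p.1 p.2 ω)| - |g (V q.1 q.2 ω)|), sq_abs (g (V p.1 p.2 ω)),
          sq_abs (g (V q.1 q.2 ω))]
    _ = 1 / 2 * ∫ ω, g (V p.1 p.2 ω) ^ 2 ∂P + 1 / 2 * ∫ ω, g (V q.1 q.2 ω) ^ 2 ∂P := by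
        rw [← integral_const_mul, ← integral_const_mul]
        exact integral_add (mp.integrable_sq.const_mul _) (mq.integrable_sq.const_mul _)
    _ = _ := by rw [ep, eq]; ring

/-- From lag k₀ on, the decay hypothesis puts the cross-covariance below κ, whatever the two firms
are. Firms in the same period may be arbitrarily dependent. -/
lemma IsCovariateProcess.abs_covariance_le_of_lag (hV : IsCovariateProcess P m T S K ρ V)
    {g : EuclideanSpace ℝ (Fin d) → ℝ} (hg : MemLp g 2 (multivariateGaussian 0 S)) {ε κ : ℝ}
    (hκ : ∀ ν : Measure (EuclideanSpace ℝ (Fin d) × EuclideanSpace ℝ (Fin d)),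
      IsGaussian ν → ν.map Prod.fst = multivariateGaussian 0 S →
      ν.map Prod.snd = multivariateGaussian 0 S →
      ‖Matrix.toEuclideanCLM (𝕜 := ℝ) (crossMoment ν Prod.fst Prod.snd)‖ ≤ κ →
      |∫ p, g p.1 * g p.2 ∂ν - (∫ x, g x ∂(multivariateGaussian 0 S)) ^ 2| ≤ ε)
    {k₀ : ℕ} (hk₀ : ∀ k ≥ k₀, K * ρ ^ k ≤ κ) {p q : ℕ × ℕ}
    (hp : p ∈ cells m T) (hq : q ∈ cells m T) (hlag : p.2 + k₀ ≤ q.2) :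
    |∫ ω, g (V p.1 p.2 ω) * g (V q.1 q.2 ω) ∂P - (∫ v, g v ∂(multivariateGaussian 0 S)) ^ 2| ≤ ε := by
  rw [mem_cells] at hp hq
  have hp' := hV.measurable p.1 hp.1 p.2 hp.2
  have hq' := hV.measurable q.1 hq.1 q.2 hq.2
  have hpq : Measurable fun ω => (V p.1 p.2 ω, V q.1 q.2 ω) := hp'.prodMk hq'
  have hG : HasGaussianLaw (fun ω => (V p.1 p.2 ω, V q.1 q.2 ω)) P :=
    hV.gaussian.hasGaussianLaw_prodMk (s := (⟨p.1, hp.1⟩, ⟨p.2, hp.2⟩))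
      (t := (⟨q.1, hq.1⟩, ⟨q.2, hq.2⟩))
  have m1 : (P.map fun ω => (V p.1 p.2 ω, V q.1 q.2 ω)).map Prod.fst = multivariateGaussian 0 S := by
    rw [Measure.map_map measurable_fst hpq]
    exact (hV.marginal p.1 hp.1 p.2 hp.2).map_eq
  have m2 : (P.map fun ω => (V p.1 p.2 ω, V q.1 q.2 ω)).map Prod.snd = multivariateGaussian 0 S := by
    rw [Measure.map_map measurable_snd hpq]
    exact (hV.marginal q.1 hq.1 q.2 hq.2).map_eq
  have hcm : crossMoment (P.map fun ω => (V p.1 p.2 ω, V q.1 q.2 ω)) Prod.fst Prod.snd =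
      crossMoment P (V p.1 p.2) (V q.1 q.2) := by
    ext k l
    simp only [crossMoment, Matrix.of_apply]
    rw [integral_map hpq.aemeasurable (by fun_prop)]
  have := hκ _ hG.isGaussian_map m1 m2 (by
    rw [hcm]
    have h := hV.decay p.1 hp.1 q.1 hq.1 p.2 (q.2 - p.2) (by omega)
    rw [show p.2 + (q.2 - p.2) = q.2 by omega] at h
    exact h.trans (hk₀ _ (by omega)))
  rwa [integral_map hpq.aemeasurable] at this
  refine AEStronglyMeasurable.mul ?_ ?_
  · refine AEStronglyMeasurable.comp_measurable (f := Prod.fst) ?_ measurable_fst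
    rw [m1]; exact hg.aestronglyMeasurable
  · refine AEStronglyMeasurable.comp_measurable (f := Prod.snd) ?_ measurable_snd
    rw [m2]; exact hg.aestronglyMeasurable

/-- Weak law of large numbers for the covariates, as a variance bound uniform over all models. -/
lemma exists_integral_sum_sub_sq_le (hS : S.PosSemidef) (hρ₀ : 0 < ρ) (hρ₁ : ρ < 1) (K : ℝ)
    {g : EuclideanSpace ℝ (Fin d) → ℝ} (hg : MemLp g 2 (multivariateGaussian 0 S)) {ε : ℝ}
    (hε : 0 < ε) :
    ∃ T₀ : ℕ, ∀ {Ω : Type*} [MeasurableSpace Ω] {P : Measure Ω} [IsProbabilityMeasure P] {m T : ℕ}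
      {V : ℕ → ℕ → Ω → EuclideanSpace ℝ (Fin d)}, IsCovariateProcess P m T S K ρ V → T₀ ≤ T →
      ∫ ω, (∑ p ∈ cells m T, g (V p.1 p.2 ω) -
        m * T * ∫ v, g v ∂(multivariateGaussian 0 S)) ^ 2 ∂P ≤ ε * (m * T) ^ 2 := by
  obtain ⟨κ, hκ0, hκ⟩ := exists_abs_integral_prod_sub_sq_le hS hg (ε := ε / 2) (by positivity)
  have hlim : Tendsto (fun k : ℕ => K * ρ ^ k) atTop (𝓝 0) := by
    simpa using (tendsto_pow_atTop_nhds_zero_of_lt_one hρ₀.le hρ₁).const_mul K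
  obtain ⟨k₀, hk₀⟩ := eventually_atTop.1 (hlim.eventually_le_const hκ0)
  set G := ∫ v, g v ∂(multivariateGaussian 0 S) with hG
  set M := ∫ v, g v ^ 2 ∂(multivariateGaussian 0 S) + G ^ 2 with hM
  have hM0 : 0 ≤ M := add_nonneg (integral_nonneg fun _ => sq_nonneg _) (sq_nonneg _)
  -- For each cell at most 2 k₀ m cells are close in time, each contributing up to M. For T ≥ T₀
  -- this is at most (ε/2) m T, as much as the far pairs are allowed.
  obtain ⟨T₀, hT₀⟩ := exists_nat_ge (2 * k₀ * M / (ε / 2))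
  refine ⟨T₀, fun {Ω} _ {P} _ {m T V} hV hT => ?_⟩
  have hTr : 2 * k₀ * M ≤ ε / 2 * T := by
    rw [div_le_iff₀ (by positivity)] at hT₀
    have : (T₀ : ℝ) ≤ T := by exact_mod_cast hT
    nlinarith
  have mem : ∀ p ∈ cells m T, MemLp (fun ω => g (V p.1 p.2 ω)) 2 P := fun p hp => by
    rw [mem_cells] at hp
    exact hg.comp_measurePreserving (hV.measurePreserving hp.1 hp.2)
  have memG : ∀ p ∈ cells m T, MemLp (fun ω => g (V p.1 p.2 ω) - G) 2 P := fun p hp =>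
    (mem p hp).sub (memLp_const G)
  have hint : ∀ p ∈ cells m T, ∀ q ∈ cells m T,
      Integrable (fun ω => (g (V p.1 p.2 ω) - G) * (g (V q.1 q.2 ω) - G)) P :=
    fun p hp q hq => (memG p hp).integrable_mul (memG q hq)
  have hcov : ∀ p ∈ cells m T, ∀ q ∈ cells m T,
      ∫ ω, (g (V p.1 p.2 ω) - G) * (g (V q.1 q.2 ω) - G) ∂P ≤
        ε / 2 + if p.2 < q.2 + k₀ ∧ q.2 < p.2 + k₀ then M else 0 := by
    intro p hp q hq
    have hp' := mem_cells.1 hp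
    have hq' := mem_cells.1 hq
    have e : ∫ ω, (g (V p.1 p.2 ω) - G) * (g (V q.1 q.2 ω) - G) ∂P =
        ∫ ω, g (V p.1 p.2 ω) * g (V q.1 q.2 ω) ∂P - G ^ 2 := by
      have := covariance_eq_sub (mem p hp) (mem q hq)
      rw [covariance, hV.integral_comp hp'.1 hp'.2 hg.aestronglyMeasurable,
        hV.integral_comp hq'.1 hq'.2 hg.aestronglyMeasurable, ← hG] at this
      rw [this]; simp [pow_two]
    rw [e]
    split_ifs with h
    · have := (le_abs_self _).trans (hV.abs_covariance_le hg hp hq)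
      linarith
    · rw [not_and_or, not_lt, not_lt] at h
      rw [add_zero]
      rcases h with h | h
      · have := hV.abs_covariance_le_of_lag hg hκ hk₀ hq hp h
        simp_rw [mul_comm (g (V q.1 q.2 _))] at this
        exact (le_abs_self _).trans this
      · exact (le_abs_self _).trans (hV.abs_covariance_le_of_lag hg hκ hk₀ hp hq h)
  have hcount : ∀ t : ℕ, ∑ s ∈ Finset.range T, (if t < s + k₀ ∧ s < t + k₀ then M else 0) ≤
      2 * k₀ * M := by
    intro t
    rw [← Finset.sum_filter, Finset.sum_const, nsmul_eq_mul]
    gcongr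
    have : (Finset.range T).filter (fun s => t < s + k₀ ∧ s < t + k₀) ⊆
        Finset.Ico (t + 1 - k₀) (t + k₀) := by
      intro s hs
      simp only [Finset.mem_filter, Finset.mem_range, Finset.mem_Ico] at hs ⊢
      omega
    have h2 := Finset.card_le_card this
    rw [Nat.card_Ico] at h2
    have h3 : ((Finset.range T).filter (fun s => t < s + k₀ ∧ s < t + k₀)).card ≤ 2 * k₀ := by omega
    exact_mod_cast h3
  have hsq : ∀ ω, (∑ p ∈ cells m T, g (V p.1 p.2 ω) - m * T * G) ^ 2 =
      ∑ p ∈ cells m T, ∑ q ∈ cells m T, (g (V p.1 p.2 ω) - G) * (g (V q.1 q.2 ω) - G) := by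
    intro ω
    rw [← Finset.sum_mul_sum, Finset.sum_sub_distrib, Finset.sum_const, card_cells, nsmul_eq_mul,
      pow_two]
    push_cast; ring
  simp_rw [hsq]
  rw [integral_finsetSum _ fun p hp => integrable_finsetSum _ (hint p hp)]
  calc ∑ p ∈ cells m T, ∫ ω, ∑ q ∈ cells m T, (g (V p.1 p.2 ω) - G) * (g (V q.1 q.2 ω) - G) ∂P
      ≤ ∑ p ∈ cells m T, ∑ q ∈ cells m T,
        (ε / 2 + if p.2 < q.2 + k₀ ∧ q.2 < p.2 + k₀ then M else 0) := by
        refine Finset.sum_le_sum fun p hp => ?_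
        rw [integral_finsetSum _ (hint p hp)]
        exact Finset.sum_le_sum fun q hq => hcov p hp q hq
    _ ≤ ∑ _p ∈ cells m T, (m * (ε / 2 * T + 2 * k₀ * M)) := by
        refine Finset.sum_le_sum fun p hp => ?_
        rw [cells, Finset.sum_product]
        refine (Finset.sum_le_card_nsmul (Finset.range m) _ (ε / 2 * T + 2 * k₀ * M)
          fun x _ => ?_).trans (by rw [Finset.card_range, nsmul_eq_mul])
        rw [Finset.sum_add_distrib, Finset.sum_const, Finset.card_range, nsmul_eq_mul]
        linarith [hcount p.2]
    _ = m * T * (m * (ε / 2 * T + 2 * k₀ * M)) := by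
        rw [Finset.sum_const, card_cells, nsmul_eq_mul]; push_cast; ring
    _ ≤ m * T * (m * (ε / 2 * T + ε / 2 * T)) := by gcongr
    _ = _ := by ring

end LawOfLargeNumbers

/-! ### Conditionally independent Bernoulli trials -/

section BernoulliScheme

variable {Ω : Type*} {mΩ : MeasurableSpace Ω} {P : Measure Ω} {m T : ℕ}
  {F : ℕ → MeasurableSpace Ω} {D a : ℕ → ℕ → Ω → ℝ}

/-- `0`-`1` variables `D i t`, `i < m`, that are, given the past `F t`, independent with success
probabilities `a i t`. -/
structure IsBernoulliScheme (P : Measure Ω) (m T : ℕ) (F : ℕ → MeasurableSpace Ω)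
    (D a : ℕ → ℕ → Ω → ℝ) : Prop where
  le : ∀ t < T, F t ≤ mΩ
  mono : ∀ s t, s ≤ t → t < T → F s ≤ F t
  measurable : ∀ i < m, ∀ t < T, Measurable (D i t)
  adapted : ∀ i < m, ∀ s t, s < t → t < T → Measurable[F t] (D i s)
  zero_or_one : ∀ i < m, ∀ t < T, ∀ ω, D i t ω = 0 ∨ D i t ω = 1
  measurable_prob : ∀ i < m, ∀ t < T, Measurable[F t] (a i t)
  prob_nonneg : ∀ i < m, ∀ t < T, ∀ ω, 0 ≤ a i t ω
  prob_le_one : ∀ i < m, ∀ t < T, ∀ ω, a i t ω ≤ 1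
  condExp_prod : ∀ t < T, ∀ s ⊆ Finset.range m,
    P[fun ω => ∏ i ∈ s, D i t ω | F t] =ᵐ[P] fun ω => ∏ i ∈ s, a i t ω

/-- Pulling a bounded known factor out of a conditional expectation. The factor may be real or
complex, for the supermartingale and for characteristic functions. -/
lemma integral_smul_eq_of_condExp {𝕜 : Type*} [RCLike 𝕜] [IsProbabilityMeasure P]
    {G : MeasurableSpace Ω} (hG : G ≤ mΩ) {f g : Ω → ℝ} (hfg : P[f | G] =ᵐ[P] g)
    (hf : Integrable f P) {Z : Ω → 𝕜} (hZ : Measurable[G] Z) {B : ℝ} (hB : ∀ ω, ‖Z ω‖ ≤ B) :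
    ∫ ω, f ω • Z ω ∂P = ∫ ω, g ω • Z ω ∂P := by
  have hZs : StronglyMeasurable[G] Z := hZ.stronglyMeasurable
  have hi : Integrable (f • Z) P :=
    hf.smul_of_top_left (memLp_top_of_bound (hZs.mono hG).aestronglyMeasurable B (ae_of_all _ hB))
  have h1 := condExp_smul_of_aestronglyMeasurable_right hf hi hZs.aestronglyMeasurable
  calc ∫ ω, f ω • Z ω ∂P = ∫ ω, (P[f • Z | G]) ω ∂P := (integral_condExp hG).symm
    _ = ∫ ω, g ω • Z ω ∂P := by
        apply integral_congr_ae
        filter_upwards [h1, hfg] with ω h2 h3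
        rw [h2, Pi.smul_apply', h3]

namespace IsBernoulliScheme

variable (h : IsBernoulliScheme P m T F D a)
include h

lemma abs_le_one {i t : ℕ} (hi : i < m) (ht : t < T) (ω : Ω) : |D i t ω| ≤ 1 := by
  rcases h.zero_or_one i hi t ht ω with h | h <;> simp [h]

lemma nonneg {i t : ℕ} (hi : i < m) (ht : t < T) (ω : Ω) : 0 ≤ D i t ω := by
  rcases h.zero_or_one i hi t ht ω with h | h <;> simp [h]

variable [IsProbabilityMeasure P]

/-- Expanding the product over sets of firms leaves exactly the conditional moments that the scheme
prescribes. Since D is 0 or 1, the factor 1 + D (e^x - 1) equals e^{Dx}, so this computes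
conditional exponential moments of sums over firms. -/
lemma integral_prod_smul {𝕜 : Type*} [RCLike 𝕜] {t : ℕ} (ht : t < T) {Z : Ω → 𝕜} {z : ℕ → Ω → 𝕜}
    (hZ : Measurable[F t] Z) (hz : ∀ i < m, Measurable[F t] (z i)) {B b : ℝ} (hB : ∀ ω, ‖Z ω‖ ≤ B)
    (hb : ∀ i < m, ∀ ω, ‖z i ω‖ ≤ b) :
    ∫ ω, Z ω * ∏ i ∈ Finset.range m, (1 + D i t ω • z i ω) ∂P =
      ∫ ω, Z ω * ∏ i ∈ Finset.range m, (1 + a i t ω • z i ω) ∂P := by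
  have hexp : ∀ c : ℕ → ℕ → Ω → ℝ, ∀ ω, Z ω * ∏ i ∈ Finset.range m, (1 + c i t ω • z i ω) =
      ∑ s ∈ (Finset.range m).powerset, (∏ i ∈ s, c i t ω) • (Z ω * ∏ i ∈ s, z i ω) := by
    intro c ω
    rw [Finset.prod_one_add, Finset.mul_sum]
    refine Finset.sum_congr rfl fun s _ => ?_
    rw [Finset.prod_smul, mul_smul_comm]
  have hsm : ∀ s ∈ (Finset.range m).powerset, Measurable[F t] (fun ω => Z ω * ∏ i ∈ s, z i ω) := by
    intro s hs
    refine hZ.mul ?_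
    exact Finset.measurable_prod s fun i hi => hz i (Finset.mem_range.1 (Finset.mem_powerset.1 hs hi))
  have hsb : ∀ s ∈ (Finset.range m).powerset, ∀ ω, ‖Z ω * ∏ i ∈ s, z i ω‖ ≤ B * ∏ _i ∈ s, b := by
    intro s hs ω
    rw [norm_mul, norm_prod]
    have hB0 : 0 ≤ B := (norm_nonneg _).trans (hB ω)
    gcongr with i hi
    · exact hB ω
    · exact hb i (Finset.mem_range.1 (Finset.mem_powerset.1 hs hi)) ω
  have key : ∀ c : ℕ → ℕ → Ω → ℝ, (∀ i < m, Measurable (c i t)) → (∀ i < m, ∀ ω, |c i t ω| ≤ 1) →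
      ∀ s ∈ (Finset.range m).powerset, Integrable (fun ω => ∏ i ∈ s, c i t ω) P ∧
        Integrable (fun ω => (∏ i ∈ s, c i t ω) • (Z ω * ∏ i ∈ s, z i ω)) P := by
    intro c hc hc1 s hs
    have hmem : ∀ i ∈ s, i < m := fun i hi => Finset.mem_range.1 (Finset.mem_powerset.1 hs hi)
    have h1 : Integrable (fun ω => ∏ i ∈ s, c i t ω) P := by
      refine Integrable.of_bound (C := 1)
        (Finset.measurable_prod s fun i hi => hc i (hmem i hi)).aestronglyMeasurable
        (ae_of_all _ fun ω => ?_)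
      rw [norm_prod]
      exact Finset.prod_le_one (fun _ _ => norm_nonneg _) fun i hi => hc1 i (hmem i hi) ω
    refine ⟨h1, ?_⟩
    exact h1.smul_of_top_left (memLp_top_of_bound
      ((hsm s hs).stronglyMeasurable.mono (h.le t ht)).aestronglyMeasurable _ (ae_of_all _ (hsb s hs)))
  have kD := key D (fun i hi => h.measurable i hi t ht) (fun i hi ω => h.abs_le_one hi ht ω)
  have ka := key a (fun i hi => (h.measurable_prob i hi t ht).mono (h.le t ht) le_rfl)
    (fun i hi ω => by
      rw [abs_of_nonneg (h.prob_nonneg i hi t ht ω)]; exact h.prob_le_one i hi t ht ω)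
  simp_rw [hexp]
  rw [integral_finsetSum _ fun s hs => (kD s hs).2, integral_finsetSum _ fun s hs => (ka s hs).2]
  refine Finset.sum_congr rfl fun s hs => ?_
  exact integral_smul_eq_of_condExp (h.le t ht) (h.condExp_prod t ht s (Finset.mem_powerset.1 hs))
    (kD s hs).1 (hsm s hs) (hsb s hs)

/-- The one-firm case of the prescribed moments, with f merely integrable, so that unbounded
functions of the covariates are covered. -/
lemma integral_mul_eq {i t : ℕ} (hi : i < m) (ht : t < T) {f : Ω → ℝ} (hf : Measurable[F t] f)
    (hfi : Integrable f P) : ∫ ω, D i t ω * f ω ∂P = ∫ ω, a i t ω * f ω ∂P := by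
  have hD : Integrable (D i t) P := Integrable.of_bound (C := 1)
    (h.measurable i hi t ht).aestronglyMeasurable (ae_of_all _ fun ω => h.abs_le_one hi ht ω)
  have hDf : Integrable (D i t * f) P :=
    hfi.bdd_mul (c := 1) (h.measurable i hi t ht).aestronglyMeasurable
      (ae_of_all _ fun ω => h.abs_le_one hi ht ω)
  have h1 := condExp_mul_of_stronglyMeasurable_right (m := F t) (hf.stronglyMeasurable) hDf hD
  have h2 := h.condExp_prod t ht {i} (by simpa using hi)
  simp only [Finset.prod_singleton] at h2
  calc ∫ ω, D i t ω * f ω ∂P = ∫ ω, (P[D i t * f | F t]) ω ∂P := (integral_condExp (h.le t ht)).symm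
    _ = ∫ ω, a i t ω * f ω ∂P := by
        apply integral_congr_ae
        filter_upwards [h1, h2] with ω h3 h4
        rw [h3, Pi.mul_apply]
        congr 1

/-- Exponential supermartingale bound for the number of successes among predictably selected
trials. -/
lemma integral_exp_le_one {f : ℕ → ℕ → Ω → ℝ} (hf : ∀ i < m, ∀ t < T, Measurable[F t] (f i t))
    (hf01 : ∀ i < m, ∀ t < T, ∀ ω, f i t ω = 0 ∨ f i t ω = 1) (n : ℕ) (hn : n ≤ T) :
    ∫ ω, Real.exp (∑ t ∈ Finset.range n, ∑ i ∈ Finset.range m,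
      (-(D i t ω * f i t ω) + (1 - Real.exp (-1)) * (a i t ω * f i t ω))) ∂P ≤ 1 := by
  -- For f equal to 0 or 1 the conditional mean of e^{-Df} is 1 - c a f ≤ e^{-c a f}, which is the
  -- supermartingale property.
  set c : ℝ := 1 - Real.exp (-1) with hc
  have hc0 : 0 ≤ c := by rw [hc]; have := Real.exp_le_one_iff.2 (show (-1 : ℝ) ≤ 0 by norm_num); linarith
  have hc1 : c ≤ 1 := by rw [hc]; linarith [Real.exp_pos (-1)]
  induction n with
  | zero => simp
  | succ n ih =>
    have hnT : n < T := hn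
    set M : Ω → ℝ := fun ω => Real.exp (∑ t ∈ Finset.range n, ∑ i ∈ Finset.range m,
      (-(D i t ω * f i t ω) + c * (a i t ω * f i t ω))) with hM
    have hmm : Measurable[F n] fun ω => (∑ t ∈ Finset.range n, ∑ i ∈ Finset.range m,
      (-(D i t ω * f i t ω) + c * (a i t ω * f i t ω))) := by
      refine Finset.measurable_sum _ fun t ht => Finset.measurable_sum _ fun i hi => ?_
      have ht' := Finset.mem_range.1 ht
      have hi' := Finset.mem_range.1 hi
      have hle := h.mono t n ht'.le hnT
      have h1 := h.adapted i hi' t n ht' hnT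
      have h2 := (h.measurable_prob i hi' t (by omega)).mono hle le_rfl
      have h3 := (hf i hi' t (by omega)).mono hle le_rfl
      exact (h1.mul h3).neg.add ((h2.mul h3).const_mul c)
    have hb : ∀ ω, ∀ i < m, 0 ≤ a i n ω * f i n ω ∧ a i n ω * f i n ω ≤ 1 := by
      intro ω i hi
      have h1 := h.prob_nonneg i hi n hnT ω
      have h2 := h.prob_le_one i hi n hnT ω
      rcases hf01 i hi n hnT ω with h3 | h3 <;> rw [h3] <;> constructor <;> linarith
    have hMb : ∀ ω, M ω ≤ Real.exp (n * m) := by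
      intro ω
      apply Real.exp_le_exp.2
      calc _ ≤ ∑ t ∈ Finset.range n, ∑ i ∈ Finset.range m, (1 : ℝ) := by
            refine Finset.sum_le_sum fun t ht => Finset.sum_le_sum fun i hi => ?_
            have ht' := Finset.mem_range.1 ht
            have hi' := Finset.mem_range.1 hi
            have h1 := h.prob_nonneg i hi' t (by omega) ω
            have h2 := h.prob_le_one i hi' t (by omega) ω
            have h3 := h.nonneg hi' (show t < T by omega) ω
            rcases hf01 i hi' t (by omega) ω with h4 | h4 <;> rw [h4] <;> nlinarith
        _ = _ := by simp
    -- Z gathers what is known at time n: the past and the compensator of the current period.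
    set Z : Ω → ℝ := fun ω => M ω * Real.exp (∑ i ∈ Finset.range m, c * (a i n ω * f i n ω)) with hZ
    have hZm : Measurable[F n] Z := by
      refine (Real.measurable_exp.comp hmm).mul (Real.measurable_exp.comp ?_)
      refine Finset.measurable_sum _ fun i hi => ?_
      have hi' := Finset.mem_range.1 hi
      exact ((h.measurable_prob i hi' n hnT).mul (hf i hi' n hnT)).const_mul c
    have hZb : ∀ ω, ‖Z ω‖ ≤ Real.exp (n * m) * Real.exp m := by
      intro ω
      rw [Real.norm_eq_abs, abs_of_nonneg (by positivity)]
      refine mul_le_mul (hMb ω) (Real.exp_le_exp.2 ?_) (Real.exp_pos _).le (Real.exp_pos _).le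
      calc _ ≤ ∑ i ∈ Finset.range m, (1 : ℝ) := by
            refine Finset.sum_le_sum fun i hi => ?_
            have := hb ω i (Finset.mem_range.1 hi)
            nlinarith
        _ = _ := by simp
    have hzm : ∀ i < m, Measurable[F n] (fun ω => Real.exp (-f i n ω) - 1) := fun i hi =>
      (Real.measurable_exp.comp (hf i hi n hnT).neg).sub_const 1
    have hzb : ∀ i < m, ∀ ω, ‖Real.exp (-f i n ω) - 1‖ ≤ 1 := by
      intro i hi ω
      rcases hf01 i hi n hnT ω with h3 | h3 <;> rw [h3, Real.norm_eq_abs]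
      · simp
      · rw [abs_of_nonpos (by rw [hc] at hc0; linarith)]; rw [hc] at hc1; linarith
    have key := h.integral_prod_smul hnT hZm hzm hZb hzb
    have e1 : ∀ ω, Z ω * ∏ i ∈ Finset.range m, (1 + D i n ω • (Real.exp (-f i n ω) - 1)) =
        Real.exp (∑ t ∈ Finset.range (n + 1), ∑ i ∈ Finset.range m,
          (-(D i t ω * f i t ω) + c * (a i t ω * f i t ω))) := by
      intro ω
      rw [Finset.sum_range_succ, Real.exp_add, Finset.sum_add_distrib (f := fun i => -(D i n ω * f i n ω)),
        Real.exp_add, hZ]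
      simp only
      rw [mul_assoc]
      congr 1
      rw [mul_comm]
      congr 1
      rw [Real.exp_sum]
      refine Finset.prod_congr rfl fun i hi => ?_
      rcases h.zero_or_one i (Finset.mem_range.1 hi) n hnT ω with h3 | h3 <;> rw [h3] <;> simp
    have e2 : ∀ ω, Z ω * ∏ i ∈ Finset.range m, (1 + a i n ω • (Real.exp (-f i n ω) - 1)) ≤ M ω := by
      intro ω
      rw [hZ]
      simp only
      rw [mul_assoc]
      refine mul_le_of_le_one_right (Real.exp_pos _).le ?_
      rw [Real.exp_sum, ← Finset.prod_mul_distrib]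
      have hfac : ∀ i ∈ Finset.range m, 1 + a i n ω • (Real.exp (-f i n ω) - 1) =
          1 - c * (a i n ω * f i n ω) := by
        intro i hi
        rcases hf01 i (Finset.mem_range.1 hi) n hnT ω with h3 | h3 <;> rw [h3] <;> simp [hc]; ring
      refine Finset.prod_le_one (fun i hi => ?_) fun i hi => ?_
      · rw [hfac i hi]
        have := hb ω i (Finset.mem_range.1 hi)
        exact mul_nonneg (Real.exp_pos _).le (by nlinarith)
      · rw [hfac i hi]
        calc Real.exp (c * (a i n ω * f i n ω)) * (1 - c * (a i n ω * f i n ω))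
            ≤ Real.exp (c * (a i n ω * f i n ω)) * Real.exp (-(c * (a i n ω * f i n ω))) := by
              gcongr
              linarith [Real.add_one_le_exp (-(c * (a i n ω * f i n ω)))]
          _ = 1 := by rw [← Real.exp_add]; simp
    have hMi : Integrable M P := Integrable.of_bound (C := Real.exp (n * m))
      ((Real.measurable_exp.comp hmm).stronglyMeasurable.mono (h.le n hnT)).aestronglyMeasurable
      (ae_of_all _ fun ω => by
        rw [Real.norm_eq_abs, abs_of_pos (Real.exp_pos _)]; exact hMb ω)
    have hMint : ∫ ω, M ω ∂P ≤ 1 := ih (by omega)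
    simp_rw [e1] at key
    rw [key]
    refine le_trans ?_ hMint
    -- Without integrability the integral is 0 by convention, and the bound holds trivially.
    by_cases hi : Integrable (fun ω => Z ω * ∏ i ∈ Finset.range m,
        (1 + a i n ω • (Real.exp (-f i n ω) - 1))) P
    · exact integral_mono hi hMi e2
    · rw [integral_undef hi]; exact integral_nonneg fun ω => (Real.exp_pos _).le

end IsBernoulliScheme

end BernoulliScheme

/-! ### A quantitative martingale central limit theorem -/

/-- The compensated characteristic function of one small Bernoulli increment. -/
lemma norm_exp_mul_bernoulli_sub_one_le {a g ε : ℝ} (ha : 0 ≤ a) (haε : a ≤ ε) (hg : |g| ≤ ε)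
    (hε : ε ≤ 1 / 2) :
    ‖Complex.exp (-(Complex.I * (a * g : ℝ)) + (a * g ^ 2 / 2 : ℝ)) *
      (1 + a • (Complex.exp (Complex.I * g) - 1)) - 1‖ ≤ 9 * ε * (a * g ^ 2) := by
  have hg0 := abs_nonneg g
  -- The Bernoulli factor 1 + a(e^{ig} - 1) equals 1 - v + r, where r is a times the third-order
  -- remainder of e^{ig}. Hence e^v (1 - v + r) - 1 consists of terms in v² and r, all of order ε a
  -- g².
  set v : ℂ := -(Complex.I * (a * g : ℝ)) + (a * g ^ 2 / 2 : ℝ) with hv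
  set r : ℂ := a • (Complex.exp (Complex.I * g) - 1) + v with hr
  have hgsq : g ^ 2 = |g| * |g| := by rw [← sq_abs]; ring
  have hnv : ‖v‖ ≤ 3 / 2 * (a * |g|) := by
    calc ‖v‖ ≤ ‖-(Complex.I * (a * g : ℝ))‖ + ‖((a * g ^ 2 / 2 : ℝ) : ℂ)‖ := norm_add_le _ _
      _ = a * |g| + a * g ^ 2 / 2 := by
          rw [norm_neg, norm_mul, Complex.norm_I, one_mul, Complex.norm_real, Complex.norm_real,
            Real.norm_eq_abs, Real.norm_eq_abs, abs_mul, abs_of_nonneg ha,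
            abs_of_nonneg (show 0 ≤ a * g ^ 2 / 2 by positivity)]
      _ ≤ _ := by rw [hgsq]; nlinarith [mul_nonneg ha hg0]
  have hnv1 : ‖v‖ ≤ 1 := by nlinarith
  have hv2 : ‖v‖ ^ 2 ≤ 9 / 4 * (ε * (a * g ^ 2)) := by
    calc ‖v‖ ^ 2 ≤ (3 / 2 * (a * |g|)) ^ 2 := by gcongr
      _ = 9 / 4 * (a * (a * g ^ 2)) := by rw [hgsq]; ring
      _ ≤ _ := by gcongr
  have hnr : ‖r‖ ≤ ε * (a * g ^ 2) := by
    have hIg : ‖Complex.I * (g : ℂ)‖ = |g| := by simp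
    have h1 := Complex.exp_bound (x := Complex.I * g) (by rw [hIg]; linarith) (n := 3) (by norm_num)
    rw [hIg] at h1
    have e : r = a • (Complex.exp (Complex.I * g) -
        ∑ m ∈ Finset.range 3, (Complex.I * g) ^ m / (m.factorial : ℂ)) := by
      rw [hr, hv, Complex.real_smul, Complex.real_smul]
      simp only [Finset.sum_range_succ, Finset.sum_range_zero, Nat.factorial]
      push_cast
      ring_nf
      rw [Complex.I_sq]
      ring
    rw [e, norm_smul, Real.norm_eq_abs, abs_of_nonneg ha]
    have h2 : |g| ^ 3 * ((Nat.succ 3 : ℝ) * ((Nat.factorial 3 : ℝ) * ((3 : ℕ) : ℝ))⁻¹) ≤ ε * g ^ 2 := by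
      have e3 : ((Nat.succ 3 : ℝ) * ((Nat.factorial 3 : ℝ) * ((3 : ℕ) : ℝ))⁻¹) = 2 / 9 := by
        norm_num [Nat.factorial]
      rw [e3, hgsq]
      nlinarith [mul_nonneg hg0 hg0]
    calc a * _ ≤ a * (ε * g ^ 2) := by gcongr; exact h1.trans h2
      _ = _ := by ring
  have h1 := Complex.norm_exp_sub_one_sub_id_le hnv1
  set s : ℂ := Complex.exp v - 1 - v with hs
  have hexp : Complex.exp v = 1 + v + s := by rw [hs]; ring
  have hu : a • (Complex.exp (Complex.I * g) - 1) = -v + r := by rw [hr]; ring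
  have hw0 : 0 ≤ ε * (a * g ^ 2) := (norm_nonneg _).trans hnr
  have hr1 : ‖r‖ ≤ 1 / 2 := by
    refine hnr.trans ?_
    have : a * g ^ 2 ≤ 1 := by rw [hgsq]; nlinarith [mul_nonneg hg0 hg0]
    nlinarith
  rw [hexp, hu]
  have e : (1 + v + s) * (1 + (-v + r)) - 1 = -v ^ 2 + (1 + v) * r + s * (1 + (-v + r)) := by ring
  rw [e]
  calc ‖-v ^ 2 + (1 + v) * r + s * (1 + (-v + r))‖
      ≤ ‖-v ^ 2‖ + ‖(1 + v) * r‖ + ‖s * (1 + (-v + r))‖ := norm_add₃_le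
    _ ≤ ‖v‖ ^ 2 + 2 * ‖r‖ + ‖v‖ ^ 2 * 2 := by
        have b1 : ‖(1 : ℂ) + v‖ ≤ 2 := by
          refine (norm_add_le _ _).trans ?_
          rw [norm_one]; linarith
        have b2 : ‖(1 : ℂ) + (-v + r)‖ ≤ 2 := by
          have : ‖v‖ ≤ 1 / 2 := by nlinarith
          refine (norm_add_le _ _).trans ?_
          have := norm_add_le (-v) r
          rw [norm_neg] at this
          rw [norm_one]; linarith
        rw [norm_neg, norm_pow, norm_mul, norm_mul]
        gcongr
    _ ≤ 9 * ε * (a * g ^ 2) := by linarith [(show 9 * ε * (a * g ^ 2) = 9 * (ε * (a * g ^ 2)) by ring)]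

section

variable {Ω : Type*} {mΩ : MeasurableSpace Ω} {P : Measure Ω} {m T : ℕ}
  {F : ℕ → MeasurableSpace Ω} {D a : ℕ → ℕ → Ω → ℝ}

/-- Quantitative martingale central limit theorem: the characteristic function of a sum of small
compensated Bernoulli variables, corrected by the predictable variance. -/
lemma IsBernoulliScheme.norm_integral_exp_sub_one_le [IsProbabilityMeasure P]
    (h : IsBernoulliScheme P m T F D a) {g : ℕ → ℕ → Ω → ℝ}
    (hg : ∀ i < m, ∀ t < T, Measurable[F t] (g i t)) {ε B : ℝ} (hε0 : 0 ≤ ε) (hε : ε ≤ 1 / 2)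
    (hgε : ∀ i < m, ∀ t < T, ∀ ω, |g i t ω| ≤ ε)
    (haε : ∀ i < m, ∀ t < T, ∀ ω, g i t ω = 0 ∨ a i t ω ≤ ε)
    (hB : ∀ ω, ∑ t ∈ Finset.range T, ∑ i ∈ Finset.range m, a i t ω * g i t ω ^ 2 ≤ B) :
    ‖∫ ω, Complex.exp (∑ t ∈ Finset.range T, ∑ i ∈ Finset.range m,
      (Complex.I * ((D i t ω - a i t ω) * g i t ω : ℝ) + (a i t ω * g i t ω ^ 2 / 2 : ℝ))) ∂P - 1‖ ≤
      9 * ε * B * Real.exp (10 * B) := by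
  have hw0 : ∀ i < m, ∀ t < T, ∀ ω, 0 ≤ a i t ω * g i t ω ^ 2 := fun i hi t ht ω =>
    mul_nonneg (h.prob_nonneg i hi t ht ω) (sq_nonneg _)
  set w : ℕ → Ω → ℝ := fun t ω => ∑ i ∈ Finset.range m, a i t ω * g i t ω ^ 2 with hw
  have hwn : ∀ t < T, ∀ ω, 0 ≤ w t ω := fun t ht ω =>
    Finset.sum_nonneg fun i hi => hw0 i (Finset.mem_range.1 hi) t ht ω
  have hWB : ∀ n ≤ T, ∀ ω, ∑ t ∈ Finset.range n, w t ω ≤ B := by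
    intro n hn ω
    refine le_trans ?_ (hB ω)
    exact Finset.sum_le_sum_of_subset_of_nonneg (Finset.range_mono hn)
      fun t ht _ => hwn t (Finset.mem_range.1 ht) ω
  have hwB : ∀ t < T, ∀ ω, w t ω ≤ B := by
    intro t ht ω
    refine le_trans ?_ (hB ω)
    exact Finset.single_le_sum (f := fun t => w t ω) (fun s hs => hwn s (Finset.mem_range.1 hs) ω)
      (Finset.mem_range.2 ht)
  obtain ⟨ω₀⟩ : Nonempty Ω := nonempty_of_isProbabilityMeasure P
  have hB0 : 0 ≤ B := by simpa using hWB 0 (by omega) ω₀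
  have hwm : ∀ t < T, Measurable[F t] (w t) := fun t ht =>
    Finset.measurable_sum _ fun i hi =>
      (h.measurable_prob i (Finset.mem_range.1 hi) t ht).mul ((hg i (Finset.mem_range.1 hi) t ht).pow_const 2)
  have hwi : ∀ t < T, Integrable (w t) P := fun t ht =>
    Integrable.of_bound (C := B) ((hwm t ht).mono (h.le t ht) le_rfl).aestronglyMeasurable
      (ae_of_all _ fun ω => by rw [Real.norm_eq_abs, abs_of_nonneg (hwn t ht ω)]; exact hwB t ht ω)
  set X : ℕ → Ω → ℂ := fun t ω => ∑ i ∈ Finset.range m,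
      (Complex.I * ((D i t ω - a i t ω) * g i t ω : ℝ) + (a i t ω * g i t ω ^ 2 / 2 : ℝ)) with hX
  have hXre : ∀ t ω, (X t ω).re = w t ω / 2 := by
    intro t ω
    simp only [hX, hw, Complex.re_sum, Finset.sum_div]
    refine Finset.sum_congr rfl fun i _ => ?_
    rw [Complex.add_re, Complex.re_mul_ofReal, Complex.ofReal_re]
    simp
  have hnorm : ∀ n ≤ T, ∀ ω, ‖Complex.exp (∑ t ∈ Finset.range n, X t ω)‖ ≤ Real.exp (B / 2) := by
    intro n hn ω
    rw [Complex.norm_exp, Complex.re_sum]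
    apply Real.exp_le_exp.2
    simp_rw [hXre]
    rw [← Finset.sum_div]
    linarith [hWB n hn ω]
  -- The error of a period is proportional to the predictable variance `w n` of that period, so the
  -- errors sum to a multiple of ε B rather than growing with T. The exponent 10 B is the sum of B/2
  -- from the past and 9 B from the period, rounded up.
  have hmain : ∀ n ≤ T, ‖∫ ω, Complex.exp (∑ t ∈ Finset.range n, X t ω) ∂P - 1‖ ≤
      9 * ε * Real.exp (10 * B) * ∫ ω, ∑ t ∈ Finset.range n, w t ω ∂P := by
    intro n
    induction n with
    | zero => intro _; simp
    | succ n ih =>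
      intro hn
      have hnT : n < T := hn
      have ih' := ih (by omega)
      have hXmeas : Measurable[F n] fun ω => Complex.exp (∑ t ∈ Finset.range n, X t ω) := by
        refine Complex.measurable_exp.comp (Finset.measurable_sum _ fun t ht =>
          Finset.measurable_sum _ fun i hi => ?_)
        have ht' := Finset.mem_range.1 ht
        have hi' := Finset.mem_range.1 hi
        have hle := h.mono t n ht'.le hnT
        have h1 := h.adapted i hi' t n ht' hnT
        have h2 := (h.measurable_prob i hi' t (by omega)).mono hle le_rfl
        have h3 := (hg i hi' t (by omega)).mono hle le_rfl
        exact ((Complex.measurable_ofReal.comp ((h1.sub h2).mul h3)).const_mul Complex.I).add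
          (Complex.measurable_ofReal.comp ((h2.mul (h3.pow_const 2)).div_const 2))
      set E : Ω → ℂ := fun ω => Complex.exp (∑ t ∈ Finset.range n, X t ω) with hE
      set Y : Ω → ℂ := fun ω => ∑ i ∈ Finset.range m, (-(Complex.I * (a i n ω * g i n ω : ℝ)) +
        (a i n ω * g i n ω ^ 2 / 2 : ℝ)) with hY
      have hYm : Measurable[F n] fun ω => Complex.exp (Y ω) := by
        refine Complex.measurable_exp.comp (Finset.measurable_sum _ fun i hi => ?_)
        have hi' := Finset.mem_range.1 hi
        have h2 := h.measurable_prob i hi' n hnT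
        have h3 := hg i hi' n hnT
        exact ((Complex.measurable_ofReal.comp (h2.mul h3)).const_mul Complex.I).neg.add
          (Complex.measurable_ofReal.comp ((h2.mul (h3.pow_const 2)).div_const 2))
      have hYb : ∀ ω, ‖Complex.exp (Y ω)‖ ≤ Real.exp (B / 2) := by
        intro ω
        rw [Complex.norm_exp]
        apply Real.exp_le_exp.2
        have : (Y ω).re = w n ω / 2 := by
          simp only [hY, hw, Complex.re_sum, Finset.sum_div]
          refine Finset.sum_congr rfl fun i _ => ?_
          rw [Complex.add_re, Complex.neg_re, Complex.re_mul_ofReal, Complex.ofReal_re]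
          simp
        rw [this]; linarith [hwB n hnT ω]
      have hEb : ∀ ω, ‖E ω‖ ≤ Real.exp (B / 2) := hnorm n (by omega)
      have key := h.integral_prod_smul hnT (Z := fun ω => E ω * Complex.exp (Y ω))
        (z := fun i ω => Complex.exp (Complex.I * (g i n ω : ℝ)) - 1) (hXmeas.mul hYm)
        (fun i hi => (Complex.measurable_exp.comp
          ((Complex.measurable_ofReal.comp (hg i hi n hnT)).const_mul Complex.I)).sub_const 1)
        (B := Real.exp (B / 2) * Real.exp (B / 2)) (b := 2)
        (fun ω => by rw [norm_mul]; gcongr; exacts [hEb ω, hYb ω])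
        (fun i hi ω => by
          refine (norm_sub_le _ _).trans ?_
          rw [mul_comm, Complex.norm_exp_ofReal_mul_I, norm_one]; norm_num)
      have e1 : ∀ ω, E ω * Complex.exp (Y ω) *
          ∏ i ∈ Finset.range m, (1 + D i n ω • (Complex.exp (Complex.I * (g i n ω : ℝ)) - 1)) =
          Complex.exp (∑ t ∈ Finset.range (n + 1), X t ω) := by
        intro ω
        rw [Finset.sum_range_succ, Complex.exp_add, mul_assoc]
        congr 1
        simp only [hY, hX]
        rw [Complex.exp_sum, Complex.exp_sum, ← Finset.prod_mul_distrib]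
        refine Finset.prod_congr rfl fun i hi => ?_
        have : 1 + D i n ω • (Complex.exp (Complex.I * (g i n ω : ℝ)) - 1) =
            Complex.exp (Complex.I * (D i n ω * g i n ω : ℝ)) := by
          rcases h.zero_or_one i (Finset.mem_range.1 hi) n hnT ω with h3 | h3 <;> rw [h3] <;> simp
        rw [this, ← Complex.exp_add]
        congr 1
        push_cast; ring
      -- R is the relative error of one period: the conditional mean of the new factor minus 1.
      set R : Ω → ℂ := fun ω => Complex.exp (Y ω) *
          ∏ i ∈ Finset.range m, (1 + a i n ω • (Complex.exp (Complex.I * (g i n ω : ℝ)) - 1)) - 1 with hR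
      have hRb : ∀ ω, ‖R ω‖ ≤ 9 * ε * Real.exp (9 * B) * w n ω := by
        intro ω
        have e3 : R ω = ∏ i ∈ Finset.range m, (1 + (Complex.exp (-(Complex.I * (a i n ω * g i n ω : ℝ)) +
            (a i n ω * g i n ω ^ 2 / 2 : ℝ)) *
            (1 + a i n ω • (Complex.exp (Complex.I * (g i n ω : ℝ)) - 1)) - 1)) - 1 := by
          simp only [hR, hY]
          rw [Complex.exp_sum, ← Finset.prod_mul_distrib]
          congr 1
          refine Finset.prod_congr rfl fun i _ => by ring
        rw [e3]
        refine (Finset.norm_prod_one_add_sub_one_le _ _).trans ?_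
        have hsum : ∑ i ∈ Finset.range m, ‖Complex.exp (-(Complex.I * (a i n ω * g i n ω : ℝ)) +
            (a i n ω * g i n ω ^ 2 / 2 : ℝ)) *
            (1 + a i n ω • (Complex.exp (Complex.I * (g i n ω : ℝ)) - 1)) - 1‖ ≤ 9 * ε * w n ω := by
          rw [hw, Finset.mul_sum]
          refine Finset.sum_le_sum fun i hi => ?_
          have hi' := Finset.mem_range.1 hi
          rcases haε i hi' n hnT ω with h4 | h4
          · rw [h4]; simp
          · exact norm_exp_mul_bernoulli_sub_one_le (h.prob_nonneg i hi' n hnT ω) h4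
              (hgε i hi' n hnT ω) hε
        have hw9 : 9 * ε * w n ω ≤ 9 * B := by
          have := hwB n hnT ω
          have := hwn n hnT ω
          nlinarith
        have hx0 : 0 ≤ 9 * ε * w n ω := mul_nonneg (by positivity) (hwn n hnT ω)
        calc Real.exp (∑ i ∈ Finset.range m, _) - 1 ≤ Real.exp (9 * ε * w n ω) - 1 := by
              gcongr
          _ ≤ 9 * ε * w n ω * Real.exp (9 * ε * w n ω) := by
              have := Real.add_one_le_exp (-(9 * ε * w n ω))
              have h5 : Real.exp (9 * ε * w n ω) * Real.exp (-(9 * ε * w n ω)) = 1 := by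
                rw [← Real.exp_add]; simp
              nlinarith [Real.exp_pos (9 * ε * w n ω)]
          _ ≤ 9 * ε * w n ω * Real.exp (9 * B) := by gcongr
          _ = _ := by ring
      simp_rw [e1] at key
      have hRm : Measurable[F n] R := by
        refine (hYm.mul (Finset.measurable_prod _ fun i hi => ?_)).sub_const 1
        have hi' := Finset.mem_range.1 hi
        exact ((h.measurable_prob i hi' n hnT).smul ((Complex.measurable_exp.comp
          ((Complex.measurable_ofReal.comp (hg i hi' n hnT)).const_mul Complex.I)).sub_const 1)).const_add 1
      have hEi : Integrable E P := Integrable.of_bound (C := Real.exp (B / 2))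
        (hXmeas.mono (h.le n hnT) le_rfl).aestronglyMeasurable (ae_of_all _ hEb)
      have hERb : ∀ ω, ‖E ω * R ω‖ ≤ 9 * ε * Real.exp (10 * B) * w n ω := by
        intro ω
        rw [norm_mul]
        have h6 := hwn n hnT ω
        calc ‖E ω‖ * ‖R ω‖ ≤ Real.exp (B / 2) * (9 * ε * Real.exp (9 * B) * w n ω) :=
              mul_le_mul (hEb ω) (hRb ω) (norm_nonneg _) (Real.exp_pos _).le
          _ = 9 * ε * (Real.exp (B / 2) * Real.exp (9 * B)) * w n ω := by ring
          _ ≤ _ := by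
              rw [← Real.exp_add]
              gcongr
              linarith
      have hERi : Integrable (fun ω => E ω * R ω) P :=
        ((hwi n hnT).const_mul (9 * ε * Real.exp (10 * B))).mono'
          ((hXmeas.mul hRm).mono (h.le n hnT) le_rfl).aestronglyMeasurable (ae_of_all _ hERb)
      have e4 : ∫ ω, Complex.exp (∑ t ∈ Finset.range (n + 1), X t ω) ∂P =
          ∫ ω, E ω ∂P + ∫ ω, E ω * R ω ∂P := by
        rw [key, ← integral_add hEi hERi]
        congr 1; ext ω
        simp only [hR]; ring
      rw [e4]
      simp_rw [Finset.sum_range_succ]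
      rw [integral_add (integrable_finsetSum _ fun t ht => hwi t (by
        have := Finset.mem_range.1 ht; omega)) (hwi n hnT), mul_add]
      calc ‖∫ ω, E ω ∂P + ∫ ω, E ω * R ω ∂P - 1‖
          = ‖(∫ ω, E ω ∂P - 1) + ∫ ω, E ω * R ω ∂P‖ := by congr 1; ring
        _ ≤ ‖∫ ω, E ω ∂P - 1‖ + ‖∫ ω, E ω * R ω ∂P‖ := norm_add_le _ _
        _ ≤ _ := by
            gcongr
            rw [← integral_const_mul]
            exact norm_integral_le_of_norm_le ((hwi n hnT).const_mul _) (ae_of_all _ hERb)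
  refine (hmain T le_rfl).trans ?_
  have : ∫ ω, ∑ t ∈ Finset.range T, w t ω ∂P ≤ B := by
    calc _ ≤ ∫ _ω, B ∂P := integral_mono (integrable_finsetSum _ fun t ht =>
            hwi t (Finset.mem_range.1 ht)) (integrable_const _) fun ω => hWB T le_rfl ω
      _ = B := by simp
  calc 9 * ε * Real.exp (10 * B) * ∫ ω, ∑ t ∈ Finset.range T, w t ω ∂P
      ≤ 9 * ε * Real.exp (10 * B) * B := by gcongr
    _ = _ := by ring

end

section

variable {Ω : Type*} {mΩ : MeasurableSpace Ω} {P : Measure Ω} {m T : ℕ}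
  {F : ℕ → MeasurableSpace Ω} {D a : ℕ → ℕ → Ω → ℝ}

/-- Characteristic function of a sum of compensated Bernoulli variables whose predictable variance
is close to the constant `J` with high probability. -/
lemma IsBernoulliScheme.norm_integral_exp_sub_exp_le [IsProbabilityMeasure P]
    (h : IsBernoulliScheme P m T F D a) {g : ℕ → ℕ → Ω → ℝ}
    (hg : ∀ i < m, ∀ t < T, Measurable[F t] (g i t)) {ε J θ : ℝ} (hε0 : 0 ≤ ε) (hε : ε ≤ 1 / 2)
    (hgε : ∀ i < m, ∀ t < T, ∀ ω, |g i t ω| ≤ ε)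
    (haε : ∀ i < m, ∀ t < T, ∀ ω, g i t ω = 0 ∨ a i t ω ≤ ε) (hJ : 0 ≤ J) (hθ0 : 0 < θ) (hθ1 : θ ≤ 1) :
    ‖∫ ω, Complex.exp (Complex.I * (∑ t ∈ Finset.range T, ∑ i ∈ Finset.range m,
        (D i t ω - a i t ω) * g i t ω : ℝ)) ∂P - Complex.exp (-(J / 2 : ℝ))‖ ≤
      θ + (4 + Real.exp ((J + 1) / 2)) *
        P.real {ω | θ < |∑ t ∈ Finset.range T, ∑ i ∈ Finset.range m, a i t ω * g i t ω ^ 2 - J|} +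
      9 * ε * (J + 1) * Real.exp (10 * (J + 1)) := by
  set B := J + 1 with hB
  set W : ℕ → Ω → ℝ := fun n ω => ∑ t ∈ Finset.range n, ∑ i ∈ Finset.range m, a i t ω * g i t ω ^ 2
    with hW
  have hw0 : ∀ i < m, ∀ t < T, ∀ ω, 0 ≤ a i t ω * g i t ω ^ 2 := fun i hi t ht ω =>
    mul_nonneg (h.prob_nonneg i hi t ht ω) (sq_nonneg _)
  have hwn : ∀ t < T, ∀ ω, 0 ≤ ∑ i ∈ Finset.range m, a i t ω * g i t ω ^ 2 := fun t ht ω =>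
    Finset.sum_nonneg fun i hi => hw0 i (Finset.mem_range.1 hi) t ht ω
  have hWmono : ∀ n ≤ T, ∀ k ≤ n, ∀ ω, W k ω ≤ W n ω := fun n hn k hk ω =>
    Finset.sum_le_sum_of_subset_of_nonneg (Finset.range_mono hk)
      fun t ht _ => hwn t (by have := Finset.mem_range.1 ht; omega) ω
  have hWm : ∀ t < T, Measurable[F t] (W (t + 1)) := fun t ht =>
    Finset.measurable_sum _ fun s hs => Finset.measurable_sum _ fun i hi => by
      have hs' := Finset.mem_range.1 hs
      have hi' := Finset.mem_range.1 hi
      have hle := h.mono s t (by omega) ht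
      exact ((h.measurable_prob i hi' s (by omega)).mul
        ((hg i hi' s (by omega)).pow_const 2)).mono hle le_rfl
  -- The weights are switched off once the predictable variance exceeds B = J + 1. The sum up to
  -- period t is known at time t, so the stopped weights stay predictable and their variance has a
  -- deterministic bound.
  set g' : ℕ → ℕ → Ω → ℝ := fun i t ω => if W (t + 1) ω ≤ B then g i t ω else 0 with hg'
  have hg'm : ∀ i < m, ∀ t < T, Measurable[F t] (g' i t) := fun i hi t ht =>
    Measurable.ite (measurableSet_le (hWm t ht) measurable_const) (hg i hi t ht) measurable_const
  have hg'ε : ∀ i < m, ∀ t < T, ∀ ω, |g' i t ω| ≤ ε := fun i hi t ht ω => by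
    simp only [hg']; split_ifs
    · exact hgε i hi t ht ω
    · simpa using hε0
  have hg'a : ∀ i < m, ∀ t < T, ∀ ω, g' i t ω = 0 ∨ a i t ω ≤ ε := fun i hi t ht ω => by
    simp only [hg']; split_ifs
    · exact haε i hi t ht ω
    · simp
  have hB0 : 0 ≤ B := by linarith
  -- The bound by `W n` is carried along for the induction: while W (n + 1) ≤ B, it is what bounds
  -- the stopped sum by B.
  have hW'B : ∀ n ≤ T, ∀ ω, ∑ t ∈ Finset.range n, ∑ i ∈ Finset.range m, a i t ω * g' i t ω ^ 2 ≤
      min B (W n ω) := by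
    intro n
    induction n with
    | zero => intro _ ω; simp [hW, hB0]
    | succ n ih =>
      intro hn ω
      have ih' := le_min_iff.1 (ih (by omega) ω)
      rw [Finset.sum_range_succ, le_min_iff]
      by_cases hc : W (n + 1) ω ≤ B
      · have e : ∑ i ∈ Finset.range m, a i n ω * g' i n ω ^ 2 =
            ∑ i ∈ Finset.range m, a i n ω * g i n ω ^ 2 := by simp [hg', hc]
        have e2 : W (n + 1) ω = W n ω + ∑ i ∈ Finset.range m, a i n ω * g i n ω ^ 2 := by
          simp only [hW]; rw [Finset.sum_range_succ]
        rw [e]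
        constructor <;> linarith [ih'.1, ih'.2]
      · have e : ∑ i ∈ Finset.range m, a i n ω * g' i n ω ^ 2 = 0 := by simp [hg', hc]
        rw [e, add_zero]
        exact ⟨ih'.1, ih'.2.trans (hWmono (n + 1) hn n (by omega) ω)⟩
  have hclt := h.norm_integral_exp_sub_one_le hg'm hε0 hε hg'ε hg'a (B := B)
    fun ω => (hW'B T le_rfl ω).trans (min_le_left _ _)
  set Sg : Ω → ℝ := fun ω => ∑ t ∈ Finset.range T, ∑ i ∈ Finset.range m,
    (D i t ω - a i t ω) * g i t ω with hSg
  set Sg' : Ω → ℝ := fun ω => ∑ t ∈ Finset.range T, ∑ i ∈ Finset.range m,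
    (D i t ω - a i t ω) * g' i t ω with hSg'
  set W' : Ω → ℝ := fun ω => ∑ t ∈ Finset.range T, ∑ i ∈ Finset.range m, a i t ω * g' i t ω ^ 2 with hW'
  have e0 : ∀ ω, Complex.exp (∑ t ∈ Finset.range T, ∑ i ∈ Finset.range m,
      (Complex.I * ((D i t ω - a i t ω) * g' i t ω : ℝ) + (a i t ω * g' i t ω ^ 2 / 2 : ℝ))) =
      Complex.exp (Complex.I * (Sg' ω : ℝ)) * Complex.exp (W' ω / 2 : ℝ) := by
    intro ω
    rw [← Complex.exp_add]
    congr 1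
    simp only [hSg', hW', Finset.sum_add_distrib]
    push_cast
    simp only [Finset.mul_sum, Finset.sum_div]
  simp_rw [e0] at hclt
  have mmeas : ∀ f : ℕ → ℕ → Ω → ℝ, (∀ i < m, ∀ t < T, Measurable[F t] (f i t)) →
      (∀ i < m, ∀ t < T, Measurable (f i t)) := fun f hf i hi t ht =>
    (hf i hi t ht).mono (h.le t ht) le_rfl
  have sm : ∀ f : ℕ → ℕ → Ω → ℝ, (∀ i < m, ∀ t < T, Measurable (f i t)) →
      Measurable fun ω => ∑ t ∈ Finset.range T, ∑ i ∈ Finset.range m, f i t ω := fun f hf =>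
    Finset.measurable_sum _ fun t ht => Finset.measurable_sum _ fun i hi =>
      hf i (Finset.mem_range.1 hi) t (Finset.mem_range.1 ht)
  have ma := mmeas a h.measurable_prob
  have mg := mmeas g hg
  have mg' := mmeas g' hg'm
  have hSgm : Measurable Sg := sm _ fun i hi t ht =>
    ((h.measurable i hi t ht).sub (ma i hi t ht)).mul (mg i hi t ht)
  have hSgm' : Measurable Sg' := sm _ fun i hi t ht =>
    ((h.measurable i hi t ht).sub (ma i hi t ht)).mul (mg' i hi t ht)
  have hWm' : Measurable W' := sm _ fun i hi t ht => (ma i hi t ht).mul ((mg' i hi t ht).pow_const 2)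
  have hWTm : Measurable (W T) := sm _ fun i hi t ht => (ma i hi t ht).mul ((mg i hi t ht).pow_const 2)
  set A : Set Ω := {ω | θ < |W T ω - J|} with hA
  have hAm : MeasurableSet A := measurableSet_lt measurable_const (hWTm.sub_const J).abs
  have good : ∀ ω ∉ A, Sg' ω = Sg ω ∧ W' ω = W T ω ∧ |W T ω - J| ≤ θ := by
    intro ω hω
    have hle : |W T ω - J| ≤ θ := not_lt.1 hω
    have hWB : W T ω ≤ B := by have := (abs_le.1 hle).2; linarith
    have hgg : ∀ i, ∀ t ∈ Finset.range T, g' i t ω = g i t ω := fun i t ht => by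
      simp only [hg']
      rw [if_pos ((hWmono T le_rfl (t + 1) (Finset.mem_range.1 ht) ω).trans hWB)]
    refine ⟨?_, ?_, hle⟩
    · exact Finset.sum_congr rfl fun t ht => Finset.sum_congr rfl fun i _ => by rw [hgg i t ht]
    · exact Finset.sum_congr rfl fun t ht => Finset.sum_congr rfl fun i _ => by rw [hgg i t ht]
  have hW'n : ∀ ω, W' ω ≤ B := fun ω => (hW'B T le_rfl ω).trans (min_le_left _ _)
  have nI : ∀ x : ℝ, ‖Complex.exp (Complex.I * (x : ℂ))‖ = 1 := fun x => by
    rw [mul_comm, Complex.norm_exp_ofReal_mul_I]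
  have nR : ∀ x : ℝ, ‖Complex.exp (x : ℂ)‖ = Real.exp x := fun x => by
    rw [Complex.norm_exp, Complex.ofReal_re]
  have mI : ∀ {f : Ω → ℝ}, Measurable f → Measurable fun ω => Complex.exp (Complex.I * (f ω : ℂ)) :=
    fun hf => Complex.measurable_exp.comp ((Complex.measurable_ofReal.comp hf).const_mul _)
  have i1 : Integrable (fun ω => Complex.exp (Complex.I * (Sg ω : ℂ))) P :=
    Integrable.of_bound (C := 1) (mI hSgm).aestronglyMeasurable (ae_of_all _ fun ω => (nI _).le)
  have i3 : Integrable (fun ω => Complex.exp (Complex.I * (Sg' ω : ℂ)) *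
      Complex.exp (W' ω / 2 : ℝ)) P := by
    refine Integrable.of_bound (C := Real.exp (B / 2)) ((mI hSgm').mul (Complex.measurable_exp.comp
      (Complex.measurable_ofReal.comp (hWm'.div_const 2)))).aestronglyMeasurable
      (ae_of_all _ fun ω => ?_)
    rw [norm_mul, nI, nR, one_mul]
    exact Real.exp_le_exp.2 (by linarith [hW'n ω])
  have hdiff : ‖∫ ω, (Complex.exp (Complex.I * (Sg ω : ℂ)) - Complex.exp (-(J / 2 : ℝ)) *
      (Complex.exp (Complex.I * (Sg' ω : ℂ)) * Complex.exp (W' ω / 2 : ℝ))) ∂P‖ ≤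
      θ + (4 + Real.exp (B / 2)) * P.real A := by
    -- Off the bad event stopping changes nothing, and the difference is |1 - e^{(W - J)/2}| ≤ |W -
    -- J| ≤ θ. On the bad event only the norms are bounded.
    have hbd : ∀ ω, ‖Complex.exp (Complex.I * (Sg ω : ℂ)) - Complex.exp (-(J / 2 : ℝ)) *
      (Complex.exp (Complex.I * (Sg' ω : ℂ)) * Complex.exp (W' ω / 2 : ℝ))‖ ≤
        θ + A.indicator (fun _ => 4 + Real.exp (B / 2)) ω := by
      intro ω
      by_cases hω : ω ∈ A
      · rw [Set.indicator_of_mem hω]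
        refine (norm_sub_le _ _).trans ?_
        have e1 : ‖Complex.exp (-(J / 2 : ℝ))‖ ≤ 1 := by
          rw [← Complex.ofReal_neg, nR]; exact Real.exp_le_one_iff.2 (by linarith)
        rw [norm_mul, norm_mul, nI, nI, nR, one_mul]
        have : Real.exp (W' ω / 2) ≤ Real.exp (B / 2) := Real.exp_le_exp.2 (by linarith [hW'n ω])
        nlinarith [Real.exp_pos (W' ω / 2)]
      · obtain ⟨e1, e2, e3⟩ := good ω hω
        rw [Set.indicator_of_notMem hω, e1, e2, add_zero]
        have e4 : Complex.exp (Complex.I * (Sg ω : ℂ)) - Complex.exp (-(J / 2 : ℝ)) *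
            (Complex.exp (Complex.I * (Sg ω : ℂ)) * Complex.exp (W T ω / 2 : ℝ)) =
            Complex.exp (Complex.I * (Sg ω : ℂ)) * ((1 - Real.exp ((W T ω - J) / 2) : ℝ) : ℂ) := by
          have : Complex.exp (-(J / 2 : ℝ)) * Complex.exp (W T ω / 2 : ℝ) =
              (Real.exp ((W T ω - J) / 2) : ℂ) := by
            rw [← Complex.exp_add, Complex.ofReal_exp]; congr 1; push_cast; ring
          rw [mul_left_comm, this]; push_cast; ring
        rw [e4, norm_mul, nI, one_mul, Complex.norm_real, Real.norm_eq_abs]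
        have := Real.abs_exp_sub_one_le (x := (W T ω - J) / 2) (by
          rw [abs_div, abs_two]; linarith)
        rw [abs_sub_comm]
        refine this.trans ?_
        rw [abs_div, abs_two]; linarith
    refine (norm_integral_le_of_norm_le (((integrable_const θ).add ((integrable_const _).indicator hAm)))
      (ae_of_all _ hbd)).trans ?_
    have hsum : ∫ ω, (θ + A.indicator (fun _ => 4 + Real.exp (B / 2)) ω) ∂P =
        θ + (4 + Real.exp (B / 2)) * P.real A := by
      rw [integral_add (integrable_const θ) ((integrable_const _).indicator hAm),
        integral_indicator_const _ hAm]
      simp [mul_comm]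
    exact hsum.le
  rw [integral_sub i1 (i3.const_mul _), integral_const_mul] at hdiff
  set I1 := ∫ ω, Complex.exp (Complex.I * (Sg ω : ℂ)) ∂P
  set I3 := ∫ ω, Complex.exp (Complex.I * (Sg' ω : ℂ)) * Complex.exp (W' ω / 2 : ℝ) ∂P
  have e5 : I1 - Complex.exp (-(J / 2 : ℝ)) = (I1 - Complex.exp (-(J / 2 : ℝ)) * I3) +
      Complex.exp (-(J / 2 : ℝ)) * (I3 - 1) := by ring
  rw [e5]
  refine (norm_add_le _ _).trans (add_le_add hdiff ?_)
  rw [norm_mul, ← Complex.ofReal_neg, nR]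
  refine (mul_le_of_le_one_left (norm_nonneg _) (Real.exp_le_one_iff.2 (by linarith))).trans hclt

end

/-! ### Survival in terms of past defaults -/

section LastTime

variable {Ω : Type*} {T : ℕ} {D : ℕ → ℕ → Ω → ℝ} {i : ℕ} {ω : Ω}

lemma lastTime_le : lastTime T D i ω ≤ T - 1 := Nat.sInf_le (by simp)

/-- The restriction t < T is due to T - 1 belonging to the set whose infimum is taken. The right
side involves defaults before t only, so being at risk is known at time t. -/
lemma le_lastTime_iff {t : ℕ} (ht : t < T) :
    t ≤ lastTime T D i ω ↔ ∀ s < t, D i s ω ≠ 1 := by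
  constructor
  · intro h s hs hD
    have : lastTime T D i ω ≤ s := Nat.sInf_le (Or.inr hD)
    omega
  · intro h
    by_contra hlt
    rw [not_le] at hlt
    have hmem : lastTime T D i ω ∈ ({T - 1} ∪ {t : ℕ | D i t ω = 1} : Set ℕ) :=
      Nat.sInf_mem ⟨T - 1, by simp⟩
    rcases hmem with h1 | h1
    · have : lastTime T D i ω = T - 1 := h1
      omega
    · exact h _ hlt h1

end LastTime

/-! ### Moment and deviation bounds for defaults in a fixed model -/

section DefaultModel

variable {d : ℕ} {Ω : Type*} {m T : ℕ} {q : ℝ → ℝ} {β : EuclideanSpace ℝ (Fin d)} {a : ℝ}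
  {V : ℕ → ℕ → Ω → EuclideanSpace ℝ (Fin d)} {D : ℕ → ℕ → Ω → ℝ}

/-- The conditional default probability of firm `i` at time `t`. -/
def hazard (T : ℕ) (q : ℝ → ℝ) (β : EuclideanSpace ℝ (Fin d)) (a : ℝ)
    (V : ℕ → ℕ → Ω → EuclideanSpace ℝ (Fin d)) (D : ℕ → ℕ → Ω → ℝ) (i t : ℕ) (ω : Ω) : ℝ :=
  if t ≤ lastTime T D i ω then q (⟪β, V i t ω⟫ - a) else 0

lemma measurable_history_covariate {i s t : ℕ} (hi : i < m) (hs : s ≤ t) :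
    Measurable[history m V D t] (V i s) := by
  refine Measurable.mono (comap_measurable (V i s)) ?_ le_rfl
  refine le_sup_of_le_left ?_
  exact le_iSup₂_of_le i hi (le_iSup₂_of_le s hs le_rfl)

lemma measurable_history_default {i s t : ℕ} (hi : i < m) (hs : s < t) :
    Measurable[history m V D t] (D i s) := by
  refine Measurable.mono (comap_measurable (D i s)) ?_ le_rfl
  refine le_sup_of_le_right ?_
  exact le_iSup₂_of_le i hi (le_iSup₂_of_le s hs le_rfl)

lemma measurableSet_history_le_lastTime {i t : ℕ} (hi : i < m) (ht : t < T) :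
    MeasurableSet[history m V D t] {ω | t ≤ lastTime T D i ω} := by
  have : {ω | t ≤ lastTime T D i ω} = ⋂ s ∈ Finset.range t, (D i s ⁻¹' {1})ᶜ := by
    ext ω
    simp only [Set.mem_ofPred_eq, le_lastTime_iff ht, Set.mem_iInter, Finset.mem_range,
      Set.mem_compl_iff, Set.mem_preimage, Set.mem_singleton_iff, ne_eq]
  rw [this]
  refine Finset.measurableSet_biInter _ fun s hs => ?_
  exact (measurable_history_default hi (Finset.mem_range.1 hs) (measurableSet_singleton 1)).compl

lemma history_mono {s t : ℕ} (h : s ≤ t) : history m V D s ≤ history m V D t := by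
  refine sup_le_sup ?_ ?_
  · refine iSup₂_mono fun i _ => iSup₂_le fun u hu => ?_
    exact le_iSup₂_of_le u (hu.trans h) le_rfl
  · refine iSup₂_mono fun i _ => iSup₂_le fun u hu => ?_
    exact le_iSup₂_of_le u (hu.trans_le h) le_rfl

variable {C x₁ : ℝ}

lemma hazard_nonneg (hq : IsExpLike q C x₁) (i t : ℕ) (ω : Ω) : 0 ≤ hazard T q β a V D i t ω := by
  unfold hazard; split_ifs
  · exact hq.nonneg _
  · exact le_rfl

lemma hazard_le (hq : IsExpLike q C x₁) (i t : ℕ) (ω : Ω) :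
    hazard T q β a V D i t ω ≤ C * Real.exp (-a) * Real.exp ⟪β, V i t ω⟫ := by
  have h1 := hq.one_le
  unfold hazard; split_ifs
  · refine (hq.le_exp _).trans (le_of_eq ?_)
    rw [sub_eq_add_neg, Real.exp_add]; ring
  · positivity

variable [mΩ : MeasurableSpace Ω] {P : Measure Ω} {S : Matrix (Fin d) (Fin d) ℝ} {K ρ : ℝ}

lemma IsDefaultProcess.isBernoulliScheme (hD : IsDefaultProcess P m T q β a V D)
    (hV : IsCovariateProcess P m T S K ρ V) (hq : Continuous q) (hq0 : ∀ x, 0 ≤ q x)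
    (hq1 : ∀ x, q x ≤ 1) :
    IsBernoulliScheme P m T (history m V D) D (hazard T q β a V D) where
  le t ht := by
    refine sup_le ?_ ?_
    · exact iSup₂_le fun i hi => iSup₂_le fun s hs =>
        (hV.measurable i hi s (hs.trans_lt ht)).comap_le
    · exact iSup₂_le fun i hi => iSup₂_le fun s hs => (hD.measurable i hi s (hs.trans ht)).comap_le
  mono s t hst _ := history_mono hst
  measurable := hD.measurable
  adapted i hi s t hst _ := measurable_history_default hi hst
  zero_or_one := hD.zero_or_one
  measurable_prob i hi t ht := by
    unfold hazard
    refine Measurable.ite (measurableSet_history_le_lastTime hi ht) ?_ measurable_const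
    have h1 : Measurable fun v : EuclideanSpace ℝ (Fin d) => q (⟪β, v⟫ - a) :=
      hq.measurable.comp (by fun_prop)
    exact h1.comp (measurable_history_covariate hi le_rfl)
  prob_nonneg i hi t ht ω := by
    unfold hazard; split_ifs <;> simp [hq0]
  prob_le_one i hi t ht ω := by
    unfold hazard; split_ifs <;> simp [hq1]
  condExp_prod := hD.cond_default

variable {f : EuclideanSpace ℝ (Fin d) → ℝ}

/-- Markov's inequality. -/
lemma measureReal_ge_le_of_integral_le {X : Ω → ℝ} (hX : Integrable X P) (hX0 : ∀ᵐ ω ∂P, 0 ≤ X ω)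
    {x A : ℝ} (hx : 0 < x) (hA : ∫ ω, X ω ∂P ≤ A) : P.real {ω | x ≤ X ω} ≤ A / x := by
  rw [le_div_iff₀ hx, mul_comm]
  exact (mul_meas_ge_le_integral_of_nonneg hX0 hX x).trans hA

lemma IsCovariateProcess.integrable_comp (hV : IsCovariateProcess P m T S K ρ V) {i t : ℕ}
    (hi : i < m) (ht : t < T) (hf : Integrable f (multivariateGaussian 0 S)) :
    Integrable (fun ω => f (V i t ω)) P :=
  (hV.measurePreserving hi ht).integrable_comp_of_integrable hf

lemma IsCovariateProcess.integral_sum (hV : IsCovariateProcess P m T S K ρ V)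
    (hf : Integrable f (multivariateGaussian 0 S)) :
    ∫ ω, ∑ p ∈ cells m T, f (V p.1 p.2 ω) ∂P = m * T * ∫ v, f v ∂(multivariateGaussian 0 S) := by
  rw [integral_finsetSum _ fun p hp =>
    hV.integrable_comp (mem_cells.1 hp).1 (mem_cells.1 hp).2 hf]
  rw [Finset.sum_congr rfl fun p hp =>
    hV.integral_comp (mem_cells.1 hp).1 (mem_cells.1 hp).2 hf.aestronglyMeasurable]
  simp

lemma IsCovariateProcess.measureReal_sum_ge_le (hV : IsCovariateProcess P m T S K ρ V)
    (hf : Integrable f (multivariateGaussian 0 S)) (hf0 : ∀ v, 0 ≤ f v) {x : ℝ} (hx : 0 < x) :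
    P.real {ω | x ≤ ∑ p ∈ cells m T, f (V p.1 p.2 ω)} ≤
      m * T * (∫ v, f v ∂(multivariateGaussian 0 S)) / x := by
  refine measureReal_ge_le_of_integral_le (integrable_finsetSum _ fun p hp =>
    hV.integrable_comp (mem_cells.1 hp).1 (mem_cells.1 hp).2 hf)
    (ae_of_all _ fun ω => Finset.sum_nonneg fun p _ => hf0 _) hx (hV.integral_sum hf).le

lemma IsDefaultProcess.integrable_default_mul (hD : IsDefaultProcess P m T q β a V D)
    (hV : IsCovariateProcess P m T S K ρ V)
    {i t : ℕ} (hi : i < m) (ht : t < T) (hf : Integrable f (multivariateGaussian 0 S)) :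
    Integrable (fun ω => D i t ω * f (V i t ω)) P := by
  refine (hV.integrable_comp hi ht hf).bdd_mul (c := 1) (hD.measurable i hi t ht).aestronglyMeasurable
      (ae_of_all _ fun ω => ?_)
  rcases hD.zero_or_one i hi t ht ω with h | h <;> simp [h]

variable [IsProbabilityMeasure P]

/-- The default indicator is replaced by its hazard, which is at most C e^{-a} e^{⟪β, v⟫}; this is
where the small factor e^{-a} = γ comes from. -/
lemma IsDefaultProcess.integral_default_mul_le (hD : IsDefaultProcess P m T q β a V D)
    (hV : IsCovariateProcess P m T S K ρ V) (hq : IsExpLike q C x₁)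
    {i t : ℕ} (hi : i < m) (ht : t < T)
    (hfm : Measurable f) (hf : Integrable f (multivariateGaussian 0 S)) (hf0 : ∀ v, 0 ≤ f v)
    (hef : Integrable (fun v => Real.exp ⟪β, v⟫ * f v) (multivariateGaussian 0 S)) :
    ∫ ω, D i t ω * f (V i t ω) ∂P ≤
      C * Real.exp (-a) * ∫ v, Real.exp ⟪β, v⟫ * f v ∂(multivariateGaussian 0 S) := by
  have hB := hD.isBernoulliScheme hV hq.cont hq.nonneg hq.le_one
  have hfV : Measurable[history m V D t] (fun ω => f (V i t ω)) :=
    hfm.comp (measurable_history_covariate hi le_rfl)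
  rw [hB.integral_mul_eq hi ht hfV (hV.integrable_comp hi ht hf),
    ← hV.integral_comp hi ht hef.aestronglyMeasurable, ← integral_const_mul]
  have h1 := (hB.measurable_prob i hi t ht).mono (hB.le t ht) le_rfl
  refine integral_mono ?_ ((hV.integrable_comp hi ht hef).const_mul _) fun ω => ?_
  · refine (hV.integrable_comp hi ht hf).bdd_mul (c := 1) h1.aestronglyMeasurable
      (ae_of_all _ fun ω => ?_)
    rw [Real.norm_eq_abs, abs_of_nonneg (hB.prob_nonneg i hi t ht ω)]
    exact hB.prob_le_one i hi t ht ω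
  · simp only []
    rw [← mul_assoc]
    exact mul_le_mul_of_nonneg_right (hazard_le hq i t ω) (hf0 _)

lemma IsDefaultProcess.measureReal_sum_default_ge_le (hD : IsDefaultProcess P m T q β a V D)
    (hV : IsCovariateProcess P m T S K ρ V) (hq : IsExpLike q C x₁)
    (hfm : Measurable f) (hf : Integrable f (multivariateGaussian 0 S)) (hf0 : ∀ v, 0 ≤ f v)
    (hef : Integrable (fun v => Real.exp ⟪β, v⟫ * f v) (multivariateGaussian 0 S))
    {x : ℝ} (hx : 0 < x) :
    P.real {ω | x ≤ ∑ p ∈ cells m T, D p.1 p.2 ω * f (V p.1 p.2 ω)} ≤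
      m * T * (C * Real.exp (-a) * ∫ v, Real.exp ⟪β, v⟫ * f v ∂(multivariateGaussian 0 S)) / x := by
  have hint : ∀ p ∈ cells m T, Integrable (fun ω => D p.1 p.2 ω * f (V p.1 p.2 ω)) P := fun p hp =>
    hD.integrable_default_mul hV (mem_cells.1 hp).1 (mem_cells.1 hp).2 hf
  refine measureReal_ge_le_of_integral_le (integrable_finsetSum _ hint)
    (ae_of_all _ fun ω => Finset.sum_nonneg fun p hp => ?_) hx ?_
  · rcases hD.zero_or_one _ (mem_cells.1 hp).1 _ (mem_cells.1 hp).2 ω with h | h <;> simp [h, hf0]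
  · rw [integral_finsetSum _ hint]
    refine (Finset.sum_le_card_nsmul _ _ _ fun p hp => hD.integral_default_mul_le hV hq
      (mem_cells.1 hp).1 (mem_cells.1 hp).2 hfm hf hf0 hef).trans (le_of_eq ?_)
    rw [card_cells, nsmul_eq_mul]; push_cast; ring

/-- The firms that are no longer at risk are negligible. -/
lemma IsDefaultProcess.measureReal_sum_not_atRisk_ge_le (hD : IsDefaultProcess P m T q β a V D)
    (hV : IsCovariateProcess P m T S K ρ V) (hq : IsExpLike q C x₁)
    (hf : MemLp f 2 (multivariateGaussian 0 S)) (hf0 : ∀ v, 0 ≤ f v)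
    {x θ : ℝ} (hx : 0 < x) (hθ : 0 < θ) :
    P.real {ω | x ≤ ∑ p ∈ cells m T, if p.2 ≤ lastTime T D p.1 ω then 0 else f (V p.1 p.2 ω)} ≤
      m * T * (θ / 2 * ∫ v, f v ^ 2 ∂(multivariateGaussian 0 S) + T * Real.exp (-a) *
        (C * ∫ v, Real.exp ⟪β, v⟫ ∂(multivariateGaussian 0 S)) / (2 * θ)) / x := by
  have hexp : Integrable (fun v => Real.exp ⟪β, v⟫ * 1) (multivariateGaussian 0 S) := by
    refine (integrable_exp_mul_norm (multivariateGaussian 0 S) ‖β‖).mono' (by fun_prop)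
      (ae_of_all _ fun v => ?_)
    rw [Real.norm_eq_abs, mul_one, Real.abs_exp]
    exact Real.exp_le_exp.2 (real_inner_le_norm β v)
  -- A firm no longer at risk has some earlier default, so f is at most θf²/2 + 1/(2θ) and the last
  -- term may be multiplied by the firm's number of defaults. Its mean is O(T e^{-a}), which is
  -- small because ζ < 1.
  set X : ℕ × ℕ → Ω → ℝ := fun p ω => θ / 2 * f (V p.1 p.2 ω) ^ 2 +
    (1 / (2 * θ)) * ∑ s ∈ Finset.range T, D p.1 s ω * 1 with hX
  have hD0 : ∀ i < m, ∀ s < T, ∀ ω, 0 ≤ D i s ω := fun i hi s hs ω => by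
    rcases hD.zero_or_one _ hi _ hs ω with h | h <;> simp [h]
  have hle : ∀ p ∈ cells m T, ∀ ω,
      (if p.2 ≤ lastTime T D p.1 ω then 0 else f (V p.1 p.2 ω)) ≤ X p ω := by
    intro p hp ω
    rw [mem_cells] at hp
    have hs0 : 0 ≤ ∑ s ∈ Finset.range T, D p.1 s ω * 1 := Finset.sum_nonneg fun s hs => by
      rw [mul_one]; exact hD0 _ hp.1 _ (Finset.mem_range.1 hs) ω
    split_ifs with h
    · rw [hX]; positivity
    · rw [le_lastTime_iff hp.2] at h
      push Not at h
      obtain ⟨s, hs, hDs⟩ := h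
      have hs1 : 1 ≤ ∑ s ∈ Finset.range T, D p.1 s ω * 1 := by
        calc (1 : ℝ) = D p.1 s ω * 1 := by rw [hDs]; ring
          _ ≤ _ := Finset.single_le_sum (f := fun s => D p.1 s ω * 1) (fun s hs => by
              rw [mul_one]; exact hD0 _ hp.1 _ (Finset.mem_range.1 hs) ω)
              (Finset.mem_range.2 (hs.trans hp.2))
      calc f (V p.1 p.2 ω) ≤ θ / 2 * f (V p.1 p.2 ω) ^ 2 + 1 / (2 * θ) * 1 := by
            have : θ / 2 * f (V p.1 p.2 ω) ^ 2 + 1 / (2 * θ) * 1 - f (V p.1 p.2 ω) =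
              (θ * f (V p.1 p.2 ω) - 1) ^ 2 / (2 * θ) := by field_simp; ring
            have h2 : 0 ≤ (θ * f (V p.1 p.2 ω) - 1) ^ 2 / (2 * θ) := by positivity
            linarith
        _ ≤ _ := add_le_add le_rfl (mul_le_mul_of_nonneg_left hs1 (by positivity))
  have hXi1 : ∀ p ∈ cells m T, Integrable (fun ω => ∑ s ∈ Finset.range T, D p.1 s ω * 1) P :=
    fun p hp => integrable_finsetSum _ fun s hs => hD.integrable_default_mul hV (f := fun _ => 1)
      (mem_cells.1 hp).1 (Finset.mem_range.1 hs) (integrable_const 1)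
  have hXi2 : ∀ p ∈ cells m T, Integrable (fun ω => f (V p.1 p.2 ω) ^ 2) P := fun p hp =>
    hV.integrable_comp (f := fun v => f v ^ 2) (mem_cells.1 hp).1 (mem_cells.1 hp).2 hf.integrable_sq
  have hXi : ∀ p ∈ cells m T, Integrable (X p) P := fun p hp =>
    ((hXi2 p hp).const_mul _).add ((hXi1 p hp).const_mul _)
  refine (measureReal_mono (fun ω hω => le_trans hω (Finset.sum_le_sum fun p hp => hle p hp ω))
    (measure_ne_top _ _)).trans ?_
  refine measureReal_ge_le_of_integral_le (integrable_finsetSum _ hXi)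
    (ae_of_all _ fun ω => Finset.sum_nonneg fun p hp => ?_) hx ?_
  · refine le_trans ?_ (hle p hp ω)
    split_ifs <;> simp [hf0]
  · rw [integral_finsetSum _ hXi]
    refine (Finset.sum_le_card_nsmul _ _ (θ / 2 * ∫ v, f v ^ 2 ∂(multivariateGaussian 0 S) +
      T * Real.exp (-a) * (C * ∫ v, Real.exp ⟪β, v⟫ ∂(multivariateGaussian 0 S)) / (2 * θ))
      fun p hp => ?_).trans (le_of_eq ?_)
    · have hp' := mem_cells.1 hp
      rw [hX, integral_add ((hXi2 p hp).const_mul _) ((hXi1 p hp).const_mul _), integral_const_mul,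
        integral_const_mul, hV.integral_comp (g := fun v => f v ^ 2) hp'.1 hp'.2
          hf.integrable_sq.aestronglyMeasurable, integral_finsetSum _ fun s hs =>
          hD.integrable_default_mul hV (f := fun _ => 1) hp'.1 (Finset.mem_range.1 hs)
            (integrable_const 1)]
      have := Finset.sum_le_card_nsmul (Finset.range T) (fun s => ∫ ω, D p.1 s ω * 1 ∂P) _
        fun s hs => hD.integral_default_mul_le hV hq (f := fun _ => 1) hp'.1
          (Finset.mem_range.1 hs) measurable_const (integrable_const 1) (fun _ => zero_le_one) hexp
      rw [Finset.card_range, nsmul_eq_mul] at this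
      simp only [mul_one] at this ⊢
      calc _ ≤ θ / 2 * ∫ v, f v ^ 2 ∂(multivariateGaussian 0 S) + 1 / (2 * θ) *
          (T * (C * Real.exp (-a) * ∫ v, Real.exp ⟪β, v⟫ ∂(multivariateGaussian 0 S))) := by gcongr
        _ = _ := by ring
    · rw [card_cells, nsmul_eq_mul]; push_cast; ring

/-- Defaults are at least as frequent as half of their compensator indicates. -/
lemma IsDefaultProcess.measureReal_sum_default_le (hD : IsDefaultProcess P m T q β a V D)
    (hV : IsCovariateProcess P m T S K ρ V) (hq : IsExpLike q C x₁)
    {B : Set (EuclideanSpace ℝ (Fin d))} (hB : MeasurableSet B) (x y : ℝ) :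
    P.real {ω | ∑ p ∈ cells m T, (if p.2 ≤ lastTime T D p.1 ω then
        D p.1 p.2 ω * B.indicator (fun _ => (1 : ℝ)) (V p.1 p.2 ω) else 0) ≤ y ∧
      x ≤ ∑ p ∈ cells m T, hazard T q β a V D p.1 p.2 ω *
        B.indicator (fun _ => (1 : ℝ)) (V p.1 p.2 ω)} ≤ Real.exp (y - x / 2) := by
  have hS := hD.isBernoulliScheme hV hq.cont hq.nonneg hq.le_one
  -- Being at risk and in the box is known before the default is drawn, so the supermartingale bound
  -- applies to this selection.
  set f : ℕ → ℕ → Ω → ℝ := fun i t ω => if t ≤ lastTime T D i ω then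
    B.indicator (fun _ => (1 : ℝ)) (V i t ω) else 0 with hf
  have hf01 : ∀ i t ω, f i t ω = 0 ∨ f i t ω = 1 := by
    intro i t ω
    by_cases h1 : t ≤ lastTime T D i ω <;> by_cases h2 : V i t ω ∈ B <;> simp [hf, h1, h2]
  have hfm : ∀ i < m, ∀ t < T, Measurable[history m V D t] (f i t) := by
    intro i hi t ht
    refine Measurable.ite (measurableSet_history_le_lastTime hi ht) ?_ measurable_const
    exact (measurable_const.indicator hB).comp (measurable_history_covariate hi le_rfl)
  have hfm' : ∀ i < m, ∀ t < T, Measurable (f i t) := fun i hi t ht =>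
    (hfm i hi t ht).mono (hS.le t ht) le_rfl
  have key := hS.integral_exp_le_one hfm (fun i _ t _ ω => hf01 i t ω) T le_rfl
  set c : ℝ := 1 - Real.exp (-1) with hc
  have hc2 : 1 / 2 ≤ c := by
    have := Real.exp_neg_one_lt_half
    rw [hc]; linarith
  set Y : Ω → ℝ := fun ω => Real.exp (∑ t ∈ Finset.range T, ∑ i ∈ Finset.range m,
      (-(D i t ω * f i t ω) + c * (hazard T q β a V D i t ω * f i t ω))) with hY
  have hc1 : c ≤ 1 := by rw [hc]; linarith [Real.exp_pos (-1)]
  have hYm : Measurable Y := by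
    refine Real.measurable_exp.comp (Finset.measurable_sum _ fun t ht =>
      Finset.measurable_sum _ fun i hi => ?_)
    rw [Finset.mem_range] at ht hi
    exact ((hS.measurable i hi t ht).mul (hfm' i hi t ht)).neg.add
      ((((hS.measurable_prob i hi t ht).mono (hS.le t ht) le_rfl).mul (hfm' i hi t ht)).const_mul c)
  have hYi : Integrable Y P := by
    refine Integrable.of_bound (C := Real.exp (T * m)) hYm.aestronglyMeasurable
      (ae_of_all _ fun ω => ?_)
    rw [Real.norm_eq_abs, Real.abs_exp]
    refine Real.exp_le_exp.2 ?_
    calc _ ≤ ∑ t ∈ Finset.range T, ∑ i ∈ Finset.range m, (1 : ℝ) := by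
          refine Finset.sum_le_sum fun t ht => Finset.sum_le_sum fun i hi => ?_
          rw [Finset.mem_range] at ht hi
          have h1 := hS.prob_nonneg i hi t ht ω
          have h2 := hS.prob_le_one i hi t ht ω
          have h3 := hS.nonneg hi ht ω
          rcases hf01 i t ω with h4 | h4 <;> rw [h4] <;> nlinarith
      _ = _ := by simp
  -- Markov's inequality for Y: since c = 1 - e⁻¹ ≥ 1/2, its exponent is at least x/2 - y on the
  -- event.
  refine (measureReal_mono (s₂ := {ω | Real.exp (x / 2 - y) ≤ Y ω}) (fun ω hω => ?_)
    (measure_ne_top _ _)).trans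
    ((measureReal_ge_le_of_integral_le hYi (ae_of_all _ fun ω => (Real.exp_pos _).le)
      (Real.exp_pos _) key).trans (le_of_eq ?_))
  · obtain ⟨h1, h2⟩ := hω
    refine Real.exp_le_exp.2 ?_
    have e1 : ∑ t ∈ Finset.range T, ∑ i ∈ Finset.range m,
        (-(D i t ω * f i t ω) + c * (hazard T q β a V D i t ω * f i t ω)) =
        -(∑ p ∈ cells m T, (if p.2 ≤ lastTime T D p.1 ω then
          D p.1 p.2 ω * B.indicator (fun _ => (1 : ℝ)) (V p.1 p.2 ω) else 0)) +
        c * ∑ p ∈ cells m T, hazard T q β a V D p.1 p.2 ω *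
          B.indicator (fun _ => (1 : ℝ)) (V p.1 p.2 ω) := by
      rw [Finset.sum_comm, ← Finset.sum_product', Finset.mul_sum, ← Finset.sum_neg_distrib,
        ← Finset.sum_add_distrib]
      refine Finset.sum_congr rfl fun p _ => ?_
      by_cases h : p.2 ≤ lastTime T D p.1 ω <;> simp [hf, hazard, h]
    rw [e1]
    have h3 : 0 ≤ ∑ p ∈ cells m T, hazard T q β a V D p.1 p.2 ω *
          B.indicator (fun _ => (1 : ℝ)) (V p.1 p.2 ω) :=
      Finset.sum_nonneg fun p _ => mul_nonneg (hazard_nonneg hq _ _ _)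
        (Set.indicator_nonneg (fun _ _ => zero_le_one) _)
    nlinarith
  · rw [one_div, ← Real.exp_neg]; congr 1; ring

end DefaultModel

/-! ### Deterministic estimates of the likelihood -/

section BinaryLikelihood

variable {d : ℕ} {ι : Type*}

/-- The likelihood of independent binary observations `Δ p` with covariates `v p` and link `q`. -/
def binaryLikelihood (R : Finset ι) (Δ : ι → Prop) [DecidablePred Δ]
    (v : ι → EuclideanSpace ℝ (Fin d)) (q : ℝ → ℝ) (a : ℝ) (b : EuclideanSpace ℝ (Fin d)) : ℝ :=
  ∏ p ∈ R, if Δ p then q (⟪b, v p⟫ - a) else 1 - q (⟪b, v p⟫ - a)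

/-- The logistic score weight `q' / (q (1 - q))`. -/
def scoreWeight (q : ℝ → ℝ) (x : ℝ) : ℝ := deriv q x / (q x * (1 - q x))

/-- The gradient of the logarithm of the likelihood. -/
def binaryScore (R : Finset ι) (Δ : ι → Prop) [DecidablePred Δ]
    (v : ι → EuclideanSpace ℝ (Fin d)) (q : ℝ → ℝ) (a : ℝ) (b : EuclideanSpace ℝ (Fin d)) :
    EuclideanSpace ℝ (Fin d) :=
  ∑ p ∈ R, (((if Δ p then 1 else 0) - q (⟪b, v p⟫ - a)) * scoreWeight q (⟪b, v p⟫ - a)) • v p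

variable {R : Finset ι} {Δ : ι → Prop} [DecidablePred Δ] {v : ι → EuclideanSpace ℝ (Fin d)}
  {q : ℝ → ℝ} {a C x₁ n : ℝ} {β b : EuclideanSpace ℝ (Fin d)}

lemma norm_le_exp_norm {E : Type*} [NormedAddCommGroup E] (x : E) : ‖x‖ ≤ Real.exp ‖x‖ := by
  linarith [Real.add_one_le_exp ‖x‖]

lemma neg_two_mul_le_log_one_sub {x : ℝ} (h0 : 0 ≤ x) (h1 : x ≤ 1 / 2) :
    -(2 * x) ≤ Real.log (1 - x) := by
  have h2 := Real.one_sub_inv_le_log_of_pos (show 0 < 1 - x by linarith)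
  have h3 : (1 - x)⁻¹ ≤ 1 + 2 * x := by
    rw [inv_le_iff_one_le_mul₀ (by linarith)]
    nlinarith
  linarith

/-- For moderate covariates the linear predictor stays below -a/2, hence below x₁ for small γ; this
is where the expansions of the link are available. -/
lemma inner_sub_le_neg_half {b w : EuclideanSpace ℝ (Fin d)} {r : ℝ} (hb : ‖b‖ ≤ r)
    (hw : r * ‖w‖ ≤ a / 2) : ⟪b, w⟫ - a ≤ -(a / 2) := by
  have h1 := real_inner_le_norm b w
  have h2 : ‖b‖ * ‖w‖ ≤ r * ‖w‖ := by gcongr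
  linarith

/-- Lower bound for the likelihood at the true parameter. -/
lemma exp_le_binaryLikelihood (hq : IsExpLike q C x₁) (ha : -(a / 2) ≤ x₁)
    (hv : ∀ p ∈ R, ‖β‖ * ‖v p‖ ≤ a / 2) {C₁ : ℝ}
    (hΔ : ∑ p ∈ R with Δ p, Real.exp ((‖β‖ + 1) * ‖v p‖) ≤ C₁ * n)
    (hR : Real.exp (-a) * ∑ p ∈ R, Real.exp ((‖β‖ + 1) * ‖v p‖) ≤ C₁ * n) :
    Real.exp (-(a * (R.filter Δ).card) - (1 + 2 * C) * C₁ * n) ≤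
      binaryLikelihood R Δ v q a β := by
  have hC := hq.one_le
  -- A default costs -a plus lower order, from q ≥ e^x/2 ≥ e^{x-1}; a survival costs at most 2q. The
  -- term a · #defaults, of size n log (1/γ), is kept exact because it must cancel later.
  calc Real.exp (-(a * (R.filter Δ).card) - (1 + 2 * C) * C₁ * n)
      ≤ Real.exp (∑ p ∈ R, ((if Δ p then -a - Real.exp ((‖β‖ + 1) * ‖v p‖) else 0) +
          -(2 * C) * (Real.exp (-a) * Real.exp ((‖β‖ + 1) * ‖v p‖)))) := by
        apply Real.exp_le_exp.2
        rw [Finset.sum_add_distrib, ← Finset.mul_sum, ← Finset.mul_sum, ← Finset.sum_filter,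
          Finset.sum_sub_distrib, Finset.sum_const, nsmul_eq_mul]
        nlinarith
    _ ≤ _ := by
        rw [Real.exp_sum, binaryLikelihood]
        refine Finset.prod_le_prod (fun _ _ => (Real.exp_pos _).le) fun p hp => ?_
        have hx := inner_sub_le_neg_half le_rfl (hv p hp)
        have hx1 := hx.trans ha
        have habs := abs_le.1 (abs_real_inner_le_norm β (v p))
        have hw0 : 0 ≤ ‖v p‖ := norm_nonneg _
        have hpos : 0 ≤ C * (Real.exp (-a) * Real.exp ((‖β‖ + 1) * ‖v p‖)) := by positivity
        split_ifs with h
        · refine le_trans ?_ (hq.lower _ hx1)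
          have h2 : Real.exp (-1 : ℝ) ≤ 1 / 2 := Real.exp_neg_one_lt_half.le
          calc _ ≤ Real.exp (⟪β, v p⟫ - a + -1) := by
                apply Real.exp_le_exp.2
                have := Real.add_one_le_exp ((‖β‖ + 1) * ‖v p‖)
                nlinarith
            _ = Real.exp (⟪β, v p⟫ - a) * Real.exp (-1) := Real.exp_add _ _
            _ ≤ _ := by have := Real.exp_pos (⟪β, v p⟫ - a); nlinarith
        · have h1 := hq.upper _ hx1
          have h0 := hq.nonneg (⟪β, v p⟫ - a)
          rw [← Real.exp_log (show 0 < 1 - q (⟪β, v p⟫ - a) by linarith)]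
          apply Real.exp_le_exp.2
          refine le_trans ?_ (neg_two_mul_le_log_one_sub h0 h1)
          have h3 : q (⟪β, v p⟫ - a) ≤ C * (Real.exp (-a) * Real.exp ((‖β‖ + 1) * ‖v p‖)) := by
            refine (hq.le_exp _).trans ?_
            rw [← Real.exp_add]
            gcongr
            nlinarith
          linarith

/-- Far away from the origin, the defaults have small likelihood. -/
lemma binaryLikelihood_le_of_default_box (hq : IsExpLike q C x₁) (hCa : C ≤ Real.exp a) {c₁ : ℝ}
    (hbox : c₁ * n ≤ ∑ p ∈ R with Δ p, (signBox 1 (orthant (-b))).indicator (fun _ => (1 : ℝ)) (v p)) :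
    binaryLikelihood R Δ v q a b ≤ Real.exp (-(‖b‖ * (c₁ * n))) := by
  calc binaryLikelihood R Δ v q a b
      ≤ Real.exp (∑ p ∈ R, if Δ p then
          -‖b‖ * (signBox 1 (orthant (-b))).indicator (fun _ => (1 : ℝ)) (v p) else 0) := by
        rw [Real.exp_sum, binaryLikelihood]
        refine Finset.prod_le_prod (fun p _ => ?_) fun p hp => ?_
        · split_ifs
          · exact hq.nonneg _
          · linarith [hq.le_one (⟪b, v p⟫ - a)]
        · split_ifs with h
          -- In the box opposite to b one has ⟪b, v⟫ ≤ -‖b‖, so a default there has probability at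
          -- most C e^{-‖b‖ - a} ≤ e^{-‖b‖}. All other factors are bounded by 1.
          · by_cases hv : v p ∈ signBox 1 (orthant (-b))
            · have h1 := norm_mul_le_inner_of_mem_signBox one_pos hv
              rw [norm_neg, inner_neg_left] at h1
              rw [Set.indicator_of_mem hv]
              calc _ ≤ C * Real.exp (⟪b, v p⟫ - a) := hq.le_exp _
                _ ≤ Real.exp a * Real.exp (-‖b‖ - a) := by gcongr; linarith
                _ = _ := by rw [← Real.exp_add]; ring_nf
            · simpa [hv] using hq.le_one _
          · simpa using hq.nonneg _
    _ ≤ _ := by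
        apply Real.exp_le_exp.2
        rw [← Finset.sum_filter, ← Finset.mul_sum]
        nlinarith [norm_nonneg b]

/-- At a moderate distance from the origin, the survivals have small likelihood. -/
lemma binaryLikelihood_le_of_survival_box (hq : IsExpLike q C x₁) (ha : -(a / 2) ≤ x₁) {C₁ c₂ s : ℝ}
    (hs : 0 < s) (hsb : ‖b‖ * (2 * s * d) ≤ a / 2)
    (hΔ : ∑ p ∈ R with Δ p, Real.exp ((‖β‖ + 1) * ‖v p‖) ≤ C₁ * n)
    (hbox : c₂ * n ≤ Real.exp (-a) *
      ∑ p ∈ R with ¬ Δ p, (signBox s (orthant b)).indicator (fun _ => (1 : ℝ)) (v p)) :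
    binaryLikelihood R Δ v q a b ≤ Real.exp (-(a * (R.filter Δ).card) + (C + ‖b‖) * (C₁ * n) -
      Real.exp (s * ‖b‖) / 2 * (c₂ * n)) := by
  have hC := hq.one_le
  -- A survival in the box along b has factor at most exp(-e^{s‖b‖ - a}/2), while the defaults gain
  -- at most a term linear in ‖b‖. By `hsb` the predictor in the box is still below -a/2, where the
  -- lower bound on q holds.
  calc binaryLikelihood R Δ v q a b
      ≤ Real.exp (∑ p ∈ R, ((if Δ p then -a + (C + ‖b‖) * Real.exp ((‖β‖ + 1) * ‖v p‖) else 0) +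
          if ¬ Δ p then -(Real.exp (s * ‖b‖) / 2 * Real.exp (-a)) *
            (signBox s (orthant b)).indicator (fun _ => (1 : ℝ)) (v p) else 0)) := by
        rw [Real.exp_sum, binaryLikelihood]
        refine Finset.prod_le_prod (fun p _ => ?_) fun p hp => ?_
        · split_ifs
          · exact hq.nonneg _
          · linarith [hq.le_one (⟪b, v p⟫ - a)]
        · by_cases h : Δ p
          · simp only [h, if_true, not_true, if_false, add_zero]
            refine (hq.le_exp _).trans ?_
            calc C * Real.exp (⟪b, v p⟫ - a) ≤ Real.exp C * Real.exp (⟪b, v p⟫ - a) := by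
                  gcongr; linarith [Real.add_one_le_exp C]
              _ = Real.exp (C + (⟪b, v p⟫ - a)) := (Real.exp_add _ _).symm
              _ ≤ _ := by
                  apply Real.exp_le_exp.2
                  have h1 := real_inner_le_norm b (v p)
                  have h2 := Real.add_one_le_exp ((‖β‖ + 1) * ‖v p‖)
                  have h3 : (1 : ℝ) ≤ Real.exp ((‖β‖ + 1) * ‖v p‖) :=
                    Real.one_le_exp (by positivity)
                  have h4 : ‖v p‖ ≤ Real.exp ((‖β‖ + 1) * ‖v p‖) := by
                    nlinarith [mul_nonneg (norm_nonneg β) (norm_nonneg (v p))]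
                  have h5 : ‖b‖ * ‖v p‖ ≤ ‖b‖ * Real.exp ((‖β‖ + 1) * ‖v p‖) := by gcongr
                  nlinarith
          · simp only [h, if_false, not_false_eq_true, if_true, zero_add]
            have h1 : 1 - q (⟪b, v p⟫ - a) ≤ Real.exp (-q (⟪b, v p⟫ - a)) := by
              linarith [Real.add_one_le_exp (-q (⟪b, v p⟫ - a))]
            refine h1.trans (Real.exp_le_exp.2 ?_)
            by_cases hv : v p ∈ signBox s (orthant b)
            · have h2 := norm_mul_le_inner_of_mem_signBox hs hv
              have h3 := norm_le_of_mem_signBox hs hv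
              have h4 : ⟪b, v p⟫ - a ≤ x₁ := by
                refine (inner_sub_le_neg_half le_rfl (le_trans ?_ hsb)).trans ha
                gcongr
              rw [Set.indicator_of_mem hv]
              have h5 := hq.lower _ h4
              have h6 : Real.exp (s * ‖b‖) * Real.exp (-a) ≤ Real.exp (⟪b, v p⟫ - a) := by
                rw [← Real.exp_add]; apply Real.exp_le_exp.2; linarith
              linarith
            · simpa [hv] using hq.nonneg _
    _ ≤ _ := by
        apply Real.exp_le_exp.2
        rw [Finset.sum_add_distrib, ← Finset.sum_filter, ← Finset.sum_filter, ← Finset.mul_sum,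
          Finset.sum_add_distrib, ← Finset.mul_sum, Finset.sum_const, nsmul_eq_mul]
        have h1 := mul_le_mul_of_nonneg_left hbox (show 0 ≤ Real.exp (s * ‖b‖) / 2 by positivity)
        have h2 := mul_le_mul_of_nonneg_left hΔ (show 0 ≤ C + ‖b‖ by positivity)
        linarith

/-- The likelihood is smaller far away than at the true parameter. -/
lemma binaryLikelihood_lt_of_le_norm (hq : IsExpLike q C x₁) (hn : 0 < n) (ha1 : 1 ≤ a)
    (ha : -(a / 2) ≤ x₁) (hCa : C ≤ Real.exp a) (hv : ∀ p ∈ R, ‖β‖ * ‖v p‖ ≤ a / 2)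
    {C₁ c₁ c₂ s A R₀ : ℝ} (hs : 0 < s) (hsA : A * (2 * s * d) ≤ 1 / 2) (hC₁ : 0 ≤ C₁) (hc₁ : 0 < c₁)
    (hA : (1 + 2 * C) * C₁ + C₁ < A * c₁)
    (hR₀ : ∀ r ≥ R₀, (C + r) * C₁ + (1 + 2 * C) * C₁ < Real.exp (s * r) / 2 * c₂)
    (hΔ : ∑ p ∈ R with Δ p, Real.exp ((‖β‖ + 1) * ‖v p‖) ≤ C₁ * n)
    (hR : Real.exp (-a) * ∑ p ∈ R, Real.exp ((‖β‖ + 1) * ‖v p‖) ≤ C₁ * n)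
    (hbox₁ : ∀ ε, c₁ * n ≤ ∑ p ∈ R with Δ p, (signBox 1 ε).indicator (fun _ => (1 : ℝ)) (v p))
    (hbox₂ : ∀ ε, c₂ * n ≤ Real.exp (-a) *
      ∑ p ∈ R with ¬ Δ p, (signBox s ε).indicator (fun _ => (1 : ℝ)) (v p))
    (hb : R₀ ≤ ‖b‖) : binaryLikelihood R Δ v q a b < binaryLikelihood R Δ v q a β := by
  have hC := hq.one_le
  refine lt_of_lt_of_le ?_ (exp_le_binaryLikelihood hq ha hv hΔ hR)
  -- Beyond A a the loss c₁ n ‖b‖ beats a · #defaults ≤ C₁ a n. Below A a the terms a · #defaults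
  -- cancel, and a loss exponential in ‖b‖ beats a linear gain.
  rcases le_total (A * a) ‖b‖ with h | h
  · refine (binaryLikelihood_le_of_default_box hq hCa (hbox₁ _)).trans_lt (Real.exp_lt_exp.2 ?_)
    have hcard : ((R.filter Δ).card : ℝ) ≤ C₁ * n := by
      refine le_trans ?_ hΔ
      rw [Finset.card_eq_sum_ones]
      push_cast
      exact Finset.sum_le_sum fun p _ => Real.one_le_exp (by positivity)
    have h1 : A * a * (c₁ * n) ≤ ‖b‖ * (c₁ * n) := by gcongr
    have h2 : a * (R.filter Δ).card ≤ a * (C₁ * n) := by gcongr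
    have h3 : ((1 + 2 * C) * C₁ + C₁) * (a * n) < A * c₁ * (a * n) := by
      have : 0 < a * n := by positivity
      gcongr
    have h4 : (1 + 2 * C) * C₁ * n * 1 ≤ (1 + 2 * C) * C₁ * n * a := by gcongr
    nlinarith
  · have hsb : ‖b‖ * (2 * s * d) ≤ a / 2 := by
      have : ‖b‖ * (2 * s * d) ≤ A * a * (2 * s * d) := by gcongr
      nlinarith
    refine (binaryLikelihood_le_of_survival_box hq ha hs hsb hΔ (hbox₂ _)).trans_lt
      (Real.exp_lt_exp.2 ?_)
    have := mul_lt_mul_of_pos_right (hR₀ _ hb) hn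
    nlinarith

lemma binaryLikelihood_pos (hq : IsExpLike q C x₁) (h : ∀ p ∈ R, ⟪b, v p⟫ - a ≤ x₁) :
    0 < binaryLikelihood R Δ v q a b := by
  refine Finset.prod_pos fun p hp => ?_
  split_ifs
  · exact (half_pos (Real.exp_pos _)).trans_le (hq.lower _ (h p hp))
  · linarith [hq.upper _ (h p hp)]

lemma log_binaryLikelihood (hq : IsExpLike q C x₁) (h : ∀ p ∈ R, ⟪b, v p⟫ - a ≤ x₁) :
    Real.log (binaryLikelihood R Δ v q a b) =
      ∑ p ∈ R, if Δ p then Real.log (q (⟪b, v p⟫ - a)) else Real.log (1 - q (⟪b, v p⟫ - a)) := by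
  rw [binaryLikelihood, Real.log_prod]
  · exact Finset.sum_congr rfl fun p _ => by split_ifs <;> rfl
  · intro p hp
    split_ifs
    · exact ((half_pos (Real.exp_pos _)).trans_le (hq.lower _ (h p hp))).ne'
    · linarith [hq.upper _ (h p hp)]

/-- Expansion of the log-likelihood around the true parameter. -/
lemma abs_log_binaryLikelihood_sub_le (hq : IsExpLike q C x₁) (ha : -(a / 2) ≤ x₁) {R₀ C₃ : ℝ}
    (hβ : ‖β‖ ≤ R₀) (hb : ‖b‖ ≤ R₀) (hv : ∀ p ∈ R, R₀ * ‖v p‖ ≤ a / 2)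
    (hΔ : ∑ p ∈ R with Δ p, Real.exp ((3 * R₀ + 3) * ‖v p‖) ≤ C₃ * n)
    (hR : Real.exp (-a) * ∑ p ∈ R, Real.exp ((3 * R₀ + 3) * ‖v p‖) ≤ C₃ * n) :
    |Real.log (binaryLikelihood R Δ v q a b) - Real.log (binaryLikelihood R Δ v q a β) -
        ⟪b - β, binaryScore R Δ v q a β⟫ + ∑ p ∈ R, Real.exp (⟪β, v p⟫ - a) *
          (Real.exp ⟪b - β, v p⟫ - 1 - ⟪b - β, v p⟫)| ≤
      2 * C * C₃ * Real.exp (-a) * n * ‖b - β‖ ^ 2 := by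
  have hC := hq.one_le
  have hR₀ : 0 ≤ R₀ := (norm_nonneg _).trans hβ
  have hxβ : ∀ p ∈ R, ⟪β, v p⟫ - a ≤ x₁ := fun p hp =>
    (inner_sub_le_neg_half hβ (hv p hp)).trans ha
  have hxb : ∀ p ∈ R, ⟪b, v p⟫ - a ≤ x₁ := fun p hp =>
    (inner_sub_le_neg_half hb (hv p hp)).trans ha
  rw [log_binaryLikelihood hq hxb, log_binaryLikelihood hq hxβ, binaryScore, inner_sum,
    ← Finset.sum_sub_distrib, ← Finset.sum_sub_distrib, ← Finset.sum_add_distrib]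
  refine (Finset.abs_sum_le_sum_abs _ _).trans ?_
  -- The remainder is of order e^{-a} for each of O(n) defaults and e^{-2a} for each of O(n e^a)
  -- survivals: both total e^{-a} n ‖b - β‖².
  calc _ ≤ ∑ p ∈ R, C * ‖b - β‖ ^ 2 * Real.exp (-a) *
        ((if Δ p then Real.exp ((3 * R₀ + 3) * ‖v p‖) else 0) +
          Real.exp (-a) * Real.exp ((3 * R₀ + 3) * ‖v p‖)) := by
        refine Finset.sum_le_sum fun p hp => ?_
        set x := ⟪β, v p⟫ - a with hx
        set y := ⟪b - β, v p⟫ with hy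
        have hxy : ⟪b, v p⟫ - a = x + y := by rw [hx, hy, inner_sub_left]; ring
        have h1 := hxβ p hp
        have h2 := hxb p hp
        rw [hxy] at h2 ⊢
        have hmax : max x (x + y) ≤ R₀ * ‖v p‖ - a := by
          refine max_le ?_ ?_
          · have := (real_inner_le_norm β (v p)).trans (by gcongr : ‖β‖ * ‖v p‖ ≤ R₀ * ‖v p‖)
            linarith
          · have := (real_inner_le_norm b (v p)).trans (by gcongr : ‖b‖ * ‖v p‖ ≤ R₀ * ‖v p‖)
            linarith
        have hy2 : y ^ 2 ≤ ‖b - β‖ ^ 2 * Real.exp (2 * ‖v p‖) := by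
          have h3 : |y| ≤ ‖b - β‖ * Real.exp ‖v p‖ :=
            (abs_real_inner_le_norm _ _).trans (by gcongr; exact norm_le_exp_norm _)
          calc y ^ 2 = |y| ^ 2 := (sq_abs y).symm
            _ ≤ (‖b - β‖ * Real.exp ‖v p‖) ^ 2 := by gcongr
            _ = _ := by rw [mul_pow, ← Real.exp_nat_mul]; push_cast; rfl
        have hv0 : 0 ≤ R₀ * ‖v p‖ := by positivity
        have hq0 : 0 < q x := (half_pos (Real.exp_pos _)).trans_le (hq.lower _ h1)
        have hq1 : 0 < 1 - q x := by linarith [hq.upper _ h1]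
        have hin : ⟪b - β, (((if Δ p then 1 else 0) - q x) * scoreWeight q x) • v p⟫ =
            ((if Δ p then 1 else 0) - q x) * scoreWeight q x * y := by
          rw [real_inner_smul_right]
        rw [hin]
        split_ifs with h
        · have e : (1 - q x) * scoreWeight q x = deriv q x / q x := by
            rw [scoreWeight]; field_simp
          rw [e]
          refine (hq.taylor_log x y h1 h2).trans ?_
          calc C * Real.exp (max x (x + y)) * y ^ 2
              ≤ C * Real.exp (R₀ * ‖v p‖ - a) * (‖b - β‖ ^ 2 * Real.exp (2 * ‖v p‖)) := by
                gcongr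
            _ = C * ‖b - β‖ ^ 2 * Real.exp (-a) * Real.exp (R₀ * ‖v p‖ + 2 * ‖v p‖) := by
                rw [sub_eq_add_neg, Real.exp_add, Real.exp_add]; ring
            _ ≤ C * ‖b - β‖ ^ 2 * Real.exp (-a) * (Real.exp ((3 * R₀ + 3) * ‖v p‖) + 0) := by
                rw [add_zero]
                gcongr
                nlinarith [norm_nonneg (v p)]
            _ ≤ _ := by gcongr; positivity
        · have e : (0 - q x) * scoreWeight q x = -(deriv q x / (1 - q x)) := by
            rw [scoreWeight]; field_simp; ring
          rw [e, neg_mul, sub_neg_eq_add, zero_add]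
          refine (hq.taylor_log_one_sub x y h1 h2).trans ?_
          calc C * Real.exp (2 * max x (x + y)) * y ^ 2
              ≤ C * Real.exp (2 * (R₀ * ‖v p‖ - a)) * (‖b - β‖ ^ 2 * Real.exp (2 * ‖v p‖)) := by
                gcongr
            _ = C * ‖b - β‖ ^ 2 * Real.exp (-a) *
                (Real.exp (-a) * Real.exp (2 * (R₀ * ‖v p‖) + 2 * ‖v p‖)) := by
                rw [show 2 * (R₀ * ‖v p‖ - a) = -a + -a + 2 * (R₀ * ‖v p‖) by ring, Real.exp_add,
                  Real.exp_add, Real.exp_add]; ring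
            _ ≤ _ := by
                gcongr
                nlinarith [norm_nonneg (v p)]
    _ ≤ _ := by
        rw [← Finset.mul_sum, Finset.sum_add_distrib, ← Finset.sum_filter, ← Finset.mul_sum]
        calc C * ‖b - β‖ ^ 2 * Real.exp (-a) * _
            ≤ C * ‖b - β‖ ^ 2 * Real.exp (-a) * (C₃ * n + C₃ * n) := by gcongr
          _ = _ := by ring

lemma exp_sub_one_sub_self_nonneg (y : ℝ) : 0 ≤ Real.exp y - 1 - y := by
  linarith [Real.add_one_le_exp y]

/-- Uniform concavity of the log-likelihood. -/
lemma le_sum_exp_mul_of_survival_box {c₂ s : ℝ} (hs : 0 < s) {u : EuclideanSpace ℝ (Fin d)}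
    (hbox : c₂ * n ≤ Real.exp (-a) *
      ∑ p ∈ R with ¬ Δ p, (signBox s (orthant u)).indicator (fun _ => (1 : ℝ)) (v p)) :
    s ^ 2 / 2 * Real.exp (-(‖β‖ * (2 * s * d))) * c₂ * n * ‖u‖ ^ 2 ≤
      ∑ p ∈ R, Real.exp (⟪β, v p⟫ - a) * (Real.exp ⟪u, v p⟫ - 1 - ⟪u, v p⟫) := by
  -- All terms are nonnegative, so the sum may be restricted to survivals in the box of u, where y =
  -- ⟪u, v⟫ ≥ s‖u‖ and e^y - 1 - y ≥ y²/2. The estimate holds for every u, not only small ones.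
  calc _ = s ^ 2 / 2 * Real.exp (-(‖β‖ * (2 * s * d))) * ‖u‖ ^ 2 * (c₂ * n) := by ring
    _ ≤ s ^ 2 / 2 * Real.exp (-(‖β‖ * (2 * s * d))) * ‖u‖ ^ 2 * (Real.exp (-a) *
      ∑ p ∈ R with ¬ Δ p, (signBox s (orthant u)).indicator (fun _ => (1 : ℝ)) (v p)) := by gcongr
    _ = ∑ p ∈ R with ¬ Δ p, s ^ 2 / 2 * Real.exp (-(‖β‖ * (2 * s * d))) * ‖u‖ ^ 2 * Real.exp (-a) *
      (signBox s (orthant u)).indicator (fun _ => (1 : ℝ)) (v p) := by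
        rw [← mul_assoc, Finset.mul_sum]
    _ ≤ ∑ p ∈ R with ¬ Δ p,
        Real.exp (⟪β, v p⟫ - a) * (Real.exp ⟪u, v p⟫ - 1 - ⟪u, v p⟫) := by
        refine Finset.sum_le_sum fun p _ => ?_
        by_cases hv : v p ∈ signBox s (orthant u)
        · rw [Set.indicator_of_mem hv, mul_one]
          have h1 := norm_mul_le_inner_of_mem_signBox hs hv
          have h2 := norm_le_of_mem_signBox hs hv
          have h3 : 0 ≤ s * ‖u‖ := by positivity
          have h4 := Real.quadratic_le_exp_of_nonneg (h3.trans h1)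
          have h5 : s ^ 2 / 2 * ‖u‖ ^ 2 ≤ Real.exp ⟪u, v p⟫ - 1 - ⟪u, v p⟫ := by nlinarith
          have h6 : Real.exp (-(‖β‖ * (2 * s * d))) * Real.exp (-a) ≤ Real.exp (⟪β, v p⟫ - a) := by
            rw [← Real.exp_add]
            apply Real.exp_le_exp.2
            have h7 := (abs_le.1 (abs_real_inner_le_norm β (v p))).1
            have h8 : ‖β‖ * ‖v p‖ ≤ ‖β‖ * (2 * s * d) := by gcongr
            linarith
          calc _ = Real.exp (-(‖β‖ * (2 * s * d))) * Real.exp (-a) * (s ^ 2 / 2 * ‖u‖ ^ 2) := by ring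
            _ ≤ _ := by gcongr
        · rw [Set.indicator_of_notMem hv, mul_zero]
          exact mul_nonneg (Real.exp_pos _).le (exp_sub_one_sub_self_nonneg _)
    _ ≤ _ := Finset.sum_le_sum_of_subset_of_nonneg (Finset.filter_subset _ _) fun p _ _ =>
        mul_nonneg (Real.exp_pos _).le (exp_sub_one_sub_self_nonneg _)

lemma abs_exp_sub_quadratic_le (y : ℝ) :
    |Real.exp y - 1 - y - y ^ 2 / 2| ≤ |y| ^ 3 * Real.exp |y| := by
  have h := Complex.norm_exp_sub_sum_le_norm_mul_exp (y : ℂ) 3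
  have e : Complex.exp (y : ℂ) - ∑ m ∈ Finset.range 3, (y : ℂ) ^ m / (m.factorial : ℂ) =
      ((Real.exp y - 1 - y - y ^ 2 / 2 : ℝ) : ℂ) := by
    simp [Finset.sum_range_succ]
    ring
  rw [e, Complex.norm_real, Complex.norm_real] at h
  exact h

/-- Local quadratic approximation of the curvature term. -/
lemma abs_sum_exp_mul_sub_quadratic_le {R₀ C₃ κ : ℝ} {u : EuclideanSpace ℝ (Fin d)}
    {A : EuclideanSpace ℝ (Fin d) →L[ℝ] EuclideanSpace ℝ (Fin d)}
    (hβ : ‖β‖ ≤ R₀) (hu : ‖u‖ ≤ 2 * R₀)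
    (hR : Real.exp (-a) * ∑ p ∈ R, Real.exp ((3 * R₀ + 3) * ‖v p‖) ≤ C₃ * n)
    (hA : |∑ p ∈ R, Real.exp (⟪β, v p⟫ - a) * ⟪u, v p⟫ ^ 2 - n * ⟪u, A u⟫| ≤ κ * n * ‖u‖ ^ 2) :
    |∑ p ∈ R, Real.exp (⟪β, v p⟫ - a) * (Real.exp ⟪u, v p⟫ - 1 - ⟪u, v p⟫) - n * ⟪u, A u⟫ / 2| ≤
      n * ‖u‖ ^ 2 * (κ / 2 + C₃ * ‖u‖) := by
  have h1 : |∑ p ∈ R, Real.exp (⟪β, v p⟫ - a) *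
      (Real.exp ⟪u, v p⟫ - 1 - ⟪u, v p⟫ - ⟪u, v p⟫ ^ 2 / 2)| ≤ C₃ * n * ‖u‖ ^ 3 := by
    refine (Finset.abs_sum_le_sum_abs _ _).trans ?_
    calc _ ≤ ∑ p ∈ R, ‖u‖ ^ 3 * Real.exp (-a) * Real.exp ((3 * R₀ + 3) * ‖v p‖) := by
          refine Finset.sum_le_sum fun p _ => ?_
          rw [abs_mul, Real.abs_exp]
          have hy : |⟪u, v p⟫| ≤ ‖u‖ * ‖v p‖ := abs_real_inner_le_norm _ _
          have hβv := (real_inner_le_norm β (v p)).trans (by gcongr : ‖β‖ * ‖v p‖ ≤ R₀ * ‖v p‖)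
          -- The exponent 3R₀ + 3 collects R₀ from e^{⟪β, v⟫}, 3 from ‖v‖³, and 2R₀ from e^{|⟪u,
          -- v⟫|}.
          calc _ ≤ Real.exp (R₀ * ‖v p‖ - a) *
                ((‖u‖ * Real.exp ‖v p‖) ^ 3 * Real.exp (2 * R₀ * ‖v p‖)) := by
                refine mul_le_mul (Real.exp_le_exp.2 (by linarith))
                  ((abs_exp_sub_quadratic_le _).trans ?_) (abs_nonneg _) (Real.exp_pos _).le
                gcongr
                · exact hy.trans (by gcongr; exact norm_le_exp_norm _)
                · exact hy.trans (by gcongr)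
            _ = _ := by
                rw [mul_pow, ← Real.exp_nat_mul, sub_eq_add_neg, Real.exp_add,
                  show (3 * R₀ + 3) * ‖v p‖ = R₀ * ‖v p‖ + (((3 : ℕ) : ℝ) * ‖v p‖ + 2 * R₀ * ‖v p‖) by
                    push_cast; ring, Real.exp_add, Real.exp_add]
                ring
      _ = ‖u‖ ^ 3 * (Real.exp (-a) * ∑ p ∈ R, Real.exp ((3 * R₀ + 3) * ‖v p‖)) := by
          rw [← Finset.mul_sum, mul_assoc]
      _ ≤ ‖u‖ ^ 3 * (C₃ * n) := by gcongr
      _ = _ := by ring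
  have e : ∑ p ∈ R, Real.exp (⟪β, v p⟫ - a) * (Real.exp ⟪u, v p⟫ - 1 - ⟪u, v p⟫) -
      n * ⟪u, A u⟫ / 2 = ∑ p ∈ R, Real.exp (⟪β, v p⟫ - a) *
      (Real.exp ⟪u, v p⟫ - 1 - ⟪u, v p⟫ - ⟪u, v p⟫ ^ 2 / 2) +
      (∑ p ∈ R, Real.exp (⟪β, v p⟫ - a) * ⟪u, v p⟫ ^ 2 - n * ⟪u, A u⟫) / 2 := by
    rw [sub_div, Finset.sum_div, ← add_sub_assoc, ← Finset.sum_add_distrib]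
    congr 1
    exact Finset.sum_congr rfl fun p _ => by ring
  rw [e]
  refine (abs_add_le _ _).trans ?_
  rw [abs_div, abs_two]
  nlinarith

end BinaryLikelihood

/-! ### From likelihood estimates to the maximiser -/

section Maximizer

variable {d : ℕ} {ι : Type*} {R : Finset ι} {Δ : ι → Prop} [DecidablePred Δ]
  {v : ι → EuclideanSpace ℝ (Fin d)}
  {q : ℝ → ℝ} {a C x₁ n : ℝ} {β b : EuclideanSpace ℝ (Fin d)}
  {A : EuclideanSpace ℝ (Fin d) →L[ℝ] EuclideanSpace ℝ (Fin d)}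
  {C₁ c₁ c₂ s R₀ C₃ κ : ℝ}

/-- A sample of binary observations whose empirical moments, weighted empirical covariance `A` and
numbers of observations in the boxes `signBox` are under control. -/
structure IsRegularSample (R : Finset ι) (Δ : ι → Prop) [DecidablePred Δ]
    (v : ι → EuclideanSpace ℝ (Fin d)) (a n : ℝ) (β : EuclideanSpace ℝ (Fin d))
    (A : EuclideanSpace ℝ (Fin d) →L[ℝ] EuclideanSpace ℝ (Fin d))
    (C₁ c₁ c₂ s R₀ C₃ κ : ℝ) : Prop where
  norm_le : ∀ p ∈ R, R₀ * ‖v p‖ ≤ a / 2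
  default_exp : ∑ p ∈ R with Δ p, Real.exp ((‖β‖ + 1) * ‖v p‖) ≤ C₁ * n
  risk_exp : Real.exp (-a) * ∑ p ∈ R, Real.exp ((‖β‖ + 1) * ‖v p‖) ≤ C₁ * n
  default_exp' : ∑ p ∈ R with Δ p, Real.exp ((3 * R₀ + 3) * ‖v p‖) ≤ C₃ * n
  risk_exp' : Real.exp (-a) * ∑ p ∈ R, Real.exp ((3 * R₀ + 3) * ‖v p‖) ≤ C₃ * n
  default_box : ∀ ε, c₁ * n ≤ ∑ p ∈ R with Δ p, (signBox 1 ε).indicator (fun _ => (1 : ℝ)) (v p)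
  survival_box : ∀ ε, c₂ * n ≤ Real.exp (-a) *
      ∑ p ∈ R with ¬ Δ p, (signBox s ε).indicator (fun _ => (1 : ℝ)) (v p)
  quadratic : ∀ u, |∑ p ∈ R, Real.exp (⟪β, v p⟫ - a) * ⟪u, v p⟫ ^ 2 - n * ⟪u, A u⟫| ≤ κ * n * ‖u‖ ^ 2

lemma continuous_binaryLikelihood (hq : Continuous q) :
    Continuous fun b => binaryLikelihood R Δ v q a b := by
  unfold binaryLikelihood
  refine continuous_finsetProd _ fun p _ => ?_
  split_ifs <;> fun_prop

/-- A point at which the likelihood is at least as large as at the true parameter is close to it. -/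
lemma IsRegularSample.norm_sub_le_of_le (h : IsRegularSample R Δ v a n β A C₁ c₁ c₂ s R₀ C₃ κ)
    (hq : IsExpLike q C x₁) (hn : 0 < n) (ha : -(a / 2) ≤ x₁) (hs : 0 < s) (hβ : ‖β‖ ≤ R₀)
    (hb : ‖b‖ ≤ R₀) {c₃ : ℝ} (hc₃ : c₃ = s ^ 2 / 2 * Real.exp (-(‖β‖ * (2 * s * d))) * c₂)
    (ha₃ : 4 * C * C₃ * Real.exp (-a) ≤ c₃)
    (hle : binaryLikelihood R Δ v q a β ≤ binaryLikelihood R Δ v q a b) :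
    c₃ * n * ‖b - β‖ ≤ 2 * ‖binaryScore R Δ v q a β‖ := by
  have hpos : 0 < binaryLikelihood R Δ v q a β := binaryLikelihood_pos hq fun p hp =>
    (inner_sub_le_neg_half hβ (h.norm_le p hp)).trans ha
  have h1 := Real.log_le_log hpos hle
  have h2 := (abs_le.1 (abs_log_binaryLikelihood_sub_le hq ha hβ hb h.norm_le h.default_exp'
    h.risk_exp')).2
  have h3 := le_sum_exp_mul_of_survival_box (β := β) hs (h.survival_box (orthant (b - β)))
  rw [← hc₃] at h3
  have h4 := real_inner_le_norm (b - β) (binaryScore R Δ v q a β)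
  -- The Taylor error is absorbed by half of the curvature c₃ n ‖b - β‖², leaving (c₃/2) n ‖b - β‖²
  -- ≤ ⟪b - β, U⟫.
  have h5 : 4 * C * C₃ * Real.exp (-a) * (n * ‖b - β‖ ^ 2) ≤ c₃ * (n * ‖b - β‖ ^ 2) := by gcongr
  rcases (norm_nonneg (b - β)).eq_or_lt with h0 | h0
  · rw [← h0]; simp
  · have : c₃ * n * ‖b - β‖ * ‖b - β‖ ≤ 2 * ‖binaryScore R Δ v q a β‖ * ‖b - β‖ := by nlinarith
    exact le_of_mul_le_mul_right this h0

/-- A maximum over a compact ball is global, since outside the ball the likelihood is below its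
value at β. The estimator is assumed to maximise only when a maximum exists, so existence is needed.
-/
lemma exists_isMax_binaryLikelihood (hq : Continuous q) (hβ : ‖β‖ ≤ R₀)
    (hlt : ∀ b, R₀ ≤ ‖b‖ → binaryLikelihood R Δ v q a b < binaryLikelihood R Δ v q a β) :
    ∃ b, ∀ b', binaryLikelihood R Δ v q a b' ≤ binaryLikelihood R Δ v q a b := by
  obtain ⟨b, -, hmax⟩ := (isCompact_closedBall (0 : EuclideanSpace ℝ (Fin d)) R₀).exists_isMaxOn
    ⟨β, by simpa using hβ⟩ (continuous_binaryLikelihood (R := R) (Δ := Δ) (v := v) (a := a) hq).continuousOn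
  refine ⟨b, fun b' => ?_⟩
  rcases le_total ‖b'‖ R₀ with hb' | hb'
  · exact hmax (by simpa using hb')
  · exact (hlt b' hb').le.trans (hmax (by simpa using hβ))

/-- Completing the square: w = n⁻¹ A⁻¹ U maximises the quadratic model, and the deficit at any u is
the quadratic form of u - w. -/
lemma inner_quadratic_sub {u w U : EuclideanSpace ℝ (Fin d)}
    (hsym : ∀ x y, ⟪A x, y⟫ = ⟪x, A y⟫) (hw : n • A w = U) :
    (⟪w, U⟫ - n * ⟪w, A w⟫ / 2) - (⟪u, U⟫ - n * ⟪u, A u⟫ / 2) = n / 2 * ⟪u - w, A (u - w)⟫ := by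
  have h1 : ⟪w, A u⟫ = ⟪u, A w⟫ := by rw [← hsym, real_inner_comm]
  rw [← hw, map_sub, inner_sub_left, inner_sub_right, inner_sub_right, real_inner_smul_right,
    real_inner_smul_right, h1]
  ring

/-- The maximum likelihood estimator is close to the one-step estimator. -/
lemma IsRegularSample.norm_sub_oneStep_le (h : IsRegularSample R Δ v a n β A C₁ c₁ c₂ s R₀ C₃ κ)
    (hq : IsExpLike q C x₁) (hn : 0 < n) (ha : -(a / 2) ≤ x₁) (hs : 0 < s) (hβ : ‖β‖ + 1 ≤ R₀)
    (hlt : ∀ b, R₀ ≤ ‖b‖ → binaryLikelihood R Δ v q a b < binaryLikelihood R Δ v q a β)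
    {c₃ : ℝ} (hc₃ : c₃ = s ^ 2 / 2 * Real.exp (-(‖β‖ * (2 * s * d))) * c₂) (hc₃0 : 0 < c₃)
    (ha₃ : 4 * C * C₃ * Real.exp (-a) ≤ c₃) (hC₃ : 0 ≤ C₃) (hκ : 0 ≤ κ)
    (hsym : ∀ x y, ⟪A x, y⟫ = ⟪x, A y⟫) {lam : ℝ} (hlam : 0 < lam)
    (hA : ∀ x, lam * ‖x‖ ^ 2 ≤ ⟪x, A x⟫)
    {B : EuclideanSpace ℝ (Fin d) →L[ℝ] EuclideanSpace ℝ (Fin d)} (hB : ∀ x, A (B x) = x)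
    {MU M : ℝ} (hU : ‖binaryScore R Δ v q a β‖ ≤ MU * √n) (hM1 : 2 * MU ≤ c₃ * M)
    (hM2 : MU ≤ lam * M) (hMn : M ≤ √n)
    (hb : ∀ b', binaryLikelihood R Δ v q a b' ≤ binaryLikelihood R Δ v q a b) :
    ‖√n • (b - β) - B ((√n)⁻¹ • binaryScore R Δ v q a β)‖ ^ 2 ≤
      4 * (M ^ 2 * (2 * C * C₃ * Real.exp (-a) + κ / 2 + C₃ * (M / √n))) / lam := by
  set U := binaryScore R Δ v q a β with hUdef
  have hC := hq.one_le
  have hsn : 0 < √n := Real.sqrt_pos.2 hn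
  have hnn : √n * √n = n := Real.mul_self_sqrt hn.le
  have hβ' : ‖β‖ ≤ R₀ := by linarith
  have hMU0 : 0 ≤ MU := by
    by_contra hneg
    push Not at hneg
    nlinarith [norm_nonneg U]
  have hM0 : 0 ≤ M := by
    by_contra hneg
    push Not at hneg
    nlinarith
  have hM1n : M / √n ≤ 1 := (div_le_one hsn).2 hMn
  have hM1n0 : 0 ≤ M / √n := by positivity
  set w := n⁻¹ • B U with hw
  have hwU : n • A w = U := by rw [hw, map_smul, hB, smul_smul, mul_inv_cancel₀ hn.ne', one_smul]
  have hbR : ‖b‖ ≤ R₀ := by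
    by_contra hneg
    push Not at hneg
    exact absurd (hb β) (not_le.2 (hlt b hneg.le))
  -- Consistency at rate n^{-1/2}, from the a priori bound by the score; M was chosen so that w
  -- satisfies the same bound.
  have hu : ‖b - β‖ ≤ M / √n := by
    rw [le_div_iff₀ hsn]
    have h1 := h.norm_sub_le_of_le hq hn ha hs hβ' hbR hc₃ ha₃ (hb β)
    have h2 : c₃ * √n * (‖b - β‖ * √n) ≤ c₃ * √n * M := by
      calc c₃ * √n * (‖b - β‖ * √n) = c₃ * n * ‖b - β‖ := by linear_combination (c₃ * ‖b - β‖) * hnn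
        _ ≤ 2 * (MU * √n) := h1.trans (by gcongr)
        _ ≤ _ := by nlinarith
    exact le_of_mul_le_mul_left h2 (by positivity)
  have hwn : ‖w‖ ≤ M / √n := by
    rw [le_div_iff₀ hsn]
    have h1 := hA w
    have h2 : n * ⟪w, A w⟫ ≤ ‖w‖ * ‖U‖ := by
      rw [← real_inner_smul_right, hwU]; exact real_inner_le_norm _ _
    rcases (norm_nonneg w).eq_or_lt with h0 | h0
    · rw [← h0]; simpa using hM0
    · have h3 : lam * n * ‖w‖ * ‖w‖ ≤ MU * √n * ‖w‖ := by nlinarith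
      have h4 := le_of_mul_le_mul_right h3 h0
      have h5 : lam * √n * (‖w‖ * √n) ≤ lam * √n * M := by
        calc lam * √n * (‖w‖ * √n) = lam * n * ‖w‖ := by linear_combination (lam * ‖w‖) * hnn
          _ ≤ MU * √n := h4
          _ ≤ _ := by nlinarith
      exact le_of_mul_le_mul_left h5 (by positivity)
  -- Within radius M/√n the log-likelihood ratio agrees with the quadratic model up to a small
  -- error.
  have hbound : ∀ u : EuclideanSpace ℝ (Fin d), ‖u‖ ≤ M / √n →
      |Real.log (binaryLikelihood R Δ v q a (β + u)) - Real.log (binaryLikelihood R Δ v q a β) -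
        (⟪u, U⟫ - n * ⟪u, A u⟫ / 2)| ≤
      M ^ 2 * (2 * C * C₃ * Real.exp (-a) + κ / 2 + C₃ * (M / √n)) := by
    intro u hu
    have hbu : ‖β + u‖ ≤ R₀ := (norm_add_le _ _).trans (by linarith)
    have h1 := abs_log_binaryLikelihood_sub_le hq ha hβ' hbu h.norm_le h.default_exp' h.risk_exp'
    rw [add_sub_cancel_left] at h1
    have h2 := abs_sum_exp_mul_sub_quadratic_le hβ' (u := u)
      (by linarith [norm_nonneg β]) h.risk_exp' (h.quadratic u)
    have h3 : n * ‖u‖ ^ 2 ≤ M ^ 2 := by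
      calc n * ‖u‖ ^ 2 ≤ n * (M / √n) ^ 2 := by gcongr
        _ = M ^ 2 := by rw [div_pow, Real.sq_sqrt hn.le]; field_simp
    have h4 : |Real.log (binaryLikelihood R Δ v q a (β + u)) -
        Real.log (binaryLikelihood R Δ v q a β) - (⟪u, U⟫ - n * ⟪u, A u⟫ / 2)| ≤
        2 * C * C₃ * Real.exp (-a) * n * ‖u‖ ^ 2 + n * ‖u‖ ^ 2 * (κ / 2 + C₃ * ‖u‖) := by
      rw [abs_le] at h1 h2 ⊢
      constructor <;> linarith [h1.1, h1.2, h2.1, h2.2]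
    refine h4.trans ?_
    calc _ = n * ‖u‖ ^ 2 * (2 * C * C₃ * Real.exp (-a) + κ / 2 + C₃ * ‖u‖) := by ring
      _ ≤ _ := by gcongr
  -- The point b is at least as likely as β + w, while w is optimal for the quadratic model. The
  -- deficit of b - β is thus at most twice the approximation error, and positivity of A bounds ‖b -
  -- β - w‖.
  have k1 := abs_le.1 (hbound (b - β) hu)
  have k2 := abs_le.1 (hbound w hwn)
  rw [add_sub_cancel] at k1
  have hposw : 0 < binaryLikelihood R Δ v q a (β + w) := binaryLikelihood_pos hq fun p hp =>
    (inner_sub_le_neg_half ((norm_add_le _ _).trans (by linarith)) (h.norm_le p hp)).trans ha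
  have k3 := Real.log_le_log hposw (hb (β + w))
  have k4 := inner_quadratic_sub (u := b - β) hsym hwU
  have k5 := hA (b - β - w)
  have e : √n • (b - β) - B ((√n)⁻¹ • U) = √n • (b - β - w) := by
    have e0 : (√n)⁻¹ = √n * n⁻¹ := by
      rw [← div_eq_mul_inv, eq_div_iff hn.ne', inv_mul_eq_iff_eq_mul₀ hsn.ne', hnn]
    rw [smul_sub √n (b - β) w, hw, smul_smul, map_smul, e0]
  rw [e, norm_smul, mul_pow, Real.norm_of_nonneg hsn.le, Real.sq_sqrt hn.le, le_div_iff₀ hlam]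
  have k6 := mul_le_mul_of_nonneg_left k5 hn.le
  nlinarith

end Maximizer

/-! ### The information matrix and its inverse -/

section InformationMatrix

variable {d : ℕ} {S : Matrix (Fin d) (Fin d) ℝ}

/-- The asymptotic information `(Σ + Σ β βᵀ Σ) exp(½ βᵀ Σ β)`. -/
def informationMatrix (S : Matrix (Fin d) (Fin d) ℝ) (β : EuclideanSpace ℝ (Fin d)) :
    Matrix (Fin d) (Fin d) ℝ :=
  Real.exp (β.ofLp ⬝ᵥ S.mulVec β.ofLp / 2) • (S + S * Matrix.vecMulVec β.ofLp β.ofLp * S)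

lemma posDef_add_mul_vecMulVec_mul (hS : S.PosDef) (x : Fin d → ℝ) :
    (S + S * Matrix.vecMulVec x x * S).PosDef := by
  refine hS.add_posSemidef ?_
  have h := (Matrix.posSemidef_vecMulVec_self_star x).mul_mul_conjTranspose_same S
  rwa [hS.isHermitian.eq, star_trivial] at h

lemma informationMatrix_posDef (hS : S.PosDef) (β : EuclideanSpace ℝ (Fin d)) :
    (informationMatrix S β).PosDef :=
  (posDef_add_mul_vecMulVec_mul hS _).smul (Real.exp_pos _)

lemma limitCov_posDef (hS : S.PosDef) (β : EuclideanSpace ℝ (Fin d)) : (limitCov S β).PosDef :=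
  (posDef_add_mul_vecMulVec_mul hS _).inv.smul (Real.exp_pos _)

lemma informationMatrix_mul_limitCov (hS : S.PosDef) (β : EuclideanSpace ℝ (Fin d)) :
    informationMatrix S β * limitCov S β = 1 := by
  rw [informationMatrix, limitCov, smul_mul_smul_comm, Matrix.mul_nonsing_inv, ← Real.exp_add]
  · ring_nf; simp
  · exact (Matrix.isUnit_iff_isUnit_det _).1 (posDef_add_mul_vecMulVec_mul hS _).isUnit

/-- This identifies the matrix as the tilted second moment, which is what the law of large numbers
produces. -/
lemma inner_informationMatrix (hS : S.PosDef) (β w : EuclideanSpace ℝ (Fin d)) :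
    ⟪w, Matrix.toEuclideanCLM (𝕜 := ℝ) (informationMatrix S β) w⟫ =
      ∫ v, Real.exp ⟪β, v⟫ * ⟪w, v⟫ ^ 2 ∂(multivariateGaussian 0 S) := by
  rw [integral_exp_inner_mul_sq hS.posSemidef, Matrix.inner_toEuclideanCLM, informationMatrix,
    Matrix.smul_mulVec, dotProduct_smul, smul_eq_mul, Matrix.add_mulVec, dotProduct_add]
  congr 2
  rw [← Matrix.mulVec_mulVec, ← Matrix.mulVec_mulVec, Matrix.vecMulVec_mulVec, pow_two]
  simp only [op_smul_eq_smul, Matrix.mulVec_smul, dotProduct_smul, smul_eq_mul]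
  rw [dotProduct_mulVec_comm_of_isHermitian hS.isHermitian β.ofLp w.ofLp]

lemma inner_toEuclideanCLM_comm {A : Matrix (Fin d) (Fin d) ℝ} (hA : A.IsHermitian)
    (x y : EuclideanSpace ℝ (Fin d)) :
    ⟪Matrix.toEuclideanCLM (𝕜 := ℝ) A x, y⟫ = ⟪x, Matrix.toEuclideanCLM (𝕜 := ℝ) A y⟫ := by
  rw [real_inner_comm, Matrix.inner_toEuclideanCLM, Matrix.inner_toEuclideanCLM,
    dotProduct_mulVec_comm_of_isHermitian hA]

lemma exists_mul_norm_sq_le_inner_of_posDef {A : Matrix (Fin d) (Fin d) ℝ} (hA : A.PosDef) :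
    ∃ lam > 0, ∀ x : EuclideanSpace ℝ (Fin d),
      lam * ‖x‖ ^ 2 ≤ ⟪x, Matrix.toEuclideanCLM (𝕜 := ℝ) A x⟫ := by
  have hpos : ∀ x : EuclideanSpace ℝ (Fin d), x ≠ 0 →
      0 < ⟪x, Matrix.toEuclideanCLM (𝕜 := ℝ) A x⟫ := fun x hx => by
    rw [Matrix.inner_toEuclideanCLM]
    simpa using hA.dotProduct_mulVec_pos (x := x.ofLp) (by simpa using hx)
  -- The unit sphere is empty when d = 0; otherwise the constant is the minimum of the form on it.
  rcases (Metric.sphere (0 : EuclideanSpace ℝ (Fin d)) 1).eq_empty_or_nonempty with h | h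
  · refine ⟨1, one_pos, fun x => ?_⟩
    have hx : x = 0 := by
      by_contra hx
      have : (‖x‖⁻¹ • x) ∈ Metric.sphere (0 : EuclideanSpace ℝ (Fin d)) 1 := by
        simp [norm_smul, hx]
      rw [h] at this
      exact this
    simp [hx]
  · obtain ⟨x₀, hx₀, hmin⟩ := (isCompact_sphere (0 : EuclideanSpace ℝ (Fin d)) 1).exists_isMinOn h
      (f := fun x => ⟪x, Matrix.toEuclideanCLM (𝕜 := ℝ) A x⟫) (by fun_prop)
    have hx₀' : ‖x₀‖ = 1 := by simpa using hx₀
    refine ⟨_, hpos x₀ (fun h => by simp [h] at hx₀'), fun x => ?_⟩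
    by_cases hx : x = 0
    · simp [hx]
    have hx' : ‖x‖ ≠ 0 := by simpa using hx
    have hm : (‖x‖⁻¹ • x) ∈ Metric.sphere (0 : EuclideanSpace ℝ (Fin d)) 1 := by
      simp [norm_smul, hx]
    have h2 := hmin hm
    simp only [Set.mem_ofPred_eq, map_smul, real_inner_smul_left, real_inner_smul_right] at h2
    calc _ ≤ ‖x‖⁻¹ * (‖x‖⁻¹ * ⟪x, Matrix.toEuclideanCLM (𝕜 := ℝ) A x⟫) * ‖x‖ ^ 2 := by gcongr
      _ = _ := by field_simp

end InformationMatrix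

/-! ### Orders of magnitude in γ -/

section Scaling

variable {δ ζ : ℝ}

/-- The order `γ^{-(δ + ζ - 1)}` of the number of defaults. -/
def effectiveSize (δ ζ γ : ℝ) : ℝ := γ ^ (-(δ + ζ - 1))

lemma effectiveSize_pos {γ : ℝ} (hγ : 0 < γ) : 0 < effectiveSize δ ζ γ := Real.rpow_pos_of_pos hγ _

lemma sqrt_effectiveSize {γ : ℝ} (hγ : 0 < γ) :
    √(effectiveSize δ ζ γ) = γ ^ (-(δ + ζ - 1) / 2) := by
  rw [effectiveSize, Real.sqrt_eq_rpow, ← Real.rpow_mul hγ.le]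
  congr 1; ring

lemma exp_neg_intercept {γ : ℝ} (hγ : 0 < γ) : Real.exp (-intercept γ) = γ := by
  rw [intercept, one_div, Real.log_inv, neg_neg, Real.exp_log hγ]

lemma eventually_pos_lt_one : ∀ᶠ γ in 𝓝[>] (0 : ℝ), 0 < γ ∧ γ < 1 := Ioo_mem_nhdsGT one_pos

lemma tendsto_intercept : Tendsto intercept (𝓝[>] 0) atTop := by
  have : intercept = fun γ => -Real.log γ := by
    ext γ; rw [intercept, one_div, Real.log_inv]
  rw [this]
  exact tendsto_neg_atBot_atTop.comp Real.tendsto_log_nhdsGT_zero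

lemma tendsto_effectiveSize (h : 1 < δ + ζ) : Tendsto (effectiveSize δ ζ) (𝓝[>] 0) atTop :=
  tendsto_rpow_neg_nhdsGT_zero (by linarith)

lemma tendsto_sqrt_effectiveSize (h : 1 < δ + ζ) :
    Tendsto (fun γ => √(effectiveSize δ ζ γ)) (𝓝[>] 0) atTop :=
  Real.tendsto_sqrt_atTop.comp (tendsto_effectiveSize h)

/-- Truncated covariates have norm at most α, so this makes the increments of the normalised score
uniformly small, the Lindeberg condition of the limit theorem. -/
lemma tendsto_intercept_div_sqrt (h : 1 < δ + ζ) :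
    Tendsto (fun γ => intercept γ / √(effectiveSize δ ζ γ)) (𝓝[>] 0) (𝓝 0) := by
  have h1 := (tendsto_log_mul_rpow_nhdsGT_zero (r := (δ + ζ - 1) / 2) (by linarith)).neg
  rw [neg_zero] at h1
  refine h1.congr' ?_
  filter_upwards [self_mem_nhdsWithin] with γ hγ
  rw [sqrt_effectiveSize hγ, neg_div, Real.rpow_neg (le_of_lt hγ), div_inv_eq_mul, intercept, one_div,
    Real.log_inv]
  ring

lemma mul_numFirms_mul_numPeriods_le {γ : ℝ} (hγ : 0 < γ) :
    γ * (numFirms δ γ * numPeriods ζ γ) ≤ effectiveSize δ ζ γ := by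
  have h1 : (numFirms δ γ : ℝ) ≤ γ ^ (-δ) := Nat.floor_le (Real.rpow_nonneg hγ.le _)
  have h2 : (numPeriods ζ γ : ℝ) ≤ γ ^ (-ζ) := Nat.floor_le (Real.rpow_nonneg hγ.le _)
  calc γ * (numFirms δ γ * numPeriods ζ γ) ≤ γ * (γ ^ (-δ) * γ ^ (-ζ)) := by gcongr
    _ = _ := by
      rw [effectiveSize, ← Real.rpow_add hγ, mul_comm, ← Real.rpow_add_one hγ.ne']
      congr 1; ring

lemma tendsto_numPeriods (hζ : 0 < ζ) : Tendsto (numPeriods ζ) (𝓝[>] 0) atTop :=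
  tendsto_nat_floor_atTop.comp (tendsto_rpow_neg_nhdsGT_zero (by linarith))

/-- Up to a constant, the product bounds the expected number of defaults of one firm over the whole
window; hence the risk set is asymptotically everything. -/
lemma tendsto_numPeriods_mul (hζ : ζ < 1) :
    Tendsto (fun γ => numPeriods ζ γ * γ) (𝓝[>] 0) (𝓝 0) := by
  have h1 : Tendsto (fun γ : ℝ => γ ^ (1 - ζ)) (𝓝[>] 0) (𝓝 0) := by
    have : Tendsto (fun γ : ℝ => γ ^ (1 - ζ)) (𝓝 0) (𝓝 (0 ^ (1 - ζ))) :=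
      (Real.continuousAt_rpow_const 0 (1 - ζ) (Or.inr (by linarith))).tendsto
    rw [Real.zero_rpow (by linarith)] at this
    exact this.mono_left nhdsWithin_le_nhds
  refine squeeze_zero' ?_ ?_ h1
  · filter_upwards [self_mem_nhdsWithin] with γ hγ
    exact mul_nonneg (Nat.cast_nonneg _) (le_of_lt hγ)
  · filter_upwards [self_mem_nhdsWithin] with γ hγ
    have hγ' : 0 < γ := hγ
    calc numPeriods ζ γ * γ ≤ γ ^ (-ζ) * γ := by
          gcongr; exact Nat.floor_le (Real.rpow_nonneg hγ'.le _)
      _ = _ := by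
          rw [← Real.rpow_add_one hγ'.ne']; congr 1; ring

lemma tendsto_mul_numFirms_mul_numPeriods_div (hδ : 0 < δ) (hζ : 0 < ζ) :
    Tendsto (fun γ => γ * (numFirms δ γ * numPeriods ζ γ) / effectiveSize δ ζ γ) (𝓝[>] 0) (𝓝 1) := by
  have h1 := (tendsto_nat_floor_div_atTop (R := ℝ)).comp
    (tendsto_rpow_neg_nhdsGT_zero (show -δ < 0 by linarith))
  have h2 := (tendsto_nat_floor_div_atTop (R := ℝ)).comp
    (tendsto_rpow_neg_nhdsGT_zero (show -ζ < 0 by linarith))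
  have h3 := h1.mul h2
  rw [one_mul] at h3
  refine h3.congr' ?_
  filter_upwards [self_mem_nhdsWithin] with γ hγ
  have hγ' : 0 < γ := hγ
  have e : effectiveSize δ ζ γ = γ * γ ^ (-δ) * γ ^ (-ζ) := by
    rw [effectiveSize, mul_assoc, ← Real.rpow_add hγ', mul_comm, ← Real.rpow_add_one hγ'.ne']
    congr 1; ring
  have p1 := Real.rpow_pos_of_pos hγ' (-δ)
  have p2 := Real.rpow_pos_of_pos hγ' (-ζ)
  rw [e, Function.comp_apply, Function.comp_apply, numFirms, numPeriods]
  field_simp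

end Scaling

/-! ### Events of high probability -/

section Likely

variable {Ω : ℝ → Type*} [∀ γ, MeasurableSpace (Ω γ)] {P : ∀ γ, Measure (Ω γ)}

/-- The events `A γ` have, for all small enough `γ > 0`, probability at least `1 - ε`. -/
def LikelyUpTo (P : ∀ γ, Measure (Ω γ)) (ε : ℝ) (A : ∀ γ, Ω γ → Prop) : Prop :=
  ∀ᶠ γ in 𝓝[>] (0 : ℝ), (P γ).real {ω | ¬ A γ ω} ≤ ε

variable [∀ γ, IsProbabilityMeasure (P γ)] {A B : ∀ γ, Ω γ → Prop} {ε ε' : ℝ}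

lemma LikelyUpTo.mono (hA : LikelyUpTo P ε A) (h : ∀ᶠ γ in 𝓝[>] (0 : ℝ), ∀ ω, A γ ω → B γ ω) :
    LikelyUpTo P ε B := by
  filter_upwards [hA, h] with γ h1 h2
  refine (measureReal_mono (s₂ := {ω | ¬ A γ ω}) ?_).trans h1
  exact fun ω (hω : ¬ B γ ω) hA => hω (h2 ω hA)

lemma LikelyUpTo.and (hA : LikelyUpTo P ε A) (hB : LikelyUpTo P ε' B) :
    LikelyUpTo P (ε + ε') fun γ ω => A γ ω ∧ B γ ω := by
  filter_upwards [hA, hB] with γ h1 h2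
  refine (measureReal_mono (s₂ := {ω | ¬ A γ ω} ∪ {ω | ¬ B γ ω}) fun ω hω => ?_).trans
    ((measureReal_union_le _ _).trans (add_le_add h1 h2))
  by_cases hA : A γ ω
  · exact Or.inr fun hB => hω ⟨hA, hB⟩
  · exact Or.inl hA

/-- Union bound with ε divided among the events; the summand 1 in the denominator covers an empty
index type. -/
lemma LikelyUpTo.forall_fintype {κ : Type*} [Fintype κ] {A : κ → ∀ γ, Ω γ → Prop}
    (hA : ∀ k, ∀ ε > 0, LikelyUpTo P ε (A k)) (hε : 0 < ε) :
    LikelyUpTo P ε fun γ ω => ∀ k, A k γ ω := by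
  have hc : (0 : ℝ) < Fintype.card κ + 1 := by positivity
  have h : ∀ᶠ γ in 𝓝[>] (0 : ℝ), ∀ k, (P γ).real {ω | ¬ A k γ ω} ≤ ε / (Fintype.card κ + 1) :=
    eventually_all.2 fun k => hA k _ (by positivity)
  filter_upwards [h] with γ h1
  refine (measureReal_mono (s₂ := ⋃ k, {ω | ¬ A k γ ω}) fun ω hω => ?_).trans
    ((measureReal_iUnion_fintype_le _).trans ?_)
  · simpa using hω
  · refine (Finset.sum_le_card_nsmul _ _ _ fun k _ => h1 k).trans ?_
    rw [Finset.card_univ, nsmul_eq_mul, mul_div_assoc', div_le_iff₀ hc]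
    nlinarith

end Likely

/-! ### Weak convergence through characteristic functions -/

section WeakConvergence

variable {E : Type*} [NormedAddCommGroup E] [InnerProductSpace ℝ E] [FiniteDimensional ℝ E]
  [MeasurableSpace E] [BorelSpace E] {ι : Type*} {l : Filter ι} {Ω : ι → Type*}
  [∀ i, MeasurableSpace (Ω i)] {P : ∀ i, Measure (Ω i)} [∀ i, IsProbabilityMeasure (P i)]
  {X : ∀ i, Ω i → E} {ν : Measure E} [IsProbabilityMeasure ν]

/-- Lévy's theorem for sequences; a countably generated filter is tested by sequences. -/
lemma tendstoInDistribution_of_tendsto_charFun [l.IsCountablyGenerated]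
    (hX : ∀ i, AEMeasurable (X i) (P i))
    (h : ∀ ξ, Tendsto (fun i => ∫ ω, Complex.exp (⟪X i ω, ξ⟫ * Complex.I) ∂(P i)) l
      (𝓝 (charFun ν ξ))) : TendstoInDistribution X l id P ν where
  forall_aemeasurable := hX
  aemeasurable_limit := aemeasurable_id
  tendsto := by
    refine tendsto_of_seq_tendsto fun u hu => ?_
    refine ProbabilityMeasure.tendsto_of_tendsto_charFun fun ξ => ?_
    have h1 := (h ξ).comp hu
    simp only [Function.comp_def, ProbabilityMeasure.coe_mk, Measure.map_id] at h1 ⊢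
    refine h1.congr fun i => ?_
    rw [charFun_apply]
    exact (integral_map (f := fun x => Complex.exp (⟪x, ξ⟫ * Complex.I)) (hX (u i))
      (by fun_prop)).symm

/-- A single limit law is tight, and the portmanteau theorem for closed sets carries the tail bound
over to the converging laws. -/
lemma _root_.MeasureTheory.TendstoInDistribution.exists_norm_le
    (h : TendstoInDistribution X l id P ν) {ε : ℝ} (hε : 0 < ε) :
    ∃ M > 0, ∀ᶠ i in l, (P i).real {ω | M < ‖X i ω‖} < ε := by
  have ht := tendsto_measure_norm_gt_of_isTightMeasureSet
    (isTightMeasureSet_singleton (μ := ν))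
  simp only [Set.mem_singleton_iff, iSup_iSup_eq_left] at ht
  obtain ⟨M, hM, hM0⟩ := ((ht.eventually_lt_const (ENNReal.ofReal_pos.2 hε)).and
    (eventually_gt_atTop 0)).exists
  refine ⟨M + 1, by positivity, ?_⟩
  have hcl : IsClosed {x : E | M + 1 ≤ ‖x‖} := isClosed_le continuous_const continuous_norm
  have hls := ProbabilityMeasure.limsup_measure_closed_le_of_tendsto h.tendsto hcl
  simp only [ProbabilityMeasure.coe_mk, Measure.map_id] at hls
  have hlt : ν {x : E | M + 1 ≤ ‖x‖} < ENNReal.ofReal ε :=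
    (measure_mono fun x (hx : M + 1 ≤ ‖x‖) => show M < ‖x‖ by linarith).trans_lt hM
  filter_upwards [eventually_lt_of_limsup_lt (hls.trans_lt hlt)] with i hi
  rw [Measure.map_apply_of_aemeasurable (h.forall_aemeasurable i) hcl.measurableSet] at hi
  rw [measureReal_def, ← ENNReal.toReal_ofReal hε.le]
  refine ENNReal.toReal_strict_mono ENNReal.ofReal_ne_top (lt_of_le_of_lt (measure_mono ?_) hi)
  intro ω hω
  exact (show M + 1 < ‖X i ω‖ from hω).le

end WeakConvergence

/-! ### The sample is regular with high probability -/

section DefaultFamily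

/-- The firms and periods at risk. -/
def riskSet {Ω : Type*} (m T : ℕ) (D : ℕ → ℕ → Ω → ℝ) (ω : Ω) : Finset (ℕ × ℕ) :=
  (cells m T).filter fun p => p.2 ≤ lastTime T D p.1 ω

lemma mem_riskSet {Ω : Type*} {m T : ℕ} {D : ℕ → ℕ → Ω → ℝ} {ω : Ω} {p : ℕ × ℕ} :
    p ∈ riskSet m T D ω ↔ p ∈ cells m T ∧ p.2 ≤ lastTime T D p.1 ω := Finset.mem_filter

lemma riskSet_subset {Ω : Type*} {m T : ℕ} {D : ℕ → ℕ → Ω → ℝ} {ω : Ω} :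
    riskSet m T D ω ⊆ cells m T := Finset.filter_subset _ _

/-- The models of the theorem, indexed by the rarity parameter `γ`. -/
structure IsDefaultFamily {d : ℕ} (S : Matrix (Fin d) (Fin d) ℝ) (β : EuclideanSpace ℝ (Fin d))
    (δ ζ : ℝ) (q : ℝ → ℝ) (C x₁ K ρ : ℝ) {Ω : ℝ → Type*} [∀ γ, MeasurableSpace (Ω γ)]
    (P : ∀ γ, Measure (Ω γ)) (V : ∀ γ, ℕ → ℕ → Ω γ → EuclideanSpace ℝ (Fin d))
    (D : ∀ γ, ℕ → ℕ → Ω γ → ℝ) : Prop where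
  posDef : S.PosDef
  firms_pos : 0 < δ
  periods_pos : 0 < ζ
  periods_lt : ζ < 1
  one_lt : 1 < δ + ζ
  link : IsExpLike q C x₁
  decay_pos : 0 < ρ
  decay_lt : ρ < 1
  covariates : ∀ γ, 0 < γ → γ < 1 →
    IsCovariateProcess (P γ) (numFirms δ γ) (numPeriods ζ γ) S K ρ (V γ)
  defaults : ∀ γ, 0 < γ → γ < 1 →
    IsDefaultProcess (P γ) (numFirms δ γ) (numPeriods ζ γ) q β (intercept γ) (V γ) (D γ)

variable {d : ℕ} {S : Matrix (Fin d) (Fin d) ℝ} {β : EuclideanSpace ℝ (Fin d)}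
  {δ ζ : ℝ} {q : ℝ → ℝ} {C x₁ K ρ : ℝ} {Ω : ℝ → Type*} [∀ γ, MeasurableSpace (Ω γ)]
  {P : ∀ γ, Measure (Ω γ)} {V : ∀ γ, ℕ → ℕ → Ω γ → EuclideanSpace ℝ (Fin d)}
  {D : ∀ γ, ℕ → ℕ → Ω γ → ℝ} [∀ γ, IsProbabilityMeasure (P γ)]
  {g f : EuclideanSpace ℝ (Fin d) → ℝ} {ε η : ℝ}

namespace IsDefaultFamily

lemma likely_abs_sum_cells_sub_le (h : IsDefaultFamily S β δ ζ q C x₁ K ρ P V D)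
    (hg : MemLp g 2 (multivariateGaussian 0 S)) (hη : 0 < η) (hε : 0 < ε) :
    LikelyUpTo P ε fun γ ω => |γ * ∑ p ∈ cells (numFirms δ γ) (numPeriods ζ γ), g (V γ p.1 p.2 ω) -
      effectiveSize δ ζ γ * ∫ v, g v ∂(multivariateGaussian 0 S)| ≤ η * effectiveSize δ ζ γ := by
  set G := ∫ v, g v ∂(multivariateGaussian 0 S) with hG
  -- Chebyshev's inequality at level η/2 then gives exactly ε. The other half of η pays for
  -- replacing γ m T by n, which is needed because of the integer parts.
  obtain ⟨T₀, hT₀⟩ := exists_integral_sum_sub_sq_le h.posDef.posSemidef h.decay_pos h.decay_lt K hg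
    (ε := ε * (η / 2) ^ 2) (by positivity)
  have hr := tendsto_mul_numFirms_mul_numPeriods_div h.firms_pos h.periods_pos
  have hr2 : Tendsto (fun γ => |γ * (numFirms δ γ * numPeriods ζ γ) / effectiveSize δ ζ γ - 1| * |G|)
      (𝓝[>] 0) (𝓝 0) := by
    simpa using ((hr.sub_const 1).abs.mul_const |G|)
  filter_upwards [eventually_pos_lt_one, (tendsto_numPeriods h.periods_pos).eventually_ge_atTop T₀,
    hr.eventually_const_lt zero_lt_one, hr2.eventually_le_const (half_pos hη)] with γ hγ hT hpos hdev
  have hV := h.covariates γ hγ.1 hγ.2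
  have hn : 0 < effectiveSize δ ζ γ := effectiveSize_pos hγ.1
  have key := hT₀ hV hT
  set m := numFirms δ γ
  set T := numPeriods ζ γ
  set n := effectiveSize δ ζ γ
  have hN : (0 : ℝ) < m * T := by
    rw [div_pos_iff_of_pos_right hn] at hpos
    exact pos_of_mul_pos_right hpos hγ.1.le
  have hmem : MemLp (fun ω => ∑ p ∈ cells m T, g (V γ p.1 p.2 ω) - m * T * G) 2 (P γ) := by
    refine MemLp.sub (memLp_finsetSum _ fun p hp => ?_) (memLp_const _)
    exact hg.comp_measurePreserving (hV.measurePreserving (mem_cells.1 hp).1 (mem_cells.1 hp).2)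
  refine (measureReal_mono (s₂ := {ω | (η / 2 * (m * T)) ^ 2 ≤
    (∑ p ∈ cells m T, g (V γ p.1 p.2 ω) - m * T * G) ^ 2}) ?_).trans
    ((measureReal_ge_le_of_integral_le hmem.integrable_sq (ae_of_all _ fun _ => sq_nonneg _)
      (by positivity) key).trans (le_of_eq ?_))
  · intro ω hω
    by_contra hlt
    refine hω ?_
    have hlt' : |∑ p ∈ cells m T, g (V γ p.1 p.2 ω) - m * T * G| ≤ η / 2 * (m * T) := by
      rw [Set.mem_ofPred_eq, not_le] at hlt
      exact abs_le_of_sq_le_sq hlt.le (by positivity)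
    have e : γ * ∑ p ∈ cells m T, g (V γ p.1 p.2 ω) - n * G =
        γ * (∑ p ∈ cells m T, g (V γ p.1 p.2 ω) - m * T * G) + n * ((γ * (m * T) / n - 1) * G) := by
      field_simp; ring
    rw [e]
    refine (abs_add_le _ _).trans ?_
    rw [abs_mul, abs_mul, abs_mul, abs_of_pos hγ.1, abs_of_pos hn]
    have h1 : γ * (m * T) ≤ n := mul_numFirms_mul_numPeriods_le hγ.1
    have h2 : γ * |∑ p ∈ cells m T, g (V γ p.1 p.2 ω) - m * T * G| ≤ η / 2 * n := by
      calc _ ≤ γ * (η / 2 * (m * T)) := by gcongr; exact hγ.1.le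
        _ = η / 2 * (γ * (m * T)) := by ring
        _ ≤ _ := by gcongr
    have h3 : n * (|γ * (m * T) / n - 1| * |G|) ≤ n * (η / 2) := by gcongr
    linarith
  · rw [mul_assoc, ← mul_pow, mul_div_cancel_right₀ _ (by positivity)]

lemma likely_sum_not_atRisk_le (h : IsDefaultFamily S β δ ζ q C x₁ K ρ P V D)
    (hf : MemLp f 2 (multivariateGaussian 0 S)) (hf0 : ∀ v, 0 ≤ f v) (hη : 0 < η) (hε : 0 < ε) :
    LikelyUpTo P ε fun γ ω => γ * ∑ p ∈ cells (numFirms δ γ) (numPeriods ζ γ),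
      (if p.2 ≤ lastTime (numPeriods ζ γ) (D γ) p.1 ω then 0 else f (V γ p.1 p.2 ω)) ≤
      η * effectiveSize δ ζ γ := by
  set G := ∫ v, f v ^ 2 ∂(multivariateGaussian 0 S) with hG
  have hG0 : 0 ≤ G := integral_nonneg fun _ => sq_nonneg _
  set M := C * ∫ v, Real.exp ⟪β, v⟫ ∂(multivariateGaussian 0 S) with hM
  -- With this θ the square term costs at most half of the allowed ε η; the other term carries the
  -- factor T γ → 0.
  set θ := ε * η / (G + 1) with hθ
  have hθ0 : 0 < θ := by positivity
  have h1 : Tendsto (fun γ => numPeriods ζ γ * γ * M / (2 * θ)) (𝓝[>] 0) (𝓝 0) := by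
    simpa using ((tendsto_numPeriods_mul h.periods_lt).mul_const M).div_const (2 * θ)
  filter_upwards [eventually_pos_lt_one, h1.eventually_le_const (show 0 < ε * η / 2 by positivity)]
    with γ hγ hle
  have hn : 0 < effectiveSize δ ζ γ := effectiveSize_pos hγ.1
  have hN := mul_numFirms_mul_numPeriods_le (δ := δ) (ζ := ζ) hγ.1
  set n := effectiveSize δ ζ γ
  have key := (h.defaults γ hγ.1 hγ.2).measureReal_sum_not_atRisk_ge_le
    (h.covariates γ hγ.1 hγ.2) h.link hf hf0 (x := η * n / γ) (div_pos (by positivity) hγ.1) hθ0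
  rw [exp_neg_intercept hγ.1, ← hG, ← hM] at key
  refine (measureReal_mono ?_).trans (key.trans ?_)
  · intro ω hω
    rw [Set.mem_ofPred_eq, not_le] at hω
    rw [Set.mem_ofPred_eq, div_le_iff₀' hγ.1]
    exact hω.le
  · have h2 : θ / 2 * G ≤ ε * η / 2 := by
      rw [hθ]
      have : G / (G + 1) ≤ 1 := (div_le_one (by positivity)).2 (by linarith)
      calc ε * η / (G + 1) / 2 * G = ε * η / 2 * (G / (G + 1)) := by ring
        _ ≤ ε * η / 2 * 1 := by gcongr
        _ = _ := mul_one _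
    rw [div_le_iff₀ (div_pos (by positivity) hγ.1)]
    calc _ ≤ numFirms δ γ * numPeriods ζ γ * (ε * η / 2 + ε * η / 2) := by gcongr
      _ = ε * η * (γ * (numFirms δ γ * numPeriods ζ γ)) / γ := by field_simp [hγ.1.ne']; ring
      _ ≤ ε * η * n / γ := by have := hγ.1; gcongr
      _ = _ := by ring

/-- Law of large numbers over the firms at risk. -/
lemma likely_abs_sum_riskSet_sub_le (h : IsDefaultFamily S β δ ζ q C x₁ K ρ P V D)
    (hg : MemLp g 2 (multivariateGaussian 0 S)) (hη : 0 < η) (hε : 0 < ε) :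
    LikelyUpTo P ε fun γ ω => |γ * ∑ p ∈ riskSet (numFirms δ γ) (numPeriods ζ γ) (D γ) ω,
        g (V γ p.1 p.2 ω) - effectiveSize δ ζ γ * ∫ v, g v ∂(multivariateGaussian 0 S)| ≤
      η * effectiveSize δ ζ γ := by
  have h1 := h.likely_abs_sum_cells_sub_le hg (half_pos hη) (half_pos hε)
  have h2 := h.likely_sum_not_atRisk_le hg.abs (fun v => abs_nonneg _) (half_pos hη) (half_pos hε)
  have h3 := h1.and h2
  rw [add_halves] at h3
  refine h3.mono ?_
  filter_upwards [eventually_pos_lt_one] with γ hγ ω ⟨h4, h5⟩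
  set m := numFirms δ γ
  set T := numPeriods ζ γ
  set n := effectiveSize δ ζ γ
  have e : ∑ p ∈ riskSet m T (D γ) ω, g (V γ p.1 p.2 ω) = ∑ p ∈ cells m T, g (V γ p.1 p.2 ω) -
      ∑ p ∈ cells m T, (if p.2 ≤ lastTime T (D γ) p.1 ω then 0 else g (V γ p.1 p.2 ω)) := by
    rw [riskSet, Finset.sum_filter, ← Finset.sum_sub_distrib]
    exact Finset.sum_congr rfl fun p _ => by split_ifs <;> simp
  have h6 : |γ * ∑ p ∈ cells m T, (if p.2 ≤ lastTime T (D γ) p.1 ω then 0 else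
      g (V γ p.1 p.2 ω))| ≤ η / 2 * n := by
    rw [abs_mul, abs_of_pos hγ.1]
    refine le_trans ?_ h5
    have := hγ.1
    gcongr
    refine (Finset.abs_sum_le_sum_abs _ _).trans (Finset.sum_le_sum fun p _ => ?_)
    split_ifs <;> simp
  rw [e, mul_sub]
  rw [abs_le] at h4 h6 ⊢
  constructor <;> linarith [h4.1, h4.2, h6.1, h6.2]

/-- Only Markov's inequality is used here, so the constant depends on ε. -/
lemma likely_sum_default_le (h : IsDefaultFamily S β δ ζ q C x₁ K ρ P V D) (c : ℝ) (hε : 0 < ε) :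
    ∃ C₁ ≥ 0, LikelyUpTo P ε fun γ ω => ∑ p ∈ riskSet (numFirms δ γ) (numPeriods ζ γ) (D γ) ω with
      D γ p.1 p.2 ω = 1, Real.exp (c * ‖V γ p.1 p.2 ω‖) ≤ C₁ * effectiveSize δ ζ γ := by
  set f : EuclideanSpace ℝ (Fin d) → ℝ := fun v => Real.exp (c * ‖v‖)
  have hf : Integrable f (multivariateGaussian 0 S) := integrable_exp_mul_norm _ c
  have hef : Integrable (fun v => Real.exp ⟪β, v⟫ * f v) (multivariateGaussian 0 S) := by
    refine (integrable_exp_mul_norm _ (‖β‖ + c)).mono' (by fun_prop) (ae_of_all _ fun v => ?_)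
    rw [Real.norm_eq_abs, ← Real.exp_add, Real.abs_exp]
    apply Real.exp_le_exp.2
    linarith [real_inner_le_norm β v]
  set M := C * ∫ v, Real.exp ⟪β, v⟫ * f v ∂(multivariateGaussian 0 S) with hM
  have hC := h.link.one_le
  have hM0 : 0 ≤ M := mul_nonneg (by linarith) (integral_nonneg fun v => by positivity)
  refine ⟨(M + 1) / ε, by positivity, ?_⟩
  filter_upwards [eventually_pos_lt_one] with γ hγ
  have hn : 0 < effectiveSize δ ζ γ := effectiveSize_pos hγ.1
  have hN := mul_numFirms_mul_numPeriods_le (δ := δ) (ζ := ζ) hγ.1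
  have hD := h.defaults γ hγ.1 hγ.2
  set n := effectiveSize δ ζ γ
  have key := hD.measureReal_sum_default_ge_le (h.covariates γ hγ.1 hγ.2) h.link (f := f)
    (by fun_prop) hf (fun v => (Real.exp_pos _).le) hef (x := (M + 1) / ε * n) (by positivity)
  refine (measureReal_mono ?_).trans (key.trans ?_)
  · intro ω hω
    rw [Set.mem_ofPred_eq, not_le] at hω
    refine hω.le.trans ?_
    rw [riskSet, Finset.filter_filter]
    calc _ = ∑ p ∈ cells (numFirms δ γ) (numPeriods ζ γ) with
          (p.2 ≤ lastTime (numPeriods ζ γ) (D γ) p.1 ω ∧ D γ p.1 p.2 ω = 1),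
          D γ p.1 p.2 ω * f (V γ p.1 p.2 ω) := by
          refine Finset.sum_congr rfl fun p hp => ?_
          rw [(Finset.mem_filter.1 hp).2.2, one_mul]
      _ ≤ _ := by
          refine Finset.sum_le_sum_of_subset_of_nonneg (Finset.filter_subset _ _) fun p hp _ => ?_
          have hp' := mem_cells.1 hp
          rcases hD.zero_or_one _ hp'.1 _ hp'.2 ω with h0 | h0 <;> rw [h0]
          · simp
          · rw [one_mul]; exact (Real.exp_pos _).le
  · rw [exp_neg_intercept hγ.1, div_le_iff₀ (by positivity)]
    calc _ = γ * (numFirms δ γ * numPeriods ζ γ) * M := by rw [hM]; ring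
      _ ≤ n * (M + 1) := by gcongr; linarith
      _ = _ := by field_simp

/-- This bound comes from the law of large numbers, so one constant serves all ε. -/
lemma likely_sum_riskSet_exp_le (h : IsDefaultFamily S β δ ζ q C x₁ K ρ P V D) (c : ℝ) :
    ∃ C₁ ≥ 0, ∀ ε > 0, LikelyUpTo P ε fun γ ω =>
      Real.exp (-intercept γ) * ∑ p ∈ riskSet (numFirms δ γ) (numPeriods ζ γ) (D γ) ω,
        Real.exp (c * ‖V γ p.1 p.2 ω‖) ≤ C₁ * effectiveSize δ ζ γ := by
  have hg : MemLp (fun v : EuclideanSpace ℝ (Fin d) => Real.exp (c * ‖v‖)) 2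
      (multivariateGaussian 0 S) :=
    memLp_two_of_le_exp _ (by fun_prop) (A := 1) (c := c) fun v => by simp
  refine ⟨∫ v, Real.exp (c * ‖v‖) ∂(multivariateGaussian 0 S) + 1,
    add_nonneg (integral_nonneg fun v => (Real.exp_pos _).le) zero_le_one, fun ε hε => ?_⟩
  refine (h.likely_abs_sum_riskSet_sub_le hg one_pos hε).mono ?_
  filter_upwards [eventually_pos_lt_one] with γ hγ ω hω
  rw [exp_neg_intercept hγ.1]
  linarith [(abs_le.1 hω).2]

lemma likely_norm_le (h : IsDefaultFamily S β δ ζ q C x₁ K ρ P V D) (r : ℝ) (hε : 0 < ε) :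
    LikelyUpTo P ε fun γ ω => ∀ p ∈ cells (numFirms δ γ) (numPeriods ζ γ),
      r * ‖V γ p.1 p.2 ω‖ ≤ intercept γ / 2 := by
  -- A violation in one cell makes e^{k‖V‖} exceed γ^{-(δ+ζ+1)}. There are at most γ^{-(δ+ζ)} cells
  -- with a common finite mean, so the union has probability O(γ).
  set k := 2 * r * (δ + ζ + 1) with hk
  set M := ∫ v : EuclideanSpace ℝ (Fin d), Real.exp (k * ‖v‖) ∂(multivariateGaussian 0 S) with hM
  have hM0 : 0 ≤ M := integral_nonneg fun v => (Real.exp_pos _).le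
  have hlim : Tendsto (fun γ : ℝ => γ * M) (𝓝[>] 0) (𝓝 0) := by
    have : Tendsto (fun γ : ℝ => γ * M) (𝓝 0) (𝓝 (0 * M)) := tendsto_id.mul_const M
    rw [zero_mul] at this
    exact this.mono_left nhdsWithin_le_nhds
  have hone := h.one_lt
  filter_upwards [eventually_pos_lt_one, hlim.eventually_le_const hε] with γ hγ hle
  have hγ' := hγ.1
  have hx : 0 < Real.exp ((δ + ζ + 1) * intercept γ) := Real.exp_pos _
  have key := (h.covariates γ hγ.1 hγ.2).measureReal_sum_ge_le
    (integrable_exp_mul_norm (multivariateGaussian 0 S) k) (fun v => (Real.exp_pos _).le) hx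
  refine (measureReal_mono ?_).trans (key.trans (le_trans ?_ hle))
  · intro ω hω
    rw [Set.mem_ofPred_eq] at hω
    push Not at hω
    obtain ⟨p, hp, hlt⟩ := hω
    refine le_trans ?_ (Finset.single_le_sum (f := fun p : ℕ × ℕ => Real.exp (k * ‖V γ p.1 p.2 ω‖))
      (fun p _ => (Real.exp_pos _).le) hp)
    apply Real.exp_le_exp.2
    rw [hk]
    nlinarith
  · have e : Real.exp ((δ + ζ + 1) * intercept γ) = effectiveSize δ ζ γ / γ / γ := by
      have : effectiveSize δ ζ γ / γ / γ = γ ^ (-(δ + ζ + 1)) := by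
        rw [effectiveSize, ← Real.rpow_sub_one hγ'.ne', ← Real.rpow_sub_one hγ'.ne']
        congr 1; ring
      rw [this, Real.rpow_def_of_pos hγ', intercept, one_div, Real.log_inv]
      congr 1; ring
    have hn : 0 < effectiveSize δ ζ γ := effectiveSize_pos hγ'
    have hN := mul_numFirms_mul_numPeriods_le (δ := δ) (ζ := ζ) hγ'
    rw [e, div_le_iff₀ (by positivity)]
    calc _ = γ * (numFirms δ γ * numPeriods ζ γ) * (M / γ) := by rw [← hM]; field_simp
      _ ≤ effectiveSize δ ζ γ * (M / γ) := by gcongr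
      _ = _ := by field_simp

lemma memLp_indicator_signBox {s : ℝ} (o : Fin d → Bool) :
    MemLp ((signBox s o).indicator fun _ => (1 : ℝ)) 2 (multivariateGaussian 0 S) :=
  (memLp_const 1).indicator (isOpen_signBox s o).measurableSet

lemma integral_indicator_signBox {s : ℝ} (o : Fin d → Bool) :
    ∫ v, (signBox s o).indicator (fun _ => (1 : ℝ)) v ∂(multivariateGaussian 0 S) =
      (multivariateGaussian 0 S).real (signBox s o) :=
  integral_indicator_one (isOpen_signBox s o).measurableSet

lemma exists_le_measureReal_signBox (hS : S.PosDef) {s : ℝ} (hs : 0 < s) :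
    ∃ c > 0, ∀ o : Fin d → Bool, c ≤ (multivariateGaussian 0 S).real (signBox s o) := by
  obtain ⟨o, ho⟩ := Finite.exists_min fun o : Fin d → Bool =>
    (multivariateGaussian 0 S).real (signBox s o)
  exact ⟨_, signBox_measureReal_pos hS hs o, ho⟩

/-- The law of large numbers counts all pairs at risk in a box; the defaults among them are O(n),
and become negligible after multiplication by γ. -/
lemma likely_survival_box (h : IsDefaultFamily S β δ ζ q C x₁ K ρ P V D) {s : ℝ} (hs : 0 < s) :
    ∃ c₂ > 0, ∀ ε > 0, LikelyUpTo P ε fun γ ω => ∀ o : Fin d → Bool, c₂ * effectiveSize δ ζ γ ≤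
      Real.exp (-intercept γ) * ∑ p ∈ riskSet (numFirms δ γ) (numPeriods ζ γ) (D γ) ω with
        ¬ D γ p.1 p.2 ω = 1, (signBox s o).indicator (fun _ => (1 : ℝ)) (V γ p.1 p.2 ω) := by
  obtain ⟨c, hc, hco⟩ := exists_le_measureReal_signBox h.posDef hs
  refine ⟨c / 4, by positivity, fun ε hε => LikelyUpTo.forall_fintype (fun o ε hε => ?_) hε⟩
  -- With exponent 0 the sum merely counts the defaults.
  obtain ⟨C₁, hC₁, hD⟩ := h.likely_sum_default_le 0 (half_pos hε)
  have h3 := (h.likely_abs_sum_riskSet_sub_le (memLp_indicator_signBox (s := s) o)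
    (half_pos hc) (half_pos hε)).and hD
  rw [add_halves] at h3
  refine h3.mono ?_
  have hlim : Tendsto (fun γ : ℝ => γ * C₁) (𝓝[>] 0) (𝓝 0) := by
    have : Tendsto (fun γ : ℝ => γ * C₁) (𝓝 0) (𝓝 (0 * C₁)) := tendsto_id.mul_const C₁
    rw [zero_mul] at this
    exact this.mono_left nhdsWithin_le_nhds
  filter_upwards [eventually_pos_lt_one, hlim.eventually_le_const (show 0 < c / 4 by positivity)]
    with γ hγ hle ω ⟨h4, h5⟩
  have hγ' := hγ.1
  have hn : 0 < effectiveSize δ ζ γ := effectiveSize_pos hγ'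
  rw [exp_neg_intercept hγ']
  rw [integral_indicator_signBox] at h4
  set R := riskSet (numFirms δ γ) (numPeriods ζ γ) (D γ) ω
  set n := effectiveSize δ ζ γ
  have e := Finset.sum_filter_add_sum_filter_not R (fun p => D γ p.1 p.2 ω = 1)
    fun p => (signBox s o).indicator (fun _ => (1 : ℝ)) (V γ p.1 p.2 ω)
  have h6 : ∑ p ∈ R with D γ p.1 p.2 ω = 1,
      (signBox s o).indicator (fun _ => (1 : ℝ)) (V γ p.1 p.2 ω) ≤ C₁ * n := by
    refine (Finset.sum_le_sum fun p _ => ?_).trans h5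
    rw [zero_mul, Real.exp_zero]
    exact Set.indicator_le_self' (fun _ _ => zero_le_one) _
  have h7 := (abs_le.1 h4).1
  have h8 : γ * (C₁ * n) ≤ c / 4 * n := by rw [← mul_assoc]; gcongr
  have h9 : n * c ≤ n * (multivariateGaussian 0 S).real (signBox s o) := by gcongr; exact hco o
  have h10 := mul_le_mul_of_nonneg_left h6 hγ'.le
  rw [← e, mul_add] at h7
  linarith

lemma likely_default_box (h : IsDefaultFamily S β δ ζ q C x₁ K ρ P V D) :
    ∃ c₁ > 0, ∀ ε > 0, LikelyUpTo P ε fun γ ω => ∀ o : Fin d → Bool, c₁ * effectiveSize δ ζ γ ≤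
      ∑ p ∈ riskSet (numFirms δ γ) (numPeriods ζ γ) (D γ) ω with
        D γ p.1 p.2 ω = 1, (signBox 1 o).indicator (fun _ => (1 : ℝ)) (V γ p.1 p.2 ω) := by
  obtain ⟨c, hc, hco⟩ := exists_le_measureReal_signBox h.posDef one_pos
  -- In the box the hazard is at least kγ, so the compensator exceeds k c n/2 = 4 c₁ n. Fewer than
  -- c₁ n defaults then have probability at most e^{c₁n - 2c₁n}, which explains the 8 in c₁.
  set k := Real.exp (-(‖β‖ * (2 * d))) / 2 with hk
  have hk0 : 0 < k := by positivity
  set c₁ := k * c / 8 with hc₁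
  have hc₁0 : 0 < c₁ := by positivity
  refine ⟨c₁, hc₁0, fun ε hε => LikelyUpTo.forall_fintype (fun o ε hε => ?_) hε⟩
  have h1 := h.likely_abs_sum_riskSet_sub_le (memLp_indicator_signBox (s := 1) o)
    (half_pos hc) (half_pos hε)
  have hlim : Tendsto (fun γ => Real.exp (-(c₁ * effectiveSize δ ζ γ))) (𝓝[>] 0) (𝓝 0) :=
    Real.tendsto_exp_neg_atTop_nhds_zero.comp
      ((tendsto_effectiveSize h.one_lt).const_mul_atTop hc₁0)
  filter_upwards [eventually_pos_lt_one, h1, hlim.eventually_le_const (half_pos hε),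
    tendsto_intercept.eventually_ge_atTop (‖β‖ * (2 * d) - x₁)] with γ hγ h2 h3 h4
  have hγ' := hγ.1
  have hn : 0 < effectiveSize δ ζ γ := effectiveSize_pos hγ'
  have hD := h.defaults γ hγ.1 hγ.2
  set m := numFirms δ γ
  set T := numPeriods ζ γ
  set n := effectiveSize δ ζ γ
  have key := hD.measureReal_sum_default_le (h.covariates γ hγ.1 hγ.2) h.link
    (isOpen_signBox 1 o).measurableSet (4 * c₁ * n) (c₁ * n)
  rw [show c₁ * n - 4 * c₁ * n / 2 = -(c₁ * n) by ring] at key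
  rw [integral_indicator_signBox] at h2
  rw [← add_halves ε]
  refine (measureReal_mono ?_).trans ((measureReal_union_le _ _).trans
    (add_le_add (key.trans h3) h2))
  intro ω hω
  rw [Set.mem_ofPred_eq, not_le] at hω
  by_contra hnot
  rw [Set.mem_union, not_or] at hnot
  obtain ⟨n1, n2⟩ := hnot
  rw [Set.mem_ofPred_eq, not_not] at n2
  refine n1 ⟨?_, ?_⟩
  · refine le_trans (le_of_eq ?_) hω.le
    rw [riskSet, Finset.filter_filter, ← Finset.sum_filter]
    rw [← Finset.filter_filter, Finset.sum_filter (p := fun p : ℕ × ℕ => D γ p.1 p.2 ω = 1)]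
    refine Finset.sum_congr rfl fun p hp => ?_
    have hp' := mem_cells.1 (Finset.mem_filter.1 hp).1
    rcases hD.zero_or_one _ hp'.1 _ hp'.2 ω with h0 | h0 <;> simp [h0]
  · have h5 := (abs_le.1 n2).1
    have h9 : n * c ≤ n * (multivariateGaussian 0 S).real (signBox 1 o) := by gcongr; exact hco o
    calc 4 * c₁ * n = k * (n * c / 2) := by rw [hc₁]; ring
      _ ≤ k * (γ * ∑ p ∈ riskSet m T (D γ) ω,
          (signBox 1 o).indicator (fun _ => (1 : ℝ)) (V γ p.1 p.2 ω)) := by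
          gcongr; linarith
      _ = ∑ p ∈ riskSet m T (D γ) ω, k * γ *
          (signBox 1 o).indicator (fun _ => (1 : ℝ)) (V γ p.1 p.2 ω) := by
          rw [← mul_assoc, Finset.mul_sum]
      _ ≤ ∑ p ∈ riskSet m T (D γ) ω, hazard T q β (intercept γ) (V γ) (D γ) p.1 p.2 ω *
          (signBox 1 o).indicator (fun _ => (1 : ℝ)) (V γ p.1 p.2 ω) := by
          refine Finset.sum_le_sum fun p hp => ?_
          by_cases hv : V γ p.1 p.2 ω ∈ signBox 1 o
          · rw [Set.indicator_of_mem hv, mul_one, mul_one, hazard, if_pos (mem_riskSet.1 hp).2]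
            have h6 := norm_le_of_mem_signBox one_pos hv
            have h7 : ‖β‖ * ‖V γ p.1 p.2 ω‖ ≤ ‖β‖ * (2 * d) := by
              rw [mul_one] at h6; gcongr
            have h8 := abs_le.1 (abs_real_inner_le_norm β (V γ p.1 p.2 ω))
            refine le_trans ?_ (h.link.lower _ (by linarith [h8.2]))
            rw [hk, div_mul_eq_mul_div, sub_eq_add_neg, Real.exp_add, exp_neg_intercept hγ']
            gcongr
            linarith [h8.1]
          · simp [hv]
      _ ≤ _ := Finset.sum_le_sum_of_subset_of_nonneg riskSet_subset fun p _ _ =>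
          mul_nonneg (hazard_nonneg h.link _ _ _) (Set.indicator_nonneg (fun _ _ => zero_le_one) _)

lemma memLp_exp_inner_mul_coord (k l : Fin d) :
    MemLp (fun v : EuclideanSpace ℝ (Fin d) => Real.exp ⟪β, v⟫ * (v k * v l)) 2
      (multivariateGaussian 0 S) := by
  refine memLp_two_of_le_exp _ (by fun_prop) (A := 1) (c := ‖β‖ + 2) fun v => ?_
  have h1 : ∀ j, |v j| ≤ Real.exp ‖v‖ := fun j =>
    (PiLp.norm_apply_le v j).trans (norm_le_exp_norm v)
  rw [abs_mul, abs_mul, Real.abs_exp, one_mul,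
    show (‖β‖ + 2) * ‖v‖ = ‖β‖ * ‖v‖ + (‖v‖ + ‖v‖) by ring, Real.exp_add, Real.exp_add]
  gcongr
  · exact real_inner_le_norm β v
  · exact h1 k
  · exact h1 l

lemma inner_sq_eq_sum (u v : EuclideanSpace ℝ (Fin d)) :
    ⟪u, v⟫ ^ 2 = ∑ k, ∑ l, u k * u l * (v k * v l) := by
  rw [PiLp.inner_apply, pow_two, Finset.sum_mul_sum]
  refine Finset.sum_congr rfl fun k _ => Finset.sum_congr rfl fun l _ => ?_
  simp only [RCLike.inner_apply, conj_trivial]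
  ring

/-- A quadratic form in u is determined by its d² coefficients, so finitely many laws of large
numbers give uniformity in u. -/
lemma likely_quadratic (h : IsDefaultFamily S β δ ζ q C x₁ K ρ P V D) {κ : ℝ} (hκ : 0 < κ)
    (hε : 0 < ε) :
    LikelyUpTo P ε fun γ ω => ∀ u : EuclideanSpace ℝ (Fin d),
      |∑ p ∈ riskSet (numFirms δ γ) (numPeriods ζ γ) (D γ) ω,
        Real.exp (⟪β, V γ p.1 p.2 ω⟫ - intercept γ) * ⟪u, V γ p.1 p.2 ω⟫ ^ 2 -
        effectiveSize δ ζ γ * ⟪u, Matrix.toEuclideanCLM (𝕜 := ℝ) (informationMatrix S β) u⟫| ≤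
      κ * effectiveSize δ ζ γ * ‖u‖ ^ 2 := by
  set η := κ / (d ^ 2 + 1) with hη
  have hη0 : 0 < η := by positivity
  have h1 := LikelyUpTo.forall_fintype (P := P) (κ := Fin d × Fin d) (fun kl ε (hε : 0 < ε) =>
    h.likely_abs_sum_riskSet_sub_le (memLp_exp_inner_mul_coord (β := β) kl.1 kl.2) hη0 hε) hε
  refine h1.mono ?_
  filter_upwards [eventually_pos_lt_one] with γ hγ ω hω u
  have hγ' := hγ.1
  have hn : 0 < effectiveSize δ ζ γ := effectiveSize_pos hγ'
  rw [inner_informationMatrix h.posDef]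
  set R := riskSet (numFirms δ γ) (numPeriods ζ γ) (D γ) ω
  set n := effectiveSize δ ζ γ
  set μ := multivariateGaussian (0 : EuclideanSpace ℝ (Fin d)) S
  have e1 : ∫ v, Real.exp ⟪β, v⟫ * ⟪u, v⟫ ^ 2 ∂μ =
      ∑ k, ∑ l, u k * u l * ∫ v, Real.exp ⟪β, v⟫ * (v k * v l) ∂μ := by
    have hi : ∀ k l, Integrable (fun v => u k * u l * (Real.exp ⟪β, v⟫ * (v k * v l))) μ :=
      fun k l => ((memLp_exp_inner_mul_coord (β := β) (S := S) k l).integrable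
        (by norm_num)).const_mul _
    calc _ = ∫ v, ∑ k, ∑ l, u k * u l * (Real.exp ⟪β, v⟫ * (v k * v l)) ∂μ := by
          refine integral_congr_ae (ae_of_all _ fun v => ?_)
          simp only [inner_sq_eq_sum, Finset.mul_sum]
          exact Finset.sum_congr rfl fun k _ => Finset.sum_congr rfl fun l _ => by ring
      _ = _ := by
          rw [integral_finsetSum _ fun k _ => integrable_finsetSum _ fun l _ => hi k l]
          refine Finset.sum_congr rfl fun k _ => ?_
          rw [integral_finsetSum _ fun l _ => hi k l]
          exact Finset.sum_congr rfl fun l _ => integral_const_mul _ _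
  have e2 : ∑ p ∈ R, Real.exp (⟪β, V γ p.1 p.2 ω⟫ - intercept γ) * ⟪u, V γ p.1 p.2 ω⟫ ^ 2 =
      ∑ k, ∑ l, u k * u l * (γ * ∑ p ∈ R, Real.exp ⟪β, V γ p.1 p.2 ω⟫ *
        (V γ p.1 p.2 ω k * V γ p.1 p.2 ω l)) := by
    simp_rw [inner_sq_eq_sum, sub_eq_add_neg, Real.exp_add, exp_neg_intercept hγ', Finset.mul_sum]
    rw [Finset.sum_comm]
    refine Finset.sum_congr rfl fun k _ => ?_
    rw [Finset.sum_comm]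
    exact Finset.sum_congr rfl fun l _ => Finset.sum_congr rfl fun p _ => by ring
  rw [e1, e2, Finset.mul_sum, ← Finset.sum_sub_distrib]
  refine (Finset.abs_sum_le_sum_abs _ _).trans ?_
  calc _ ≤ ∑ _k : Fin d, ∑ _l : Fin d, ‖u‖ * ‖u‖ * (η * n) := by
        refine Finset.sum_le_sum fun k _ => ?_
        rw [Finset.mul_sum, ← Finset.sum_sub_distrib]
        refine (Finset.abs_sum_le_sum_abs _ _).trans (Finset.sum_le_sum fun l _ => ?_)
        rw [mul_left_comm n, ← mul_sub, abs_mul, abs_mul]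
        gcongr
        · exact PiLp.norm_apply_le u k
        · exact PiLp.norm_apply_le u l
        · exact hω (k, l)
    _ = d ^ 2 * η * (n * ‖u‖ ^ 2) := by simp; ring
    _ ≤ κ * (n * ‖u‖ ^ 2) := by
        gcongr
        rw [hη, mul_div_assoc', div_le_iff₀ (by positivity)]
        nlinarith
    _ = _ := by ring

end IsDefaultFamily

end DefaultFamily

/-! ### Central limit theorem for the score -/

section ScoreLimit

lemma IsExpLike.abs_scoreWeight_le {q : ℝ → ℝ} {C x₁ x : ℝ} (hq : IsExpLike q C x₁) (hx : x ≤ x₁) :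
    |scoreWeight q x| ≤ 1 + C := by
  have h1 := hq.score x hx
  have hC := hq.one_le
  have h2 : C * Real.exp x ≤ C * 1 := by
    gcongr
    exact Real.exp_le_one_iff.2 (hx.trans hq.nonpos)
  rw [scoreWeight]
  rw [abs_le] at h1 ⊢
  constructor <;> linarith [h1.1, h1.2]

/-- The weight is 1 + O(e^x) and q is e^x + O(e^{2x}), so the predictable variance of the score has
the same leading term as the curvature. -/
lemma IsExpLike.abs_mul_scoreWeight_sq_sub_exp_le {q : ℝ → ℝ} {C x₁ x : ℝ} (hq : IsExpLike q C x₁)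
    (hx : x ≤ x₁) :
    |q x * scoreWeight q x ^ 2 - Real.exp x| ≤ (C ^ 2 * (C + 2) + C) * Real.exp (2 * x) := by
  have hC := hq.one_le
  have h1 : |scoreWeight q x - 1| ≤ C * Real.exp x := hq.score x hx
  have h2 : |scoreWeight q x + 1| ≤ C + 2 := by
    refine (abs_add_le _ _).trans ?_
    rw [abs_one]
    linarith [hq.abs_scoreWeight_le hx]
  have e2 : Real.exp (2 * x) = Real.exp x * Real.exp x := by rw [← Real.exp_add]; ring_nf
  have e : q x * scoreWeight q x ^ 2 - Real.exp x =
      q x * ((scoreWeight q x - 1) * (scoreWeight q x + 1)) + (q x - Real.exp x) := by ring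
  rw [e]
  refine (abs_add_le _ _).trans ?_
  rw [abs_mul, abs_mul, abs_of_nonneg (hq.nonneg x)]
  calc _ ≤ C * Real.exp x * (C * Real.exp x * (C + 2)) + C * Real.exp (2 * x) := by
        gcongr
        · exact hq.le_exp x
        · exact hq.sub_exp x
    _ = _ := by rw [e2]; ring

variable {d : ℕ}

/-- The weight of a covariate vector in the score; vectors of extreme norm are discarded. -/
def scoreCoeff {Ω : Type*} (T : ℕ) (q : ℝ → ℝ) (β : EuclideanSpace ℝ (Fin d)) (a : ℝ)
    (V : ℕ → ℕ → Ω → EuclideanSpace ℝ (Fin d)) (D : ℕ → ℕ → Ω → ℝ) (i t : ℕ) (ω : Ω) : ℝ :=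
  if t ≤ lastTime T D i ω ∧ (‖β‖ + 1) * ‖V i t ω‖ ≤ a / 2 then scoreWeight q (⟪β, V i t ω⟫ - a) else 0

/-- The score at the true parameter without the covariate vectors of extreme norm. -/
def truncatedScore {Ω : Type*} (m T : ℕ) (q : ℝ → ℝ) (β : EuclideanSpace ℝ (Fin d)) (a : ℝ)
    (V : ℕ → ℕ → Ω → EuclideanSpace ℝ (Fin d)) (D : ℕ → ℕ → Ω → ℝ) (ω : Ω) :
    EuclideanSpace ℝ (Fin d) :=
  ∑ p ∈ cells m T, ((D p.1 p.2 ω - hazard T q β a V D p.1 p.2 ω) *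
    scoreCoeff T q β a V D p.1 p.2 ω) • V p.1 p.2 ω

section FixedModel

variable {Ω : Type*} {m T : ℕ} {q : ℝ → ℝ} {β : EuclideanSpace ℝ (Fin d)} {a : ℝ}
  {V : ℕ → ℕ → Ω → EuclideanSpace ℝ (Fin d)} {D : ℕ → ℕ → Ω → ℝ}

/-- The truncation is there to bound the martingale increments; on the likely event that no
covariate is large it removes nothing. -/
lemma truncatedScore_eq_binaryScore (hD : ∀ i < m, ∀ t < T, ∀ ω, D i t ω = 0 ∨ D i t ω = 1) {ω : Ω}
    (hω : ∀ p ∈ cells m T, (‖β‖ + 1) * ‖V p.1 p.2 ω‖ ≤ a / 2) :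
    truncatedScore m T q β a V D ω = binaryScore (riskSet m T D ω) (fun p => D p.1 p.2 ω = 1)
      (fun p => V p.1 p.2 ω) q a β := by
  rw [binaryScore, truncatedScore, riskSet, Finset.sum_filter]
  refine Finset.sum_congr rfl fun p hp => ?_
  have hp' := mem_cells.1 hp
  have e : (if D p.1 p.2 ω = 1 then (1 : ℝ) else 0) = D p.1 p.2 ω := by
    rcases hD _ hp'.1 _ hp'.2 ω with h0 | h0 <;> simp [h0]
  by_cases h : p.2 ≤ lastTime T D p.1 ω
  · simp [scoreCoeff, hazard, h, hω p hp, e]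
  · simp [scoreCoeff, h]

lemma measurable_history_scoreCoeff (hq : Continuous q) {i t : ℕ} (hi : i < m) (ht : t < T) :
    Measurable[history m V D t] (scoreCoeff T q β a V D i t) := by
  have hV : Measurable[history m V D t] (V i t) := measurable_history_covariate hi le_rfl
  unfold scoreCoeff
  refine Measurable.ite ?_ ?_ measurable_const
  · refine MeasurableSet.inter (measurableSet_history_le_lastTime hi ht) ?_
    have : MeasurableSet {v : EuclideanSpace ℝ (Fin d) | (‖β‖ + 1) * ‖v‖ ≤ a / 2} :=
      measurableSet_le (by fun_prop) measurable_const
    exact hV this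
  · have hw : Measurable (scoreWeight q) := by
      unfold scoreWeight
      exact (measurable_deriv q).div (hq.measurable.mul (hq.measurable.const_sub 1))
    have h1 : Measurable fun v : EuclideanSpace ℝ (Fin d) => scoreWeight q (⟪β, v⟫ - a) :=
      hw.comp (by fun_prop)
    exact h1.comp hV

lemma abs_scoreCoeff_mul_inner_le {C x₁ : ℝ} (hq : IsExpLike q C x₁) (ha : -(a / 2) ≤ x₁)
    (ha0 : 0 ≤ a) (ξ : EuclideanSpace ℝ (Fin d)) (i t : ℕ) (ω : Ω) :
    |scoreCoeff T q β a V D i t ω * ⟪V i t ω, ξ⟫| ≤ (1 + C) * ‖ξ‖ * a := by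
  have hC := hq.one_le
  rw [scoreCoeff]
  split_ifs with h
  · have hx : ⟪β, V i t ω⟫ - a ≤ x₁ :=
      (inner_sub_le_neg_half (by linarith : ‖β‖ ≤ ‖β‖ + 1) h.2).trans ha
    have hn : ‖V i t ω‖ ≤ a := by
      nlinarith [norm_nonneg β, norm_nonneg (V i t ω), mul_nonneg (norm_nonneg β) (norm_nonneg (V i t ω))]
    rw [abs_mul]
    calc _ ≤ (1 + C) * (a * ‖ξ‖) := by
          gcongr
          · exact hq.abs_scoreWeight_le hx
          · exact (abs_real_inner_le_norm _ _).trans (by gcongr)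
      _ = _ := by ring
  · rw [zero_mul, abs_zero]; positivity

/-- The limit theorem requires small success probabilities wherever the weight is nonzero;
truncation provides this. -/
lemma scoreCoeff_eq_zero_or {C x₁ : ℝ} (hq : IsExpLike q C x₁) (i t : ℕ) (ω : Ω) :
    scoreCoeff T q β a V D i t ω = 0 ∨ hazard T q β a V D i t ω ≤ C * Real.exp (-(a / 2)) := by
  by_cases h : t ≤ lastTime T D i ω ∧ (‖β‖ + 1) * ‖V i t ω‖ ≤ a / 2
  · right
    rw [hazard, if_pos h.1]
    refine (hq.le_exp _).trans ?_
    have := hq.one_le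
    gcongr
    exact inner_sub_le_neg_half (by linarith) h.2
  · left
    rw [scoreCoeff, if_neg h]

/-- The predictable variance of the score is close to the weighted empirical covariance. -/
lemma abs_sum_hazard_mul_sq_sub_le {C x₁ n κ C₁ : ℝ} (hq : IsExpLike q C x₁) (ha : -(a / 2) ≤ x₁)
    (hn : 0 < n) {ω : Ω} (hω : ∀ p ∈ cells m T, (‖β‖ + 1) * ‖V p.1 p.2 ω‖ ≤ a / 2)
    {ξ : EuclideanSpace ℝ (Fin d)} {J : ℝ}
    (hJ : |∑ p ∈ riskSet m T D ω, Real.exp (⟪β, V p.1 p.2 ω⟫ - a) * ⟪ξ, V p.1 p.2 ω⟫ ^ 2 - n * J| ≤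
      κ * n * ‖ξ‖ ^ 2)
    (hC₁ : Real.exp (-a) * ∑ p ∈ riskSet m T D ω, Real.exp ((2 * ‖β‖ + 2) * ‖V p.1 p.2 ω‖) ≤ C₁ * n) :
    |∑ t ∈ Finset.range T, ∑ i ∈ Finset.range m, hazard T q β a V D i t ω *
      ((√n)⁻¹ * (scoreCoeff T q β a V D i t ω * ⟪V i t ω, ξ⟫)) ^ 2 - J| ≤
      (κ + (C ^ 2 * (C + 2) + C) * C₁ * Real.exp (-a)) * ‖ξ‖ ^ 2 := by
  have hC := hq.one_le
  set C' := C ^ 2 * (C + 2) + C with hC'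
  have hC'0 : 0 ≤ C' := by positivity
  have e1 : ∑ t ∈ Finset.range T, ∑ i ∈ Finset.range m, hazard T q β a V D i t ω *
      ((√n)⁻¹ * (scoreCoeff T q β a V D i t ω * ⟪V i t ω, ξ⟫)) ^ 2 =
      n⁻¹ * ∑ p ∈ riskSet m T D ω, q (⟪β, V p.1 p.2 ω⟫ - a) *
        scoreWeight q (⟪β, V p.1 p.2 ω⟫ - a) ^ 2 * ⟪ξ, V p.1 p.2 ω⟫ ^ 2 := by
    rw [Finset.sum_comm, ← Finset.sum_product', riskSet, Finset.sum_filter, Finset.mul_sum]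
    refine Finset.sum_congr rfl fun p hp => ?_
    by_cases h : p.2 ≤ lastTime T D p.1 ω
    · rw [if_pos h, hazard, if_pos h, scoreCoeff, if_pos ⟨h, hω p hp⟩, mul_pow, inv_pow,
        Real.sq_sqrt hn.le, real_inner_comm ξ]
      ring
    · rw [if_neg h, hazard, if_neg h, zero_mul, mul_zero]
  rw [e1]
  have h2 : |∑ p ∈ riskSet m T D ω, q (⟪β, V p.1 p.2 ω⟫ - a) *
        scoreWeight q (⟪β, V p.1 p.2 ω⟫ - a) ^ 2 * ⟪ξ, V p.1 p.2 ω⟫ ^ 2 -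
      ∑ p ∈ riskSet m T D ω, Real.exp (⟪β, V p.1 p.2 ω⟫ - a) * ⟪ξ, V p.1 p.2 ω⟫ ^ 2| ≤
      C' * ‖ξ‖ ^ 2 * Real.exp (-a) * (C₁ * n) := by
    rw [← Finset.sum_sub_distrib]
    refine (Finset.abs_sum_le_sum_abs _ _).trans ?_
    calc _ ≤ ∑ p ∈ riskSet m T D ω, C' * ‖ξ‖ ^ 2 * Real.exp (-a) *
          (Real.exp (-a) * Real.exp ((2 * ‖β‖ + 2) * ‖V p.1 p.2 ω‖)) := by
          refine Finset.sum_le_sum fun p hp => ?_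
          have hx : ⟪β, V p.1 p.2 ω⟫ - a ≤ x₁ := (inner_sub_le_neg_half
            (by linarith : ‖β‖ ≤ ‖β‖ + 1) (hω p (riskSet_subset hp))).trans ha
          rw [← sub_mul, abs_mul, abs_of_nonneg (sq_nonneg ⟪ξ, V p.1 p.2 ω⟫)]
          have h3 : ⟪ξ, V p.1 p.2 ω⟫ ^ 2 ≤ (‖ξ‖ * Real.exp ‖V p.1 p.2 ω‖) ^ 2 := by
            rw [← sq_abs]
            gcongr
            exact (abs_real_inner_le_norm _ _).trans (by gcongr; exact norm_le_exp_norm _)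
          have h4 : Real.exp (2 * (⟪β, V p.1 p.2 ω⟫ - a)) ≤
              Real.exp (2 * (‖β‖ * ‖V p.1 p.2 ω‖ - a)) := by
            gcongr; exact real_inner_le_norm _ _
          calc _ ≤ C' * Real.exp (2 * (‖β‖ * ‖V p.1 p.2 ω‖ - a)) *
                (‖ξ‖ * Real.exp ‖V p.1 p.2 ω‖) ^ 2 := by
                gcongr
                exact (hq.abs_mul_scoreWeight_sq_sub_exp_le hx).trans (by gcongr)
            _ = _ := by
                rw [mul_pow, ← Real.exp_nat_mul,
                  show 2 * (‖β‖ * ‖V p.1 p.2 ω‖ - a) = 2 * ‖β‖ * ‖V p.1 p.2 ω‖ + (-a + -a) by ring,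
                  show (2 * ‖β‖ + 2) * ‖V p.1 p.2 ω‖ =
                    2 * ‖β‖ * ‖V p.1 p.2 ω‖ + ((2 : ℕ) : ℝ) * ‖V p.1 p.2 ω‖ by push_cast; ring,
                  Real.exp_add, Real.exp_add, Real.exp_add]
                ring
      _ = C' * ‖ξ‖ ^ 2 * Real.exp (-a) * (Real.exp (-a) *
          ∑ p ∈ riskSet m T D ω, Real.exp ((2 * ‖β‖ + 2) * ‖V p.1 p.2 ω‖)) := by
          rw [← Finset.mul_sum, ← Finset.mul_sum]
      _ ≤ _ := by gcongr
  have h3 := abs_add_le _ _ |>.trans (add_le_add h2 hJ)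
  rw [sub_add_sub_cancel] at h3
  have e2 : ∀ y : ℝ, n⁻¹ * y - J = n⁻¹ * (y - n * J) := fun y => by field_simp
  rw [e2, abs_mul, abs_of_pos (inv_pos.2 hn), inv_mul_le_iff₀ hn]
  linarith

lemma inner_smul_truncatedScore (c : ℝ) (ξ : EuclideanSpace ℝ (Fin d)) (ω : Ω) :
    ⟪c • truncatedScore m T q β a V D ω, ξ⟫ = ∑ t ∈ Finset.range T, ∑ i ∈ Finset.range m,
      (D i t ω - hazard T q β a V D i t ω) *
        (c * (scoreCoeff T q β a V D i t ω * ⟪V i t ω, ξ⟫)) := by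
  rw [Finset.sum_comm, ← Finset.sum_product', real_inner_smul_left, truncatedScore, sum_inner,
    Finset.mul_sum]
  refine Finset.sum_congr rfl fun p _ => ?_
  rw [real_inner_smul_left]; ring

end FixedModel

variable {S : Matrix (Fin d) (Fin d) ℝ} {β : EuclideanSpace ℝ (Fin d)}
  {δ ζ : ℝ} {q : ℝ → ℝ} {C x₁ K ρ : ℝ} {Ω : ℝ → Type*} [∀ γ, MeasurableSpace (Ω γ)]
  {P : ∀ γ, Measure (Ω γ)} {V : ∀ γ, ℕ → ℕ → Ω γ → EuclideanSpace ℝ (Fin d)}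
  {D : ∀ γ, ℕ → ℕ → Ω γ → ℝ} {ε : ℝ}

/-- The normalised score. -/
def normalizedScore (δ ζ : ℝ) (q : ℝ → ℝ) (β : EuclideanSpace ℝ (Fin d)) {Ω : ℝ → Type*}
    (V : ∀ γ, ℕ → ℕ → Ω γ → EuclideanSpace ℝ (Fin d)) (D : ∀ γ, ℕ → ℕ → Ω γ → ℝ) (γ : ℝ) (ω : Ω γ) :
    EuclideanSpace ℝ (Fin d) :=
  if 0 < γ ∧ γ < 1 then (√(effectiveSize δ ζ γ))⁻¹ •
    truncatedScore (numFirms δ γ) (numPeriods ζ γ) q β (intercept γ) (V γ) (D γ) ω else 0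

namespace IsDefaultFamily

/-- Convergence in distribution asks for measurability at every γ. The model is specified only for 0
< γ < 1, hence the value zero elsewhere. -/
lemma measurable_normalizedScore (h : IsDefaultFamily S β δ ζ q C x₁ K ρ P V D) (γ : ℝ) :
    Measurable (normalizedScore δ ζ q β V D γ) := by
  by_cases hγ : 0 < γ ∧ γ < 1
  · have e : normalizedScore δ ζ q β V D γ = fun ω => (√(effectiveSize δ ζ γ))⁻¹ •
        truncatedScore (numFirms δ γ) (numPeriods ζ γ) q β (intercept γ) (V γ) (D γ) ω := by
      ext1 ω; rw [normalizedScore, if_pos hγ]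
    rw [e]
    suffices hs : Measurable (truncatedScore (numFirms δ γ) (numPeriods ζ γ) q β (intercept γ) (V γ)
      (D γ)) from hs.const_smul (√(effectiveSize δ ζ γ))⁻¹
    unfold truncatedScore
    refine Finset.measurable_sum _ fun p hp => ?_
    have hp' := mem_cells.1 hp
    have hV := h.covariates γ hγ.1 hγ.2
    have hB := (h.defaults γ hγ.1 hγ.2).isBernoulliScheme hV h.link.cont h.link.nonneg h.link.le_one
    have h1 := hB.measurable _ hp'.1 _ hp'.2
    have h2 := (hB.measurable_prob _ hp'.1 _ hp'.2).mono (hB.le _ hp'.2) le_rfl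
    have h3 := (measurable_history_scoreCoeff (β := β) (a := intercept γ) (V := V γ) (D := D γ)
      h.link.cont hp'.1 hp'.2).mono (hB.le _ hp'.2) le_rfl
    exact ((h1.sub h2).mul h3).smul (hV.measurable _ hp'.1 _ hp'.2)
  · have e : normalizedScore δ ζ q β V D γ = fun _ => 0 := by
      ext1 ω; rw [normalizedScore, if_neg hγ]
    rw [e]; exact measurable_const

variable [∀ γ, IsProbabilityMeasure (P γ)]

lemma likely_abs_variance_sub_le (h : IsDefaultFamily S β δ ζ q C x₁ K ρ P V D)
    (ξ : EuclideanSpace ℝ (Fin d)) {θ : ℝ} (hθ : 0 < θ) (hε : 0 < ε) :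
    LikelyUpTo P ε fun γ ω => |∑ t ∈ Finset.range (numPeriods ζ γ), ∑ i ∈ Finset.range (numFirms δ γ),
      hazard (numPeriods ζ γ) q β (intercept γ) (V γ) (D γ) i t ω * ((√(effectiveSize δ ζ γ))⁻¹ *
        (scoreCoeff (numPeriods ζ γ) q β (intercept γ) (V γ) (D γ) i t ω * ⟪V γ i t ω, ξ⟫)) ^ 2 -
      ⟪ξ, Matrix.toEuclideanCLM (𝕜 := ℝ) (informationMatrix S β) ξ⟫| ≤ θ := by
  obtain ⟨C₁, hC₁, hR⟩ := h.likely_sum_riskSet_exp_le (2 * ‖β‖ + 2)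
  set κ := θ / (2 * (‖ξ‖ ^ 2 + 1)) with hκ
  have hκ0 : 0 < κ := by positivity
  have hκ1 : κ * ‖ξ‖ ^ 2 ≤ θ / 2 := by
    rw [hκ, div_mul_eq_mul_div, div_le_iff₀ (by positivity)]
    nlinarith
  have h3 := ((h.likely_norm_le (‖β‖ + 1) (show 0 < ε / 3 by positivity)).and
    (hR (ε / 3) (by positivity))).and (h.likely_quadratic hκ0 (show 0 < ε / 3 by positivity))
  rw [show ε / 3 + ε / 3 + ε / 3 = ε by ring] at h3
  refine h3.mono ?_
  have hlim : Tendsto (fun γ : ℝ => (C ^ 2 * (C + 2) + C) * C₁ * γ * ‖ξ‖ ^ 2) (𝓝[>] 0) (𝓝 0) := by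
    have : Tendsto (fun γ : ℝ => (C ^ 2 * (C + 2) + C) * C₁ * γ * ‖ξ‖ ^ 2) (𝓝 0)
        (𝓝 ((C ^ 2 * (C + 2) + C) * C₁ * 0 * ‖ξ‖ ^ 2)) := by
      apply Continuous.tendsto; fun_prop
    rw [mul_zero, zero_mul] at this
    exact this.mono_left nhdsWithin_le_nhds
  filter_upwards [eventually_pos_lt_one, hlim.eventually_le_const (half_pos hθ),
    tendsto_intercept.eventually_ge_atTop (-(2 * x₁))] with γ hγ h4 h5 ω ⟨⟨h6, h7⟩, h8⟩
  refine (abs_sum_hazard_mul_sq_sub_le h.link (by linarith) (effectiveSize_pos hγ.1) h6 (h8 ξ)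
    h7).trans ?_
  rw [exp_neg_intercept hγ.1, add_mul]
  linarith

/-- Central limit theorem for the score, in terms of characteristic functions. -/
lemma tendsto_charFun_normalizedScore (h : IsDefaultFamily S β δ ζ q C x₁ K ρ P V D)
    (ξ : EuclideanSpace ℝ (Fin d)) :
    Tendsto (fun γ => ∫ ω, Complex.exp (⟪normalizedScore δ ζ q β V D γ ω, ξ⟫ * Complex.I) ∂(P γ))
      (𝓝[>] 0) (𝓝 (Complex.exp (-(⟪ξ, Matrix.toEuclideanCLM (𝕜 := ℝ) (informationMatrix S β) ξ⟫ / 2 :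
        ℝ)))) := by
  set J := ⟪ξ, Matrix.toEuclideanCLM (𝕜 := ℝ) (informationMatrix S β) ξ⟫ with hJ
  have hJ0 : 0 ≤ J := by
    rw [hJ, inner_informationMatrix h.posDef]
    exact integral_nonneg fun v => by positivity
  have hC := h.link.one_le
  rw [Metric.tendsto_nhds]
  intro η hη
  -- The error estimate has three parts: θ, the probability of an atypical variance times A, and e
  -- times B. Each is made at most η/4.
  set θ := min (η / 4) 1 with hθ
  have hθ0 : 0 < θ := lt_min (by positivity) one_pos
  set A := 4 + Real.exp ((J + 1) / 2) with hA
  have hA0 : 0 < A := by positivity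
  set B := 9 * (J + 1) * Real.exp (10 * (J + 1)) with hB
  have hB0 : 0 < B := by positivity
  set e := min (η / (4 * B)) (1 / 2) with he
  have he0 : 0 < e := lt_min (by positivity) (by norm_num)
  have hlim1 : Tendsto (fun γ => (1 + C) * ‖ξ‖ * (intercept γ / √(effectiveSize δ ζ γ)))
      (𝓝[>] 0) (𝓝 0) := by
    simpa using (tendsto_intercept_div_sqrt h.one_lt).const_mul ((1 + C) * ‖ξ‖)
  have hlim2 : Tendsto (fun γ => C * Real.exp (-(intercept γ / 2))) (𝓝[>] 0) (𝓝 0) := by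
    have := (Real.tendsto_exp_neg_atTop_nhds_zero.comp
      (tendsto_intercept.atTop_div_const (zero_lt_two))).const_mul C
    simpa [Function.comp_def] using this
  filter_upwards [eventually_pos_lt_one, hlim1.eventually_le_const he0, hlim2.eventually_le_const he0,
    tendsto_intercept.eventually_ge_atTop (-(2 * x₁)), tendsto_intercept.eventually_ge_atTop 0,
    h.likely_abs_variance_sub_le ξ hθ0 (show 0 < η / (4 * A) by positivity)]
    with γ hγ h1 h2 h3 h4 h5
  have hn : 0 < effectiveSize δ ζ γ := effectiveSize_pos hγ.1
  have hsn : 0 < √(effectiveSize δ ζ γ) := Real.sqrt_pos.2 hn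
  have hS := (h.defaults γ hγ.1 hγ.2).isBernoulliScheme (h.covariates γ hγ.1 hγ.2) h.link.cont
    h.link.nonneg h.link.le_one
  set m := numFirms δ γ
  set T := numPeriods ζ γ
  set n := effectiveSize δ ζ γ
  set g : ℕ → ℕ → Ω γ → ℝ := fun i t ω => (√n)⁻¹ *
    (scoreCoeff T q β (intercept γ) (V γ) (D γ) i t ω * ⟪V γ i t ω, ξ⟫) with hg
  have hgm : ∀ i < m, ∀ t < T, Measurable[history m (V γ) (D γ) t] (g i t) := by
    intro i hi t ht
    have hw : Measurable fun v : EuclideanSpace ℝ (Fin d) => ⟪v, ξ⟫ := by fun_prop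
    exact ((measurable_history_scoreCoeff h.link.cont hi ht).mul
      (hw.comp (measurable_history_covariate hi le_rfl))).const_mul _
  have key := hS.norm_integral_exp_sub_exp_le hgm he0.le (min_le_right _ _) (J := J) (θ := θ)
    (fun i _ t _ ω => by
      rw [hg]
      simp only []
      rw [abs_mul, abs_of_pos (inv_pos.2 hsn), inv_mul_le_iff₀ hsn]
      refine (abs_scoreCoeff_mul_inner_le h.link (by linarith) h4 ξ i t ω).trans ?_
      rwa [mul_div_assoc', div_le_iff₀ hsn, mul_comm e] at h1)
    (fun i _ t _ ω => by
      rcases scoreCoeff_eq_zero_or (T := T) (β := β) (a := intercept γ) (V := V γ) (D := D γ) h.link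
        i t ω with h0 | h0
      · left; simp only [hg, h0, zero_mul, mul_zero]
      · right; exact h0.trans h2)
    hJ0 hθ0 (min_le_right _ _)
  have e1 : ∀ ω, Complex.exp (⟪normalizedScore δ ζ q β V D γ ω, ξ⟫ * Complex.I) =
      Complex.exp (Complex.I * (∑ t ∈ Finset.range T, ∑ i ∈ Finset.range m,
        (D γ i t ω - hazard T q β (intercept γ) (V γ) (D γ) i t ω) * g i t ω : ℝ)) := by
    intro ω
    rw [normalizedScore, if_pos hγ, inner_smul_truncatedScore, mul_comm]
  simp_rw [e1]
  rw [dist_eq_norm]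
  refine key.trans_lt ?_
  have h6 : (P γ).real {ω | θ < |∑ t ∈ Finset.range T, ∑ i ∈ Finset.range m,
      hazard T q β (intercept γ) (V γ) (D γ) i t ω * g i t ω ^ 2 - J|} ≤ η / (4 * A) := by
    refine le_trans (le_of_eq ?_) h5
    congr 1
    ext ω
    simp only [Set.mem_ofPred_eq, not_le]
    rfl
  have h7 : A * (P γ).real {ω | θ < |∑ t ∈ Finset.range T, ∑ i ∈ Finset.range m,
      hazard T q β (intercept γ) (V γ) (D γ) i t ω * g i t ω ^ 2 - J|} ≤ η / 4 := by
    calc _ ≤ A * (η / (4 * A)) := by gcongr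
      _ = _ := by field_simp
  have h8 : 9 * e * (J + 1) * Real.exp (10 * (J + 1)) ≤ η / 4 := by
    calc _ = e * B := by rw [hB]; ring
      _ ≤ η / (4 * B) * B := by gcongr; exact min_le_left _ _
      _ = _ := by field_simp
  have h9 : θ ≤ η / 4 := min_le_left _ _
  linarith

lemma charFun_gaussian_eq {A : Matrix (Fin d) (Fin d) ℝ} (hA : A.PosSemidef)
    (ξ : EuclideanSpace ℝ (Fin d)) : charFun (multivariateGaussian 0 A) ξ =
      Complex.exp (-(⟪ξ, Matrix.toEuclideanCLM (𝕜 := ℝ) A ξ⟫ / 2 : ℝ)) := by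
  rw [charFun_multivariateGaussian hA, Matrix.inner_toEuclideanCLM]
  simp

lemma tendstoInDistribution_normalizedScore (h : IsDefaultFamily S β δ ζ q C x₁ K ρ P V D) :
    TendstoInDistribution (normalizedScore δ ζ q β V D) (𝓝[>] (0 : ℝ)) id P
      (multivariateGaussian 0 (informationMatrix S β)) := by
  refine tendstoInDistribution_of_tendsto_charFun
    (fun γ => (h.measurable_normalizedScore γ).aemeasurable) fun ξ => ?_
  rw [charFun_gaussian_eq (informationMatrix_posDef h.posDef β).posSemidef]
  exact h.tendsto_charFun_normalizedScore ξ

end IsDefaultFamily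

end ScoreLimit

/-! ### Equivalence with the one-step estimator -/

section Conclusion

variable {d : ℕ}

/-- For T = 0 the two sides may differ: the product up to `lastTime` still contains t = 0, while
there are no cells. -/
lemma likelihood_eq_binaryLikelihood {Ω : Type*} {m T : ℕ} (hT : 0 < T) (q : ℝ → ℝ)
    (V : ℕ → ℕ → Ω → EuclideanSpace ℝ (Fin d)) (D : ℕ → ℕ → Ω → ℝ) (a : ℝ)
    (b : EuclideanSpace ℝ (Fin d)) (ω : Ω) :
    likelihood m T q V D a b ω = binaryLikelihood (riskSet m T D ω) (fun p => D p.1 p.2 ω = 1)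
      (fun p => V p.1 p.2 ω) q a b := by
  rw [likelihood, binaryLikelihood, riskSet, Finset.prod_filter, cells, Finset.prod_product]
  refine Finset.prod_congr rfl fun i _ => ?_
  rw [← Finset.prod_filter]
  refine Finset.prod_congr ?_ fun _ _ => rfl
  ext t
  have := lastTime_le (T := T) (D := D) (i := i) (ω := ω)
  simp only [Finset.mem_range, Finset.mem_filter]
  omega

/-- Exponentials eventually dominate affine functions. -/
lemma exists_forall_affine_lt_exp {c s : ℝ} (hc : 0 < c) (hs : 0 < s) {A B : ℝ} (hA : 0 ≤ A) :
    ∃ R : ℝ, ∀ r ≥ R, A + B * r < Real.exp (s * r) / 2 * c := by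
  refine ⟨max 1 (4 * (A + B) / (c * s ^ 2) + 1), fun r hr => ?_⟩
  have h1 : 1 ≤ r := (le_max_left _ _).trans hr
  have h2 : 4 * (A + B) / (c * s ^ 2) < r := by
    linarith [(le_max_right _ _).trans hr]
  rw [div_lt_iff₀ (by positivity)] at h2
  have h3 := Real.quadratic_le_exp_of_nonneg (show 0 ≤ s * r by positivity)
  have h4 : (s * r) ^ 2 / 2 ≤ Real.exp (s * r) := by nlinarith [mul_pos hs (zero_lt_one.trans_le h1)]
  calc A + B * r ≤ A * r + B * r := by nlinarith
    _ < (s * r) ^ 2 / 2 / 2 * c := by nlinarith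
    _ ≤ _ := by gcongr

lemma norm_exp_mul_I_sub_le (x y : ℝ) :
    ‖Complex.exp (x * Complex.I) - Complex.exp (y * Complex.I)‖ ≤ |x - y| := by
  have e : Complex.exp (x * Complex.I) - Complex.exp (y * Complex.I) =
      Complex.exp (y * Complex.I) * (Complex.exp (Complex.I * ((x - y : ℝ) : ℂ)) - 1) := by
    rw [mul_sub, ← Complex.exp_add, mul_one]
    congr 2
    push_cast; ring
  rw [e, norm_mul, Complex.norm_exp_ofReal_mul_I, one_mul]
  exact Real.norm_exp_I_mul_ofReal_sub_one_le

/-- Slutsky's lemma in quantitative form: variables that are close in probability have close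
characteristic functions. -/
lemma norm_integral_exp_inner_sub_le {Ω : Type*} [MeasurableSpace Ω] {P : Measure Ω}
    [IsProbabilityMeasure P] {X Y : Ω → EuclideanSpace ℝ (Fin d)} (hX : AEMeasurable X P)
    (hY : AEMeasurable Y P) (ξ : EuclideanSpace ℝ (Fin d)) {κ : ℝ} (hκ : 0 ≤ κ) :
    ‖∫ ω, Complex.exp (⟪X ω, ξ⟫ * Complex.I) ∂P - ∫ ω, Complex.exp (⟪Y ω, ξ⟫ * Complex.I) ∂P‖ ≤
      κ * ‖ξ‖ + 2 * P.real {ω | ¬ ‖X ω - Y ω‖ ≤ κ} := by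
  have hi : ∀ Z : Ω → EuclideanSpace ℝ (Fin d), AEMeasurable Z P →
      Integrable (fun ω => Complex.exp (⟪Z ω, ξ⟫ * Complex.I)) P := fun Z hZ => by
    refine Integrable.of_bound (C := 1) ?_ (ae_of_all _ fun ω => ?_)
    · have : Continuous fun v : EuclideanSpace ℝ (Fin d) =>
        Complex.exp ((⟪v, ξ⟫ : ℝ) * Complex.I) := by fun_prop
      exact (this.measurable.comp_aemeasurable hZ).aestronglyMeasurable
    · rw [Complex.norm_exp_ofReal_mul_I]
  -- X and Y are only almost everywhere measurable, so the exceptional event is replaced by a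
  -- measurable hull of equal measure.
  set s := toMeasurable P {ω | ¬ ‖X ω - Y ω‖ ≤ κ} with hs
  have hsm : MeasurableSet s := measurableSet_toMeasurable _ _
  have hsr : P.real s = P.real {ω | ¬ ‖X ω - Y ω‖ ≤ κ} := by
    rw [measureReal_def, measureReal_def, hs, measure_toMeasurable]
  rw [← integral_sub (hi X hX) (hi Y hY)]
  calc _ ≤ ∫ ω, (κ * ‖ξ‖ + s.indicator (fun _ => (2 : ℝ)) ω) ∂P := by
        refine norm_integral_le_of_norm_le ((integrable_const _).add
          ((integrable_const _).indicator hsm)) (ae_of_all _ fun ω => ?_)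
        by_cases hω : ω ∈ s
        · rw [Set.indicator_of_mem hω]
          refine (norm_sub_le _ _).trans ?_
          rw [Complex.norm_exp_ofReal_mul_I, Complex.norm_exp_ofReal_mul_I]
          have : 0 ≤ κ * ‖ξ‖ := by positivity
          linarith
        · rw [Set.indicator_of_notMem hω, add_zero]
          have h1 : ‖X ω - Y ω‖ ≤ κ := by
            by_contra h
            exact hω (subset_toMeasurable _ _ h)
          refine (norm_exp_mul_I_sub_le _ _).trans ?_
          rw [← inner_sub_left]
          exact (abs_real_inner_le_norm _ _).trans (by gcongr)
    _ = _ := by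
        rw [integral_add (integrable_const _) ((integrable_const _).indicator hsm),
          integral_indicator_const _ hsm, integral_const, hsr]
        simp [mul_comm]

variable {S : Matrix (Fin d) (Fin d) ℝ} {β : EuclideanSpace ℝ (Fin d)}
  {δ ζ : ℝ} {q : ℝ → ℝ} {C x₁ K ρ : ℝ} {Ω : ℝ → Type*} [∀ γ, MeasurableSpace (Ω γ)]
  {P : ∀ γ, Measure (Ω γ)} {V : ∀ γ, ℕ → ℕ → Ω γ → EuclideanSpace ℝ (Fin d)}
  {D : ∀ γ, ℕ → ℕ → Ω γ → ℝ} [∀ γ, IsProbabilityMeasure (P γ)] {ε : ℝ}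

namespace IsDefaultFamily

lemma exists_likely_norm_score_le (h : IsDefaultFamily S β δ ζ q C x₁ K ρ P V D) (hε : 0 < ε) :
    ∃ M > 0, LikelyUpTo P ε fun γ ω => ‖normalizedScore δ ζ q β V D γ ω‖ ≤ M := by
  obtain ⟨M, hM, hlim⟩ := h.tendstoInDistribution_normalizedScore.exists_norm_le hε
  refine ⟨M, hM, ?_⟩
  filter_upwards [hlim] with γ hγ
  simpa only [not_le] using hγ.le

/-- The sample at risk is regular with high probability. -/
lemma exists_likely_isRegularSample (h : IsDefaultFamily S β δ ζ q C x₁ K ρ P V D) (hε : 0 < ε) :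
    ∃ C₁ c₁ c₂ s A₀ R₀ C₃ : ℝ, 0 ≤ C₁ ∧ 0 < c₁ ∧ 0 < c₂ ∧ 0 < s ∧ 0 ≤ C₃ ∧ ‖β‖ + 1 ≤ R₀ ∧
      A₀ * (2 * s * d) ≤ 1 / 2 ∧ (1 + 2 * C) * C₁ + C₁ < A₀ * c₁ ∧
      (∀ r ≥ R₀, (C + r) * C₁ + (1 + 2 * C) * C₁ < Real.exp (s * r) / 2 * c₂) ∧
      ∀ κ > 0, LikelyUpTo P ε fun γ ω =>
        IsRegularSample (riskSet (numFirms δ γ) (numPeriods ζ γ) (D γ) ω)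
          (fun p => D γ p.1 p.2 ω = 1) (fun p => V γ p.1 p.2 ω) (intercept γ) (effectiveSize δ ζ γ) β
          (Matrix.toEuclideanCLM (𝕜 := ℝ) (informationMatrix S β)) C₁ c₁ c₂ s R₀ C₃ κ := by
  have hC := h.link.one_le
  have he : 0 < ε / 8 := by positivity
  obtain ⟨C₁a, hC₁a, hda⟩ := h.likely_sum_default_le (‖β‖ + 1) he
  obtain ⟨C₁b, hC₁b, hra⟩ := h.likely_sum_riskSet_exp_le (‖β‖ + 1)
  set C₁ := max C₁a C₁b
  have hC₁ : 0 ≤ C₁ := hC₁a.trans (le_max_left _ _)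
  obtain ⟨c₁, hc₁, hbox₁⟩ := h.likely_default_box
  -- The order of choice matters: A₀ from C₁ and c₁, then the box size s from A₀, then c₂ from s,
  -- then R₀ from C₁, c₂ and s, and C₃ from R₀.
  set A₀ := ((1 + 2 * C) * C₁ + C₁) / c₁ + 1 with hA₀
  have hA₀0 : 0 < A₀ := by positivity
  -- Small enough that ‖b‖ ≤ A₀ a keeps the predictor in the survival boxes below -a/2; d + 1 avoids
  -- dividing by zero when d = 0.
  set s := 1 / (4 * A₀ * (d + 1)) with hs
  have hs0 : 0 < s := by positivity
  obtain ⟨c₂, hc₂, hbox₂⟩ := h.likely_survival_box hs0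
  obtain ⟨R₁, hR₁⟩ := exists_forall_affine_lt_exp (B := C₁) hc₂ hs0
    (show 0 ≤ C * C₁ + (1 + 2 * C) * C₁ by positivity)
  set R₀ := max R₁ (‖β‖ + 1)
  obtain ⟨C₃a, hC₃a, hdb⟩ := h.likely_sum_default_le (3 * R₀ + 3) he
  obtain ⟨C₃b, hC₃b, hrb⟩ := h.likely_sum_riskSet_exp_le (3 * R₀ + 3)
  refine ⟨C₁, c₁, c₂, s, A₀, R₀, max C₃a C₃b, hC₁, hc₁, hc₂, hs0, hC₃a.trans (le_max_left _ _),
    le_max_right _ _, ?_, ?_, fun r hr => ?_, fun κ hκ => ?_⟩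
  · rw [hs, show A₀ * (2 * (1 / (4 * A₀ * (d + 1))) * d) = d / (d + 1) / 2 by field_simp; ring]
    have : (d : ℝ) / (d + 1) ≤ 1 := (div_le_one (by positivity)).2 (by linarith)
    linarith
  · rw [hA₀, add_mul _ 1 c₁, div_mul_cancel₀ _ hc₁.ne']
    linarith
  · linarith [hR₁ r ((le_max_left _ _).trans hr)]
  · have hall := (((h.likely_norm_le R₀ he).and hda).and ((hra _ he).and hdb)).and
      (((hrb _ he).and (hbox₁ _ he)).and ((hbox₂ _ he).and (h.likely_quadratic hκ he)))
    rw [show ε / 8 + ε / 8 + (ε / 8 + ε / 8) + (ε / 8 + ε / 8 + (ε / 8 + ε / 8)) = ε by ring] at hall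
    refine hall.mono ?_
    filter_upwards [eventually_pos_lt_one] with γ hγ ω ⟨⟨⟨h1, h2⟩, h3, h4⟩, ⟨h5, h6⟩, h7, h8⟩
    have hn : 0 < effectiveSize δ ζ γ := effectiveSize_pos hγ.1
    exact
      { norm_le := fun p hp => h1 p (riskSet_subset hp)
        default_exp := h2.trans (by gcongr; exact le_max_left _ _)
        risk_exp := h3.trans (by gcongr; exact le_max_right _ _)
        default_exp' := h4.trans (by gcongr; exact le_max_left _ _)
        risk_exp' := h5.trans (by gcongr; exact le_max_right _ _)
        default_box := h6
        survival_box := h7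
        quadratic := h8 }

/-- The maximum likelihood estimator is asymptotically equivalent to the one-step estimator. -/
lemma likely_norm_sub_oneStep_le (h : IsDefaultFamily S β δ ζ q C x₁ K ρ P V D)
    {βM : ∀ γ, Ω γ → EuclideanSpace ℝ (Fin d)}
    (hMLE : ∀ γ, 0 < γ → γ < 1 → ∀ᵐ ω ∂(P γ),
      (∃ b, IsMLE (numFirms δ γ) (numPeriods ζ γ) q (V γ) (D γ) (intercept γ) ω b) →
      IsMLE (numFirms δ γ) (numPeriods ζ γ) q (V γ) (D γ) (intercept γ) ω (βM γ ω))
    {κ : ℝ} (hκ : 0 < κ) (hε : 0 < ε) :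
    LikelyUpTo P ε fun γ ω => ‖√(effectiveSize δ ζ γ) • (βM γ ω - β) -
      Matrix.toEuclideanCLM (𝕜 := ℝ) (limitCov S β) (normalizedScore δ ζ q β V D γ ω)‖ ≤ κ := by
  have he : 0 < ε / 4 := by positivity
  have hC := h.link.one_le
  set A := Matrix.toEuclideanCLM (𝕜 := ℝ) (informationMatrix S β) with hA
  set B := Matrix.toEuclideanCLM (𝕜 := ℝ) (limitCov S β) with hB
  have hAB : ∀ x, A (B x) = x := fun x => by
    have : A * B = 1 := by rw [hA, hB, ← map_mul, informationMatrix_mul_limitCov h.posDef, map_one]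
    exact DFunLike.congr_fun this x
  have hsym : ∀ x y, ⟪A x, y⟫ = ⟪x, A y⟫ :=
    inner_toEuclideanCLM_comm (informationMatrix_posDef h.posDef β).isHermitian
  obtain ⟨lam, hlam, hlamA⟩ := exists_mul_norm_sq_le_inner_of_posDef (informationMatrix_posDef h.posDef β)
  obtain ⟨C₁, c₁, c₂, s, A₀, R₀, C₃, hC₁, hc₁, hc₂, hs, hC₃, hβ, hsA, hAc, hR₀, hreg⟩ :=
    h.exists_likely_isRegularSample he
  obtain ⟨MU, hMU, hU⟩ := h.exists_likely_norm_score_le he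
  set c₃ := s ^ 2 / 2 * Real.exp (-(‖β‖ * (2 * s * d))) * c₂ with hc₃
  have hc₃0 : 0 < c₃ := by positivity
  set M := max (2 * MU / c₃) (MU / lam) with hM
  have hM1 : 2 * MU ≤ c₃ * M := by
    have := (div_le_iff₀' hc₃0).1 (le_max_left (2 * MU / c₃) (MU / lam)); exact this
  have hM2 : MU ≤ lam * M := by
    have := (div_le_iff₀' hlam).1 (le_max_right (2 * MU / c₃) (MU / lam)); exact this
  -- The precision κ' of the curvature contributes at most κ²/2 to the squared distance; the
  -- remaining error terms tend to zero.
  set κ' := κ ^ 2 * lam / (4 * (M ^ 2 + 1)) with hκ'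
  have hκ'0 : 0 < κ' := by positivity
  have hκ'1 : 4 * M ^ 2 * (κ' / 2) / lam ≤ κ ^ 2 / 2 := by
    rw [hκ', show 4 * M ^ 2 * (κ ^ 2 * lam / (4 * (M ^ 2 + 1)) / 2) / lam =
      κ ^ 2 / 2 * (M ^ 2 / (M ^ 2 + 1)) by field_simp]
    have : M ^ 2 / (M ^ 2 + 1) ≤ 1 := (div_le_one (by positivity)).2 (by linarith)
    exact mul_le_of_le_one_right (by positivity) this
  have hmle : LikelyUpTo P (ε / 4) fun γ ω =>
      (∃ b, IsMLE (numFirms δ γ) (numPeriods ζ γ) q (V γ) (D γ) (intercept γ) ω b) →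
      IsMLE (numFirms δ γ) (numPeriods ζ γ) q (V γ) (D γ) (intercept γ) ω (βM γ ω) := by
    filter_upwards [eventually_pos_lt_one] with γ hγ
    have := ae_iff.1 (hMLE γ hγ.1 hγ.2)
    rw [measureReal_def, this]
    exact he.le
  have hall := ((hreg κ' hκ'0).and hU).and (hmle.and (h.likely_norm_le (‖β‖ + 1) he))
  rw [show ε / 4 + ε / 4 + (ε / 4 + ε / 4) = ε by ring] at hall
  refine hall.mono ?_
  have hsqrt := tendsto_sqrt_effectiveSize (δ := δ) (ζ := ζ) h.one_lt
  have hlim1 : Tendsto (fun γ : ℝ => 4 * C * C₃ * γ) (𝓝[>] 0) (𝓝 0) := by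
    have : Tendsto (fun γ : ℝ => 4 * C * C₃ * γ) (𝓝 0) (𝓝 (4 * C * C₃ * 0)) := by
      apply Continuous.tendsto; fun_prop
    rw [mul_zero] at this
    exact this.mono_left nhdsWithin_le_nhds
  have hlim2 : Tendsto (fun γ => 4 * (M ^ 2 * (4 * C * C₃ * γ / 2 + C₃ * (M / √(effectiveSize δ ζ γ)))) /
      lam) (𝓝[>] 0) (𝓝 0) := by
    simpa using (((((hlim1.div_const 2).add
      ((hsqrt.const_div_atTop M).const_mul C₃)).const_mul (M ^ 2)).const_mul 4).div_const lam)
  filter_upwards [eventually_pos_lt_one, hlim1.eventually_le_const hc₃0,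
    hlim2.eventually_le_const (show 0 < κ ^ 2 / 2 by positivity), hsqrt.eventually_ge_atTop M,
    tendsto_intercept.eventually_ge_atTop (-(2 * x₁)), tendsto_intercept.eventually_ge_atTop 1,
    tendsto_intercept.eventually_ge_atTop (Real.log C),
    (tendsto_numPeriods h.periods_pos).eventually_gt_atTop 0]
    with γ hγ k1 k2 k3 k4 k5 k6 hT ω ⟨⟨hr, hu⟩, hml, hnorm⟩
  have hγ' := hγ.1
  have hn : 0 < effectiveSize δ ζ γ := effectiveSize_pos hγ'
  have hsn : 0 < √(effectiveSize δ ζ γ) := Real.sqrt_pos.2 hn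
  have ha : -(intercept γ / 2) ≤ x₁ := by linarith
  have hlt : ∀ b, R₀ ≤ ‖b‖ → binaryLikelihood (riskSet (numFirms δ γ) (numPeriods ζ γ) (D γ) ω)
      (fun p => D γ p.1 p.2 ω = 1) (fun p => V γ p.1 p.2 ω) q (intercept γ) b <
      binaryLikelihood (riskSet (numFirms δ γ) (numPeriods ζ γ) (D γ) ω)
      (fun p => D γ p.1 p.2 ω = 1) (fun p => V γ p.1 p.2 ω) q (intercept γ) β := fun b hb =>
    binaryLikelihood_lt_of_le_norm h.link hn k5 ha
      ((Real.log_le_iff_le_exp (by linarith)).1 k6)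
      (fun p hp => (by gcongr; linarith : ‖β‖ * ‖V γ p.1 p.2 ω‖ ≤ R₀ * ‖V γ p.1 p.2 ω‖).trans
        (hr.norm_le p hp)) hs hsA hC₁ hc₁ hAc hR₀ hr.default_exp hr.risk_exp hr.default_box
      hr.survival_box hb
  -- Existence of a maximum releases the hypothesis on the estimator.
  have hex := exists_isMax_binaryLikelihood h.link.cont (by linarith : ‖β‖ ≤ R₀) hlt
  simp only [IsMLE, likelihood_eq_binaryLikelihood hT] at hml
  have hmax := hml hex
  rw [normalizedScore, if_pos hγ, truncatedScore_eq_binaryScore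
    (h.defaults γ hγ.1 hγ.2).zero_or_one hnorm] at hu ⊢
  rw [norm_smul, norm_inv, Real.norm_of_nonneg hsn.le, inv_mul_le_iff₀ hsn, mul_comm] at hu
  rw [← exp_neg_intercept hγ'] at k1
  have key := hr.norm_sub_oneStep_le h.link hn ha hs hβ hlt hc₃ hc₃0 k1 hC₃ hκ'0.le hsym hlam hlamA
    hAB hu hM1 hM2 k3 hmax
  refine abs_le_of_sq_le_sq' ?_ hκ.le |>.2
  refine key.trans ?_
  rw [exp_neg_intercept hγ']
  calc _ = 4 * M ^ 2 * (κ' / 2) / lam +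
        4 * (M ^ 2 * (4 * C * C₃ * γ / 2 + C₃ * (M / √(effectiveSize δ ζ γ)))) / lam := by ring
    _ ≤ κ ^ 2 / 2 + κ ^ 2 / 2 := add_le_add hκ'1 k2
    _ = κ ^ 2 := by ring

/-- Asymptotic normality of the maximum likelihood estimator. -/
lemma tendstoInDistribution_mle (h : IsDefaultFamily S β δ ζ q C x₁ K ρ P V D)
    {βM : ∀ γ, Ω γ → EuclideanSpace ℝ (Fin d)} (hβM : ∀ γ, AEMeasurable (βM γ) (P γ))
    (hMLE : ∀ γ, 0 < γ → γ < 1 → ∀ᵐ ω ∂(P γ),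
      (∃ b, IsMLE (numFirms δ γ) (numPeriods ζ γ) q (V γ) (D γ) (intercept γ) ω b) →
      IsMLE (numFirms δ γ) (numPeriods ζ γ) q (V γ) (D γ) (intercept γ) ω (βM γ ω)) :
    TendstoInDistribution (fun γ ω => γ ^ (-(δ + ζ - 1) / 2) • (βM γ ω - β)) (𝓝[>] (0 : ℝ))
      (id : EuclideanSpace ℝ (Fin d) → EuclideanSpace ℝ (Fin d)) P
      (multivariateGaussian 0 (limitCov S β)) := by
  have hX : ∀ γ, AEMeasurable (fun ω => γ ^ (-(δ + ζ - 1) / 2) • (βM γ ω - β)) (P γ) := fun γ =>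
    ((hβM γ).sub_const β).const_smul (γ ^ (-(δ + ζ - 1) / 2))
  refine tendstoInDistribution_of_tendsto_charFun hX fun ξ => ?_
  rw [charFun_gaussian_eq (limitCov_posDef h.posDef β).posSemidef]
  set A := Matrix.toEuclideanCLM (𝕜 := ℝ) (informationMatrix S β) with hA
  set B := Matrix.toEuclideanCLM (𝕜 := ℝ) (limitCov S β) with hB
  have hAB : A (B ξ) = ξ := by
    have : A * B = 1 := by rw [hA, hB, ← map_mul, informationMatrix_mul_limitCov h.posDef, map_one]
    exact DFunLike.congr_fun this ξ
  have hsymB : ∀ x y, ⟪B x, y⟫ = ⟪x, B y⟫ :=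
    inner_toEuclideanCLM_comm (limitCov_posDef h.posDef β).isHermitian
  -- By symmetry of B, the characteristic function of the score at Bξ is that of B applied to the
  -- score, evaluated at ξ; and ⟪Bξ, A Bξ⟫ = ⟪ξ, Bξ⟫ is the limit variance.
  have h1 := h.tendsto_charFun_normalizedScore (B ξ)
  rw [← hA, hAB, hsymB] at h1
  refine (tendsto_iff_of_dist ?_).1 h1
  rw [Metric.tendsto_nhds]
  intro η hη
  set κ := η / (4 * (‖ξ‖ + 1)) with hκ
  have hκ0 : 0 < κ := by positivity
  filter_upwards [eventually_pos_lt_one, h.likely_norm_sub_oneStep_le hMLE hκ0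
    (show 0 < η / 8 by positivity)] with γ hγ h2
  rw [sqrt_effectiveSize hγ.1] at h2
  have hBm : Measurable fun v : EuclideanSpace ℝ (Fin d) => B v := B.continuous.measurable
  have h3 := norm_integral_exp_inner_sub_le (hX γ)
    (hBm.comp (h.measurable_normalizedScore γ)).aemeasurable ξ hκ0.le
  simp only [Function.comp_apply, hsymB] at h3
  rw [Real.dist_eq, sub_zero, abs_of_nonneg dist_nonneg, dist_comm, dist_eq_norm]
  refine h3.trans_lt ?_
  have h4 : κ * ‖ξ‖ ≤ η / 4 := by
    rw [hκ, div_mul_eq_mul_div, div_le_iff₀ (by positivity)]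
    nlinarith [norm_nonneg ξ]
  linarith

end IsDefaultFamily

end Conclusion

end

/-! ### The theorem -/

theorem theorem2
    {d : ℕ} (S : Matrix (Fin d) (Fin d) ℝ) (hS : S.PosDef)
    (β : EuclideanSpace ℝ (Fin d))
    (δ ζ : ℝ) (hδ : 0 < δ) (hζ₀ : 0 < ζ) (hζ₁ : ζ < 1) (hδζ : 1 < δ + ζ)
    -- the parametric family of default probabilities
    (h : ℝ → ℝ) (hq : ∀ x, 0 ≤ link h x ∧ link h x ≤ 1)
    (hh : IsSmoothRemainder S β h)
    -- the sequence of models, indexed by the rarity parameter `γ`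
    (K ρ : ℝ) (hρ₀ : 0 < ρ) (hρ₁ : ρ < 1)
    {Ω : ℝ → Type*} [∀ γ, MeasurableSpace (Ω γ)]
    (P : ∀ γ, Measure (Ω γ)) [∀ γ, IsProbabilityMeasure (P γ)]
    (V : ∀ γ, ℕ → ℕ → Ω γ → EuclideanSpace ℝ (Fin d))
    (D : ∀ γ, ℕ → ℕ → Ω γ → ℝ)
    (hV : ∀ γ, 0 < γ → γ < 1 →
      IsCovariateProcess (P γ) (numFirms δ γ) (numPeriods ζ γ) S K ρ (V γ))
    (hD : ∀ γ, 0 < γ → γ < 1 →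
      IsDefaultProcess (P γ) (numFirms δ γ) (numPeriods ζ γ) (link h) β (intercept γ) (V γ) (D γ))
    -- the maximum likelihood estimator: it maximises the likelihood whenever that is possible
    (βM : ∀ γ, Ω γ → EuclideanSpace ℝ (Fin d)) (hβM : ∀ γ, AEMeasurable (βM γ) (P γ))
    (hMLE : ∀ γ, 0 < γ → γ < 1 → ∀ᵐ ω ∂(P γ),
      (∃ b, IsMLE (numFirms δ γ) (numPeriods ζ γ) (link h) (V γ) (D γ) (intercept γ) ω b) →
      IsMLE (numFirms δ γ) (numPeriods ζ γ) (link h) (V γ) (D γ) (intercept γ) ω (βM γ ω)) :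
    TendstoInDistribution
      (fun γ ω => γ ^ (-(δ + ζ - 1) / 2) • (βM γ ω - β))
      (𝓝[>] (0 : ℝ)) (id : EuclideanSpace ℝ (Fin d) → EuclideanSpace ℝ (Fin d)) P
      (multivariateGaussian 0 (limitCov S β)) ∧
    IsBigOP P (fun γ ω => ‖βM γ ω - β‖ ^ 2) (fun γ => γ ^ (δ + ζ - 1)) := by
  obtain ⟨C, x₁, hlink⟩ := hh.exists_isExpLike hS hq
  have hF : IsDefaultFamily S β δ ζ (link h) C x₁ K ρ P V D :=
    ⟨hS, hδ, hζ₀, hζ₁, hδζ, hlink, hρ₀, hρ₁, hV, hD⟩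
  have hlim := hF.tendstoInDistribution_mle hβM hMLE
  refine ⟨hlim, fun ε hε => ?_⟩
  obtain ⟨M, hM, hbound⟩ := hlim.exists_norm_le hε
  refine ⟨M ^ 2, by positivity, ?_⟩
  filter_upwards [hbound, eventually_pos_lt_one] with γ h1 hγ
  refine lt_of_le_of_lt (measureReal_mono fun ω hω => ?_) h1
  have hω' : M ^ 2 < |‖βM γ ω - β‖ ^ 2 / γ ^ (δ + ζ - 1)| := hω
  -- The ratio in the rate statement is the squared norm of the rescaled error, so the tightness
  -- bound M enters as M².
  have e : ‖γ ^ (-(δ + ζ - 1) / 2) • (βM γ ω - β)‖ ^ 2 =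
      |‖βM γ ω - β‖ ^ 2 / γ ^ (δ + ζ - 1)| := by
    rw [abs_of_nonneg (div_nonneg (sq_nonneg _) (Real.rpow_nonneg hγ.1.le _)), norm_smul, mul_pow,
      Real.norm_of_nonneg (Real.rpow_nonneg hγ.1.le _), ← Real.rpow_mul_natCast hγ.1.le,
      show -(δ + ζ - 1) / 2 * (2 : ℕ) = -(δ + ζ - 1) by push_cast; ring, Real.rpow_neg hγ.1.le]
    ring
  rw [← e] at hω'
  exact lt_of_pow_lt_pow_left₀ 2 (norm_nonneg _) hω'
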